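/- Let $0<a<2$, and for $0\le\theta\le\pi/2$ let $\Gamma_0,\Gamma_1,\Gamma_2$ be the rays from the origin, oriented towards infinity, with $\arg\xi=-\frac{\pi}{2}-2\theta$, $\frac{\pi}{4}-2\theta$, $\frac{3\pi}{4}-2\theta$ respectively, $\Gamma=\Gamma_0\cup\Gamma_1\cup\Gamma_2$. All powers of $\xi$ are taken on the plane cut along $\Gamma_0$ with $-\frac{\pi}{2}-2\theta<\arg\xi<\frac{3\pi}{2}-2\theta$. Let $\sigma_3=\mathrm{diag}(1,-1)$ and $T=\begin{pmatrix}\frac12&-\frac i2\\ \frac12&\frac i2\end{pmatrix}$. The Hankel functions $H^{(1,2)}_\nu$ are considered on the universal covering of $\mathbb C\setminus\{0\}$, and $\frac i2\sqrt\xi$ is the point of it with $i=e^{i\pi/2}$. Put $$\Psi^{(0)}(\xi)=\frac{\sqrt\pi}{2}\begin{pmatrix}\frac12&0\\0&2\xi\end{pmatrix}\begin{pmatrix}H^{(2)}_{-a/2}(\frac i2\sqrt\xi)&H^{(1)}_{-a/2}(\frac i2\sqrt\xi)\\ \frac{d}{d\xi}H^{(2)}_{-a/2}(\frac i2\sqrt\xi)&\frac{d}{d\xi}H^{(1)}_{-a/2}(\frac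 i2\sqrt\xi)\end{pmatrix}e^{\frac{\pi i a}{4}\sigma_3}\,F(\xi),$$ where $F=I$ for $-\frac\pi2-2\theta<\arg\xi<\frac\pi4-2\theta$, $F=\begin{pmatrix}1&0\\e^{i\pi a/2}&1\end{pmatrix}$ for $\frac\pi4-2\theta<\arg\xi<\frac{3\pi}4-2\theta$, and $F=\begin{pmatrix}1&0\\2\cos\frac{\pi a}{2}&1\end{pmatrix}$ for $\frac{3\pi}4-2\theta<\arg\xi<\frac{3\pi}2-2\theta$. Then, for every $\theta\in[0,\pi/2]$, $\Psi=\Psi^{(0)}$ solves the following model Riemann–Hilbert problem. 1. $\Psi$ is analytic on $\mathbb C\setminus\Gamma$. 2. On $\Gamma_k\setminus\{0\}$ the boundary values $\Psi_\pm$ from the left ($+$) and right ($-$) side exist and $\Psi_+=\Psi_-L_k$, with $L_0=\begin{pmatrix}0&1\\-1&0\end{pmatrix}$, $L_1=\begin{pmatrix}1&0\\e^{i\pi a/2}&1\end{pmatrix}$, $L_2=\begin{pmatrix}1&0\\e^{-i\pi a/2}&1\end{pmatrix}$. 3. $\Psi(\xi)=\xi^{-\frac14\sigma_3}\,T\,\bigl(I+O(\xi^{-1/2})\bigr)e^{\frac12\sqrt\xi\sigma_3}$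 as $\xi\to\infty$, $\xi\notin\Gamma$. 4. As $\xi\to0$, $\xi\notin\Gamma$, $\Psi(\xi)=E(\xi)\,\xi^{-\frac a4\sigma_3}C_0(\xi)$, where $E$ is holomorphic at $0$, $\det E\equiv\frac i2$, $E(\xi)=B_0(I+O(\xi))$ with a constant matrix $B_0$, and $C_0=\begin{pmatrix}1&\frac{1}{2i\sin(\pi a/2)}\\0&1\end{pmatrix}G$ with $G=\begin{pmatrix}1&0\\-e^{i\pi a/2}&1\end{pmatrix}$, $I$, $\begin{pmatrix}1&0\\e^{-i\pi a/2}&1\end{pmatrix}$ in the three sectors above, in the same order. Moreover, as $\xi\to\infty$, $\xi\notin\Gamma$, it has the refined expansion $$\Psi^{(0)}(\xi)=\xi^{-\frac14\sigma_3}\Bigl(I+\frac{1}{\sqrt\xi}\Psi_1+O\bigl(\tfrac1\xi\bigr)\Bigr)T\,e^{\frac12\sqrt\xi\sigma_3},\qquad \Psi_1=\begin{pmatrix}0&\psi_1\\ \psi_1-1&0\end{pmatrix},\quad \psi_1=\frac{1-a^2}{4},$$ where the bound in $O(1/\xi)$ depends only on $a$ (it is uniform in $\arg\xi$ and in $\theta\in[0,\pi/2]$).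 -/

import Mathlib

open Filter Topology Asymptotics

noncomputable section

namespace ModelRH

/-! ### Bessel and Hankel functions on the universal covering of the punctured plane

A point of the universal covering of `ℂ ∖ {0}` is given by its logarithm `w`,
so that `z = e ^ w` and `arg z = w.im` may be any real number. -/

/-- `J_ν(z)` at the point `z = e ^ w` of the universal covering,
`J_ν(z) = ∑ (-1)^j / (j! Γ(ν + j + 1)) (z / 2)^(2j + ν)`. -/
def besselJ (ν w : ℂ) : ℂ :=
  ∑' j : ℕ, (-1 : ℂ) ^ j / ((j.factorial : ℂ) * Complex.Gamma (ν + j + 1)) *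
    Complex.exp ((2 * j + ν) * (w - (Real.log 2 : ℝ)))

/-- The Hankel function `H^{(1)}_ν(z)` of non-integer order `ν`, at `z = e ^ w`. -/
def hankel1 (ν w : ℂ) : ℂ :=
  (besselJ (-ν) w - Complex.exp (-(Complex.I * ν * Real.pi)) * besselJ ν w) /
    (Complex.I * Complex.sin (Real.pi * ν))

/-- The Hankel function `H^{(2)}_ν(z)` of non-integer order `ν`, at `z = e ^ w`. -/
def hankel2 (ν w : ℂ) : ℂ :=
  (Complex.exp (Complex.I * ν * Real.pi) * besselJ ν w - besselJ (-ν) w) /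
    (Complex.I * Complex.sin (Real.pi * ν))

/-! ### Branches -/

/-- The logarithm of `ξ` on the plane cut along the ray `arg ξ = -π/2 - 2θ`, with
`-π/2 - 2θ < arg ξ < 3π/2 - 2θ` off the cut. -/
def logBr (θ : ℝ) (ξ : ℂ) : ℂ :=
  Complex.log (ξ * Complex.exp (-(((Real.pi / 2 - 2 * θ : ℝ) : ℂ) * Complex.I))) +
    ((Real.pi / 2 - 2 * θ : ℝ) : ℂ) * Complex.I

/-- The corresponding branch of `arg ξ`. -/
def argBr (θ : ℝ) (ξ : ℂ) : ℝ := (logBr θ ξ).im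

/-- The corresponding branch of `√ξ`. -/
def sqrtBr (θ : ℝ) (ξ : ℂ) : ℂ := Complex.exp (logBr θ ξ / 2)

/-- The logarithm of the point `(i/2) √ξ` of the universal covering, where `i = e^{iπ/2}`. -/
def logArg (θ : ℝ) (ξ : ℂ) : ℂ :=
  logBr θ ξ / 2 + ((Real.pi / 2 : ℝ) : ℂ) * Complex.I - (Real.log 2 : ℝ)

/-! ### Contour and sectors -/

/-- The closed ray from the origin in the direction `φ`. -/
def ray (φ : ℝ) : Set ℂ := {ξ | ∃ r : ℝ, 0 ≤ r ∧ ξ = r * Complex.exp (φ * Complex.I)}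

/-- Directions of the rays `Γ₀`, `Γ₁`, `Γ₂`. -/
def dir (θ : ℝ) : Fin 3 → ℝ :=
  ![-Real.pi / 2 - 2 * θ, Real.pi / 4 - 2 * θ, 3 * Real.pi / 4 - 2 * θ]

/-- The contour `Γ₀ ∪ Γ₁ ∪ Γ₂`; the origin belongs to it. -/
def contour (θ : ℝ) : Set ℂ := ⋃ k : Fin 3, ray (dir θ k)

/-- The sector `α < arg ξ < β`. -/
def sector (θ α β : ℝ) : Set ℂ := {ξ | ξ ≠ 0 ∧ α < argBr θ ξ ∧ argBr θ ξ < β}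

/-- The sector between `Γ₀` and `Γ₁`. -/
def sector01 (θ : ℝ) : Set ℂ :=
  sector θ (-Real.pi / 2 - 2 * θ) (Real.pi / 4 - 2 * θ)

/-- The sector between `Γ₁` and `Γ₂`. -/
def sector12 (θ : ℝ) : Set ℂ :=
  sector θ (Real.pi / 4 - 2 * θ) (3 * Real.pi / 4 - 2 * θ)

/-- The sector between `Γ₂` and `Γ₀`. -/
def sector20 (θ : ℝ) : Set ℂ :=
  sector θ (3 * Real.pi / 4 - 2 * θ) (3 * Real.pi / 2 - 2 * θ)

/-- The sector on the left (plus) side of `Γ_k`; each ray is oriented towards infinity. -/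
def plusSide (θ : ℝ) : Fin 3 → Set ℂ := ![sector01 θ, sector12 θ, sector20 θ]

/-- The sector on the right (minus) side of `Γ_k`. -/
def minusSide (θ : ℝ) : Fin 3 → Set ℂ := ![sector20 θ, sector01 θ, sector12 θ]

/-! ### Constant matrices -/

/-- `e^{w σ₃}`. -/
def expSigma (w : ℂ) : Matrix (Fin 2) (Fin 2) ℂ :=
  !![Complex.exp w, 0; 0, Complex.exp (-w)]

/-- Lower triangular unipotent matrix. -/
def lower (c : ℂ) : Matrix (Fin 2) (Fin 2) ℂ := !![1, 0; c, 1]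

/-- The matrix `T` of the normalization at infinity. -/
def matT : Matrix (Fin 2) (Fin 2) ℂ :=
  !![1 / 2, -(Complex.I / 2); 1 / 2, Complex.I / 2]

/-- The jump matrix on `Γ_k`. -/
def jump (a : ℝ) : Fin 3 → Matrix (Fin 2) (Fin 2) ℂ :=
  ![!![0, 1; -1, 0],
    lower (Complex.exp (Complex.I * Real.pi * a / 2)),
    lower (Complex.exp (-(Complex.I * Real.pi * a / 2)))]

/-- The piecewise constant matrix `C₀` in the condition at the origin. Only its values off the
contour matter. -/
def matC (a θ : ℝ) (ξ : ℂ) : Matrix (Fin 2) (Fin 2) ℂ :=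
  !![1, 1 / (2 * Complex.I * Complex.sin (Real.pi * a / 2)); 0, 1] *
    (if argBr θ ξ < Real.pi / 4 - 2 * θ then
      lower (-Complex.exp (Complex.I * Real.pi * a / 2))
    else if argBr θ ξ < 3 * Real.pi / 4 - 2 * θ then 1
    else lower (Complex.exp (-(Complex.I * Real.pi * a / 2))))

/-! ### The model Riemann–Hilbert problem -/

/-- `Ψ` solves the model Riemann–Hilbert problem with parameters `a` and `θ`. -/
structure SolvesModelRHP (a θ : ℝ) (Ψ : ℂ → Matrix (Fin 2) (Fin 2) ℂ) : Prop where
  /-- `Ψ` is analytic off the contour. -/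
  analytic : ∀ i j, DifferentiableOn ℂ (fun ξ => Ψ ξ i j) (contour θ)ᶜ
  /-- `Ψ` has boundary values on both sides of each ray, and `Ψ₊ = Ψ₋ L_k` on `Γ_k ∖ {0}`. -/
  jumps : ∀ k : Fin 3, ∀ ξ ∈ ray (dir θ k), ξ ≠ 0 →
    ∃ Ψp Ψm : Matrix (Fin 2) (Fin 2) ℂ,
      Tendsto Ψ (𝓝[plusSide θ k] ξ) (𝓝 Ψp) ∧
      Tendsto Ψ (𝓝[minusSide θ k] ξ) (𝓝 Ψm) ∧
      Ψp = Ψm * jump a k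
  /-- `Ψ(ξ) = ξ^{-σ₃/4} T (I + O(1/√ξ)) e^{√ξ σ₃ / 2}` as `ξ → ∞`. -/
  infinity : ∃ R : ℂ → Matrix (Fin 2) (Fin 2) ℂ,
    (∀ i j, (fun ξ => R ξ i j) =O[Bornology.cobounded ℂ ⊓ 𝓟 (contour θ)ᶜ]
      (fun ξ => (sqrtBr θ ξ)⁻¹)) ∧
    ∀ᶠ ξ in Bornology.cobounded ℂ ⊓ 𝓟 (contour θ)ᶜ,
      Ψ ξ = expSigma (-(logBr θ ξ / 4)) * matT * (1 + R ξ) * expSigma (sqrtBr θ ξ / 2)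
  /-- `Ψ(ξ) = E(ξ) ξ^{-a σ₃ / 4} C₀` near `ξ = 0`, where `E` is holomorphic at `0`,
  `det E = i/2`, and `E(ξ) = B₀ (I + O(ξ))`. -/
  zero : ∃ (B₀ : Matrix (Fin 2) (Fin 2) ℂ) (E R : ℂ → Matrix (Fin 2) (Fin 2) ℂ),
    (∀ i j, AnalyticAt ℂ (fun ξ => E ξ i j) 0) ∧
    (∀ᶠ ξ in 𝓝 (0 : ℂ), (E ξ).det = Complex.I / 2) ∧
    (∀ i j, (fun ξ => R ξ i j) =O[𝓝 (0 : ℂ)] (fun ξ => ξ)) ∧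
    (∀ᶠ ξ in 𝓝 (0 : ℂ), E ξ = B₀ * (1 + R ξ)) ∧
    ∀ᶠ ξ in 𝓝 (0 : ℂ) ⊓ 𝓟 (contour θ)ᶜ,
      Ψ ξ = E ξ * expSigma (-(a * logBr θ ξ / 4)) * matC a θ ξ

/-! ### The explicit solution -/

/-- The matrix of `H^{(2)}_{-a/2}((i/2)√ξ)`, `H^{(1)}_{-a/2}((i/2)√ξ)` (first row) and of their
derivatives in `ξ` (second row). -/
def hankelMatrix (a θ : ℝ) (ξ : ℂ) : Matrix (Fin 2) (Fin 2) ℂ :=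
  !![hankel2 (-(a / 2)) (logArg θ ξ), hankel1 (-(a / 2)) (logArg θ ξ);
    deriv (fun η => hankel2 (-(a / 2)) (logArg θ η)) ξ,
    deriv (fun η => hankel1 (-(a / 2)) (logArg θ η)) ξ]

/-- The sectorwise constant right factor. Only its values off the contour matter. -/
def rightFactor (a θ : ℝ) (ξ : ℂ) : Matrix (Fin 2) (Fin 2) ℂ :=
  if argBr θ ξ < Real.pi / 4 - 2 * θ then 1
  else if argBr θ ξ < 3 * Real.pi / 4 - 2 * θ then
    lower (Complex.exp (Complex.I * Real.pi * a / 2))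
  else lower (2 * Complex.cos (Real.pi * a / 2))

/-- The explicit matrix function built from Hankel functions. -/
def Psi0 (a θ : ℝ) (ξ : ℂ) : Matrix (Fin 2) (Fin 2) ℂ :=
  ((Real.sqrt Real.pi / 2 : ℝ) : ℂ) •
    (!![1 / 2, 0; 0, 2 * ξ] * hankelMatrix a θ ξ *
      expSigma (Real.pi * Complex.I * a / 4) * rightFactor a θ ξ)

/-- `ψ₁ = (1 - a²) / 4`. -/
def psi1 (a : ℝ) : ℂ := (1 - (a : ℂ) ^ 2) / 4

/-- The off-diagonal coefficient `Ψ₁` of the expansion at infinity. -/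
def Psi1 (a : ℝ) : Matrix (Fin 2) (Fin 2) ℂ := !![0, psi1 a; psi1 a - 1, 0]

end ModelRH

end

/-!
Away from the cut, `Ψ⁽⁰⁾` is a constant multiple of a matrix built from the Macdonald function.
With `b = a / 2` and `x = √ξ / 2 = e ^ w`, the two Hankel functions at `i x` are constant multiples
of `K_b(x e^{iπ})` and `K_b(x)` (`hankel1_neg_eq`, `hankel2_neg_eq`), so that `Ψ⁽⁰⁾` is
`coreMatrix b w`, an entire function of `w`, times a constant matrix in each sector (`Psi0_eq`).
Analyticity is then immediate, and so are the jumps on `Γ₁` and `Γ₂`. Crossing `Γ₀` changes `w`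
by `iπ`, and the jump there is the relation
`K_b(x e^{iπ}) + K_b(x e^{-iπ}) = 2 cos(π b) K_b(x)` (`coreMatrix_monodromy`).

At the origin, `K_b` is a combination of `I_b` and `I_{-b}`, and `I_μ(x) = (x / 2)^μ Φ_μ(x² / 4)`
with `Φ_μ` entire. Since `K_b(x e^{iπ}) - e^{iπb} K_b(x)` is a multiple of `I_{-b}(x)` alone, this
yields the local representation with an explicit entire factor `localE`, whose determinant is the
Wronskian of `I_b` and `I_{-b}` (`coreMatrix_mul_lower_eq`, `det_localE`).

At infinity, everything rests on the expansion
`K_b(x) = √(π / 2x) e^{-x} (1 + (4b² - 1) / (8x) + O(x⁻²))`, uniformly for `|arg x| ≤ 11π/8`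
(`besselK_asymptotic`). For `|arg x| < π/2`, the power series for `K_b` and the integral
`½ ∫ exp (b u - x cosh u) du` agree, because they have the same Wronskians with `I_b` and `I_{-b}`
(`besselQ_eq_besselK`). The substitution `s = sinh (u / 2)` turns the integral into a Gaussian
integral of `cosh (2 b arsinh s) / √(1 + s²)`. Its line of integration can be rotated: the rotated
integral is analytic in a strip of half-width `π` in `w` and agrees with `e^x K_b(x)` on the central
line of the strip, hence on the whole strip (`exp_mul_besselK_eq_rotatedIntegral`). A Taylor
expansion of the kernel and two such rotations cover the closed sector. The derivative reduces to
`K_b` and `K_{1-b}`. In each of the three sectors the first column of `Ψ⁽⁰⁾` is, up to an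
exponentially small term, a Macdonald function at `x e^{iπ}` or `x e^{-iπ}`, at an argument within
the closed sector for every `θ` in `[0, π/2]` (`Psi0_columns`), which gives uniformity in `θ`.
-/

noncomputable section

namespace ModelRH

/-! ### The entire functions `Φ_μ` -/

/-- The entire function `Φ_μ(y) = ∑ y^j / (j! Γ(μ + j + 1))`, the common power series part of the
Bessel functions `J_{μ}` and `I_{μ}`. -/
def besselPhi (μ y : ℂ) : ℂ :=
  ∑' j : ℕ, ((j.factorial : ℂ) * Complex.Gamma (μ + j + 1))⁻¹ * y ^ j

/-- The coefficients of `Φ_μ`. -/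
def phiCoeff (μ : ℂ) (j : ℕ) : ℂ := ((j.factorial : ℂ) * Complex.Gamma (μ + j + 1))⁻¹

lemma phiCoeff_eq_mul (μ : ℂ) (j : ℕ) :
    phiCoeff μ j = (j + 1) * (μ + j + 1) * phiCoeff μ (j + 1) := by
  have h := Complex.one_div_Gamma_eq_self_mul_one_div_Gamma_add_one (μ + j + 1)
  have hj : ((j : ℂ) + 1) ≠ 0 := Nat.cast_add_one_ne_zero j
  have hf : (j.factorial : ℂ) ≠ 0 := by exact_mod_cast j.factorial_ne_zero
  unfold phiCoeff
  rw [mul_inv, h, Nat.factorial_succ]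
  push_cast
  rw [show μ + (j + 1 : ℂ) + 1 = μ + j + 1 + 1 by ring, mul_inv, mul_inv]
  field_simp

lemma phiCoeff_succ_mul (μ : ℂ) (j : ℕ) :
    (j + 1) * phiCoeff μ (j + 1) = phiCoeff (μ + 1) j := by
  have hj : ((j : ℂ) + 1) ≠ 0 := Nat.cast_add_one_ne_zero j
  have hf : (j.factorial : ℂ) ≠ 0 := by exact_mod_cast j.factorial_ne_zero
  unfold phiCoeff
  rw [Nat.factorial_succ]
  push_cast
  rw [show μ + (j + 1 : ℂ) + 1 = μ + 1 + j + 1 by ring, mul_inv, mul_inv, mul_inv]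
  field_simp

lemma phiCoeff_sub_one (μ : ℂ) (j : ℕ) :
    phiCoeff (μ - 1) j = (μ + j) * phiCoeff μ j := by
  have h := Complex.one_div_Gamma_eq_self_mul_one_div_Gamma_add_one (μ + j)
  unfold phiCoeff
  rw [show μ - 1 + j + 1 = μ + j by ring, mul_inv, mul_inv, h]
  ring

lemma summable_phiCoeff (μ y : ℂ) : Summable fun j => phiCoeff μ j * y ^ j := by
  refine summable_of_ratio_norm_eventually_le (r := 1 / 2) (by norm_num) ?_
  obtain ⟨N, hN⟩ := exists_nat_gt (‖μ‖ + 2 * ‖y‖)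
  filter_upwards [eventually_ge_atTop N] with j hj
  have hjN : (N : ℝ) ≤ j := by exact_mod_cast hj
  have h1 : 2 * ‖y‖ ≤ ‖((j : ℂ) + 1) * (μ + j + 1)‖ := by
    have e1 : ‖(j : ℂ) + 1‖ = j + 1 := by
      have : ((j : ℂ) + 1) = ((j + 1 : ℕ) : ℂ) := by push_cast; ring
      rw [this, Complex.norm_natCast]; push_cast; ring
    have e2 : (j : ℝ) + 1 - ‖μ‖ ≤ ‖μ + j + 1‖ := by
      have := norm_sub_norm_le ((j : ℂ) + 1) (-μ)
      rw [e1, norm_neg] at this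
      rwa [sub_neg_eq_add, show (j : ℂ) + 1 + μ = μ + j + 1 by ring] at this
    rw [norm_mul, e1]
    have : 0 ≤ ‖y‖ := norm_nonneg y
    have : 0 ≤ (j : ℝ) := Nat.cast_nonneg j
    nlinarith
  rw [phiCoeff_eq_mul μ j, norm_mul, norm_mul, norm_mul, norm_pow, norm_pow, pow_succ]
  have := mul_le_mul_of_nonneg_right h1
    (mul_nonneg (norm_nonneg (phiCoeff μ (j + 1))) (pow_nonneg (norm_nonneg y) j))
  nlinarith

lemma hasDerivAt_besselPhi (μ y : ℂ) : HasDerivAt (besselPhi μ) (besselPhi (μ + 1) y) y := by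
  set R : ℝ := ‖y‖ + 1
  have hsum : Summable fun j => ‖phiCoeff (μ + 1) j * (R : ℂ) ^ j‖ :=
    (summable_phiCoeff (μ + 1) R).norm
  have hu : Summable fun j : ℕ => ‖(j : ℂ) * phiCoeff μ j‖ * R ^ (j - 1) := by
    refine (summable_nat_add_iff 1).1 (hsum.congr fun j => ?_)
    rw [norm_mul, ← phiCoeff_succ_mul, norm_pow, Complex.norm_real,
      Real.norm_of_nonneg (by positivity)]
    push_cast; simp
  have h := hasDerivAt_tsum_of_isPreconnected (t := Metric.ball 0 R) (y₀ := y) (y := y)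
    (g := fun j z => phiCoeff μ j * z ^ j) (g' := fun j z => phiCoeff μ j * (j * z ^ (j - 1)))
    hu Metric.isOpen_ball (convex_ball _ _).isPreconnected
    (fun j z _ => (hasDerivAt_pow j z).const_mul _)
    (fun j z hz => by
      have hz' : ‖z‖ ≤ R := (mem_ball_zero_iff.1 hz).le
      rw [norm_mul, norm_mul, norm_mul, norm_pow, ← mul_assoc, mul_comm ‖phiCoeff μ j‖]
      gcongr)
    (by simp [R]) (summable_phiCoeff μ y) (by simp [R])
  have hd : Summable fun j : ℕ => phiCoeff μ j * (j * y ^ (j - 1)) := by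
    refine (summable_nat_add_iff 1).1 ((summable_phiCoeff (μ + 1) y).congr fun j => ?_)
    rw [← phiCoeff_succ_mul]; push_cast; ring
  refine h.congr_deriv ?_
  rw [hd.tsum_eq_zero_add]
  simp only [CharP.cast_eq_zero, zero_mul, mul_zero, zero_add]
  refine tsum_congr fun j => ?_
  change _ = phiCoeff (μ + 1) j * y ^ j
  rw [← phiCoeff_succ_mul]; push_cast; ring

lemma differentiable_besselPhi (μ : ℂ) : Differentiable ℂ (besselPhi μ) :=
  fun y => (hasDerivAt_besselPhi μ y).differentiableAt

lemma continuous_besselPhi (μ : ℂ) : Continuous (besselPhi μ) :=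
  (differentiable_besselPhi μ).continuous

lemma besselPhi_zero (μ : ℂ) : besselPhi μ 0 = (Complex.Gamma (μ + 1))⁻¹ := by
  unfold besselPhi
  rw [tsum_eq_single 0 (fun j hj => by simp [hj])]
  simp

lemma besselPhi_sub_one (μ y : ℂ) :
    besselPhi (μ - 1) y = μ * besselPhi μ y + y * besselPhi (μ + 1) y := by
  change ∑' j, phiCoeff (μ - 1) j * y ^ j = μ * (∑' j, phiCoeff μ j * y ^ j) +
    y * (∑' j, phiCoeff (μ + 1) j * y ^ j)
  have hs : Summable fun j : ℕ => (j : ℂ) * phiCoeff μ j * y ^ j := by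
    refine (summable_nat_add_iff 1).1 (((summable_phiCoeff (μ + 1) y).mul_left y).congr fun j => ?_)
    rw [← phiCoeff_succ_mul]; push_cast; ring
  have h1 : y * (∑' j, phiCoeff (μ + 1) j * y ^ j) = ∑' j : ℕ, (j : ℂ) * phiCoeff μ j * y ^ j := by
    rw [hs.tsum_eq_zero_add, ← tsum_mul_left]
    simp only [CharP.cast_eq_zero, zero_mul, zero_add]
    refine tsum_congr fun j => ?_
    rw [← phiCoeff_succ_mul]; push_cast; ring
  rw [h1, ← tsum_mul_left, ← ((summable_phiCoeff μ y).mul_left μ).tsum_add hs]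
  refine tsum_congr fun j => ?_
  rw [phiCoeff_sub_one]; ring

/-- The Wronskian of `I_b` and `I_{-b}` in terms of power series: its derivative vanishes by the
recurrence `besselPhi_sub_one`, and its value at `0` is the reflection formula of `Γ`. -/
lemma wronskian_besselPhi (b y : ℂ) :
    besselPhi (b - 1) y * besselPhi (-b) y - y * besselPhi (1 - b) y * besselPhi b y =
      Complex.sin (Real.pi * b) / Real.pi := by
  set W : ℂ → ℂ := fun y =>
    besselPhi (b - 1) y * besselPhi (-b) y - y * besselPhi (1 - b) y * besselPhi b y
  have hW : ∀ y, HasDerivAt W 0 y := by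
    intro y
    have h1 := hasDerivAt_besselPhi (b - 1) y
    have h2 := hasDerivAt_besselPhi (-b) y
    have h3 := hasDerivAt_besselPhi (1 - b) y
    have h4 := hasDerivAt_besselPhi b y
    have h := (h1.mul h2).sub (((hasDerivAt_id y).mul h3).mul h4)
    have r1 := besselPhi_sub_one (1 - b) y
    have r2 := besselPhi_sub_one b y
    rw [show (1 : ℂ) - b - 1 = -b by ring] at r1
    rw [show b - 1 + 1 = b by ring, show -b + 1 = 1 - b by ring] at h
    refine h.congr_deriv ?_
    simp only [id, Pi.mul_apply, one_mul]
    linear_combination (-besselPhi b y) * r1 + (-besselPhi (1 - b) y) * r2 +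
      (2 * besselPhi b y) * r1 + (2 * besselPhi (1 - b) y) * r2
  have hc := is_const_of_deriv_eq_zero (fun y => (hW y).differentiableAt)
    (fun y => (hW y).deriv) y 0
  change W y = _
  rw [hc]
  simp only [W, besselPhi_zero, zero_mul, sub_zero]
  rw [show b - 1 + 1 = b by ring, show -b + 1 = 1 - b by ring, ← mul_inv,
    Complex.Gamma_mul_Gamma_one_sub, inv_div]

/-! ### Modified Bessel functions on the universal covering -/

/-- The modified Bessel function `I_μ(x)` at the point `x = e ^ w` of the universal covering. -/
def besselI (μ w : ℂ) : ℂ :=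
  Complex.exp (μ * (w - (Real.log 2 : ℝ))) * besselPhi μ (Complex.exp (2 * w) / 4)

/-- The Macdonald function `K_μ(x)` of non-integer order `μ`, at `x = e ^ w`. -/
def besselK (μ w : ℂ) : ℂ :=
  Real.pi / (2 * Complex.sin (Real.pi * μ)) * (besselI (-μ) w - besselI μ w)

lemma exp_log_two : Complex.exp ((Real.log 2 : ℝ) : ℂ) = 2 := by
  rw [← Complex.ofReal_exp, Real.exp_log two_pos]; simp

lemma exp_two_mul_div_four (w : ℂ) :
    Complex.exp (2 * w) / 4 = Complex.exp w * (Complex.exp (w - (Real.log 2 : ℝ)) / 2) := by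
  rw [Complex.exp_sub, exp_log_two, two_mul, Complex.exp_add]; ring

lemma hasDerivAt_besselI (μ w : ℂ) :
    HasDerivAt (besselI μ) (μ * besselI μ w + Complex.exp w * besselI (μ + 1) w) w := by
  have h1 : HasDerivAt (fun w : ℂ => Complex.exp (μ * (w - (Real.log 2 : ℝ))))
      (Complex.exp (μ * (w - (Real.log 2 : ℝ))) * μ) w := by
    simpa using ((((hasDerivAt_id w).sub_const _).const_mul μ).cexp)
  have h2 : HasDerivAt (fun w : ℂ => Complex.exp (2 * w) / 4) (Complex.exp (2 * w) * 2 / 4) w := by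
    simpa using ((((hasDerivAt_id w).const_mul (2 : ℂ)).cexp).div_const 4)
  have h := h1.mul ((hasDerivAt_besselPhi μ _).comp w h2)
  refine h.congr_deriv ?_
  have e1 : Complex.exp ((μ + 1) * (w - (Real.log 2 : ℝ))) =
      Complex.exp (μ * (w - (Real.log 2 : ℝ))) * Complex.exp (w - (Real.log 2 : ℝ)) := by
    rw [← Complex.exp_add]; ring_nf
  simp only [besselI, e1, Function.comp]
  linear_combination (2 * Complex.exp (μ * (w - (Real.log 2 : ℝ))) *
    besselPhi (μ + 1) (Complex.exp (2 * w) / 4)) * exp_two_mul_div_four w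

lemma besselI_sub_one (μ w : ℂ) :
    Complex.exp w * besselI (μ - 1) w =
      2 * μ * besselI μ w + Complex.exp w * besselI (μ + 1) w := by
  have e1 : Complex.exp ((μ + 1) * (w - (Real.log 2 : ℝ))) =
      Complex.exp (μ * (w - (Real.log 2 : ℝ))) * (Complex.exp w / 2) := by
    rw [add_mul, Complex.exp_add, one_mul, Complex.exp_sub w, exp_log_two]
  have e2 : Complex.exp ((μ - 1) * (w - (Real.log 2 : ℝ))) =
      Complex.exp (μ * (w - (Real.log 2 : ℝ))) * (2 / Complex.exp w) := by
    rw [sub_mul, Complex.exp_sub, one_mul, Complex.exp_sub w, exp_log_two, div_div_eq_mul_div]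
    ring
  have e3 : Complex.exp (2 * w) = Complex.exp w * Complex.exp w := by
    rw [← Complex.exp_add]; ring_nf
  simp only [besselI, e1, e2, besselPhi_sub_one μ, e3]
  have := Complex.exp_ne_zero w
  field_simp
  ring

/-- The derivative of `I_μ` by the lowering recurrence. -/
lemma hasDerivAt_besselI' (μ w : ℂ) :
    HasDerivAt (besselI μ) (-μ * besselI μ w + Complex.exp w * besselI (μ - 1) w) w := by
  refine (hasDerivAt_besselI μ w).congr_deriv ?_
  rw [besselI_sub_one]; ring

lemma wronskian_besselI (b w : ℂ) :
    Complex.exp w * (besselI (b - 1) w * besselI (-b) w - besselI (1 - b) w * besselI b w) =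
      2 * Complex.sin (Real.pi * b) / Real.pi := by
  have h := wronskian_besselPhi b (Complex.exp (2 * w) / 4)
  have e1 : Complex.exp w * (Complex.exp ((b - 1) * (w - (Real.log 2 : ℝ))) *
      Complex.exp (-b * (w - (Real.log 2 : ℝ)))) = 2 := by
    rw [← Complex.exp_add, ← Complex.exp_add]; refine Eq.trans ?_ exp_log_two; congr 1; ring
  have e2 : Complex.exp w * (Complex.exp ((1 - b) * (w - (Real.log 2 : ℝ))) *
      Complex.exp (b * (w - (Real.log 2 : ℝ)))) = Complex.exp (2 * w) / 2 := by
    refine Eq.trans ?_ (congrArg (Complex.exp (2 * w) / ·) exp_log_two)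
    rw [← Complex.exp_add, ← Complex.exp_add, ← Complex.exp_sub]; congr 1; ring
  simp only [besselI]
  linear_combination 2 * h + (besselPhi (b - 1) (Complex.exp (2 * w) / 4) *
    besselPhi (-b) (Complex.exp (2 * w) / 4)) * e1 - (besselPhi (1 - b) (Complex.exp (2 * w) / 4) *
    besselPhi b (Complex.exp (2 * w) / 4)) * e2

lemma besselI_add_pi (μ w : ℂ) :
    besselI μ (w + Real.pi * Complex.I) = Complex.exp (μ * (Real.pi * Complex.I)) * besselI μ w := by
  have e : Complex.exp (2 * (w + Real.pi * Complex.I)) = Complex.exp (2 * w) := by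
    rw [mul_add, show (2 : ℂ) * (Real.pi * Complex.I) = 2 * Real.pi * Complex.I by ring,
      Complex.exp_periodic]
  rw [besselI, besselI, e, ← mul_assoc, ← Complex.exp_add]; congr 2; ring

lemma besselI_sub_pi (μ w : ℂ) :
    besselI μ (w - Real.pi * Complex.I) =
      Complex.exp (-(μ * (Real.pi * Complex.I))) * besselI μ w := by
  have h := besselI_add_pi μ (w - Real.pi * Complex.I)
  rw [sub_add_cancel] at h
  rw [h, ← mul_assoc, ← Complex.exp_add, neg_add_cancel, Complex.exp_zero, one_mul]

/-- The derivative of `K_μ` with respect to `w = log x`. -/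
def derivK (μ w : ℂ) : ℂ := -μ * besselK μ w - Complex.exp w * besselK (1 - μ) w

lemma hasDerivAt_besselK (μ w : ℂ) :
    HasDerivAt (besselK μ) (derivK μ w) w := by
  have h := ((hasDerivAt_besselI (-μ) w).sub (hasDerivAt_besselI' μ w)).const_mul
    (Real.pi / (2 * Complex.sin (Real.pi * μ)))
  refine h.congr_deriv ?_
  have e : Complex.sin (Real.pi * (1 - μ)) = Complex.sin (Real.pi * μ) := by
    rw [mul_sub, mul_one, Complex.sin_pi_sub]
  simp only [derivK, besselK, e]
  rw [show -(1 - μ) = μ - 1 by ring, show -μ + 1 = 1 - μ by ring]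
  ring

lemma differentiable_besselK (μ : ℂ) : Differentiable ℂ (besselK μ) :=
  fun w => (hasDerivAt_besselK μ w).differentiableAt

lemma differentiable_derivK (μ : ℂ) : Differentiable ℂ (derivK μ) :=
  ((differentiable_besselK μ).const_mul _).sub
    (Complex.differentiable_exp.mul (differentiable_besselK _))

/-- The monodromy relation of `K_μ`. -/
lemma besselK_add_pi_add_sub_pi (μ w : ℂ) :
    besselK μ (w + Real.pi * Complex.I) + besselK μ (w - Real.pi * Complex.I) =
      2 * Complex.cos (Real.pi * μ) * besselK μ w := by
  simp only [besselK, besselI_add_pi, besselI_sub_pi, Complex.cos]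
  rw [show Real.pi * μ * Complex.I = μ * (Real.pi * Complex.I) by ring,
    show -(Real.pi * μ) * Complex.I = -(μ * (Real.pi * Complex.I)) by ring, neg_mul, neg_neg]
  ring

lemma derivK_add_pi_add_sub_pi (μ w : ℂ) :
    derivK μ (w + Real.pi * Complex.I) + derivK μ (w - Real.pi * Complex.I) =
      2 * Complex.cos (Real.pi * μ) * derivK μ w := by
  have h1 := (hasDerivAt_besselK μ (w + Real.pi * Complex.I)).comp_add_const w (Real.pi * Complex.I)
  have h2 := (hasDerivAt_besselK μ (w - Real.pi * Complex.I)).comp_sub_const w (Real.pi * Complex.I)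
  have h3 := (hasDerivAt_besselK μ w).const_mul (2 * Complex.cos (Real.pi * μ))
  have h4 := h1.add h2
  have : (fun w => 2 * Complex.cos (Real.pi * μ) * besselK μ w) =
      (fun w => besselK μ (w + Real.pi * Complex.I)) +
        (fun w => besselK μ (w - Real.pi * Complex.I)) := by
    ext w; exact (besselK_add_pi_add_sub_pi μ w).symm
  rw [this] at h3
  exact h4.unique h3

/-! ### Hankel functions on the positive imaginary axis -/

/-- `J_ν(i x) = e^{iπν/2} I_ν(x)` on the universal covering. -/
lemma besselJ_add_half_pi (ν w : ℂ) :
    besselJ ν (w + ((Real.pi / 2 : ℝ) : ℂ) * Complex.I) =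
      Complex.exp (ν * (Real.pi * Complex.I) / 2) * besselI ν w := by
  unfold besselJ besselI besselPhi
  rw [← tsum_mul_left, ← tsum_mul_left]
  refine tsum_congr fun j => ?_
  have e1 : Complex.exp ((2 * j + ν) * (w + ((Real.pi / 2 : ℝ) : ℂ) * Complex.I -
      (Real.log 2 : ℝ))) = (-1) ^ j * Complex.exp (ν * (Real.pi * Complex.I) / 2) *
        Complex.exp (ν * (w - (Real.log 2 : ℝ))) * (Complex.exp (2 * w) / 4) ^ j := by
    have e4 : (4 : ℂ) = Complex.exp ((Real.log 2 : ℝ)) * Complex.exp ((Real.log 2 : ℝ)) := by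
      rw [exp_log_two]; norm_num
    rw [← Complex.exp_pi_mul_I, e4, ← Complex.exp_add, ← Complex.exp_sub, ← Complex.exp_nat_mul,
      ← Complex.exp_nat_mul, ← Complex.exp_add, ← Complex.exp_add, ← Complex.exp_add]
    congr 1; push_cast; ring
  have e2 : ((-1 : ℂ) ^ j) * (-1) ^ j = 1 := by rw [← mul_pow]; simp
  rw [e1, div_eq_mul_inv]
  linear_combination (((j.factorial : ℂ) * Complex.Gamma (ν + j + 1))⁻¹ *
    (Complex.exp (ν * (Real.pi * Complex.I) / 2) *
        Complex.exp (ν * (w - (Real.log 2 : ℝ))) * (Complex.exp (2 * w) / 4) ^ j)) * e2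

/-- `H^{(1)}_{-b}` at the point `i x` of the covering is a multiple of `K_b(x)`. This holds for
integer `b` too, both sides then being `0` by the convention for division by zero. -/
lemma hankel1_neg_eq (b w : ℂ) :
    hankel1 (-b) (w + ((Real.pi / 2 : ℝ) : ℂ) * Complex.I) =
      -(2 * Complex.I / Real.pi) * Complex.exp (b * (Real.pi * Complex.I) / 2) * besselK b w := by
  have hpi : (Real.pi : ℂ) ≠ 0 := by exact_mod_cast Real.pi_ne_zero
  unfold hankel1 besselK
  rw [besselJ_add_half_pi, besselJ_add_half_pi, neg_neg, mul_neg (Real.pi : ℂ), Complex.sin_neg]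
  have e1 : Complex.exp (-(Complex.I * -b * Real.pi)) =
      Complex.exp (b * (Real.pi * Complex.I) / 2) * Complex.exp (b * (Real.pi * Complex.I) / 2) := by
    rw [← Complex.exp_add]; congr 1; ring
  have e2 : Complex.exp (b * (Real.pi * Complex.I) / 2) *
      Complex.exp (-b * (Real.pi * Complex.I) / 2) = 1 := by
    rw [← Complex.exp_add, ← Complex.exp_zero]; congr 1; ring
  rw [e1]
  by_cases hs : Complex.sin (Real.pi * b) = 0
  · simp [hs]
  have hX : ∀ X : ℂ, X / (Complex.I * -Complex.sin (Real.pi * b)) =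
      X * (Complex.I / Complex.sin (Real.pi * b)) := by
    intro X
    rw [div_mul_eq_div_div, Complex.div_I]; ring
  have hY : 2 * Complex.I / Real.pi * (Real.pi / (2 * Complex.sin (Real.pi * b))) =
      Complex.I / Complex.sin (Real.pi * b) := by
    field_simp
  rw [hX]
  linear_combination (-Complex.I / Complex.sin (Real.pi * b) *
    Complex.exp (b * (Real.pi * Complex.I) / 2) * besselI (-b) w) * e2 +
    (Complex.exp (b * (Real.pi * Complex.I) / 2) * (besselI (-b) w - besselI b w)) * hY

/-- `H^{(2)}_{-b}` at the point `i x` of the covering is a multiple of `K_b(x e^{iπ})`. -/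
lemma hankel2_neg_eq (b w : ℂ) :
    hankel2 (-b) (w + ((Real.pi / 2 : ℝ) : ℂ) * Complex.I) =
      2 * Complex.I / Real.pi * Complex.exp (-(b * (Real.pi * Complex.I) / 2)) *
        besselK b (w + Real.pi * Complex.I) := by
  have hpi : (Real.pi : ℂ) ≠ 0 := by exact_mod_cast Real.pi_ne_zero
  unfold hankel2 besselK
  rw [besselJ_add_half_pi, besselJ_add_half_pi, neg_neg, mul_neg (Real.pi : ℂ), Complex.sin_neg,
    besselI_add_pi, besselI_add_pi]
  have e0 : Complex.exp (-b * (Real.pi * Complex.I) / 2) =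
    Complex.exp (-(b * (Real.pi * Complex.I) / 2)) := by congr 1; ring
  have e1 : Complex.exp (Complex.I * -b * Real.pi) =
      Complex.exp (-b * (Real.pi * Complex.I)) := by congr 1; ring
  have e2 : Complex.exp (-(b * (Real.pi * Complex.I) / 2)) *
      Complex.exp (b * (Real.pi * Complex.I)) = Complex.exp (b * (Real.pi * Complex.I) / 2) := by
    rw [← Complex.exp_add]; congr 1; ring
  rw [e1, e0]
  by_cases hs : Complex.sin (Real.pi * b) = 0
  · simp [hs]
  have hX : ∀ X : ℂ, X / (Complex.I * -Complex.sin (Real.pi * b)) =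
      X * (Complex.I / Complex.sin (Real.pi * b)) := by
    intro X
    rw [div_mul_eq_div_div, Complex.div_I]; ring
  have hY : 2 * Complex.I / Real.pi * (Real.pi / (2 * Complex.sin (Real.pi * b))) =
      Complex.I / Complex.sin (Real.pi * b) := by
    field_simp
  rw [hX]
  linear_combination (Complex.I / Complex.sin (Real.pi * b) * besselI b w) * e2 -
    (Complex.exp (-(b * (Real.pi * Complex.I) / 2)) *
      (Complex.exp (-b * (Real.pi * Complex.I)) * besselI (-b) w -
        Complex.exp (b * (Real.pi * Complex.I)) * besselI b w)) * hY

/-! ### The identity theorem along a horizontal line -/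

/-- Two functions analytic on a domain that agree on a horizontal line through one of its points
agree everywhere on it. -/
lemma eqOn_of_eq_on_horizontal_line {f g : ℂ → ℂ} {U : Set ℂ} (hU : IsOpen U)
    (hU' : IsPreconnected U) (hf : DifferentiableOn ℂ f U) (hg : DifferentiableOn ℂ g U) {w₀ : ℂ}
    (hw₀ : w₀ ∈ U) (h : ∀ t : ℝ, f (w₀ + t) = g (w₀ + t)) : Set.EqOn f g U := by
  refine (hf.analyticOnNhd hU).eqOn_of_preconnected_of_frequently_eq (hg.analyticOnNhd hU) hU' hw₀
    ?_
  have ht : Tendsto (fun t : ℝ => w₀ + (t : ℂ)) (𝓝[≠] 0) (𝓝[≠] w₀) := by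
    refine tendsto_nhdsWithin_iff.2 ⟨?_, ?_⟩
    · have : Tendsto (fun t : ℝ => w₀ + (t : ℂ)) (𝓝 0) (𝓝 (w₀ + ((0 : ℝ) : ℂ))) :=
        Continuous.tendsto (by fun_prop) 0
      simpa using this.mono_left nhdsWithin_le_nhds
    · filter_upwards [self_mem_nhdsWithin] with t ht
      simpa using ht
  exact ht.frequently (Eventually.of_forall h).frequently

/-! ### The integral representation of the Macdonald function -/

/-- The integral `½ ∫ exp (ν u - x cosh u) du` over the real line, at `x = e ^ w`. -/
def besselQ (ν : ℝ) (w : ℂ) : ℂ :=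
  1 / 2 * ∫ u : ℝ, Complex.exp (ν * u - Complex.exp w * (Real.cosh u : ℝ))

lemma sq_div_four_le_cosh (u : ℝ) : u ^ 2 / 4 ≤ Real.cosh u := by
  rw [← Real.cosh_abs, Real.cosh_eq, ← sq_abs]
  have h1 := Real.quadratic_le_exp_of_nonneg (abs_nonneg u)
  have h2 := Real.exp_pos (-|u|)
  have h3 := abs_nonneg u
  linarith

lemma integrable_exp_sub_cosh (c : ℝ) {δ : ℝ} (hδ : 0 < δ) :
    MeasureTheory.Integrable fun u : ℝ => Real.exp (c * u - δ * Real.cosh u) := by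
  have h := (integrable_cexp_quadratic (b := ((δ / 4 : ℝ) : ℂ))
    (by rw [Complex.ofReal_re]; positivity) c 0).norm
  refine h.mono' (Continuous.aestronglyMeasurable (by fun_prop)) (Eventually.of_forall fun u => ?_)
  rw [Real.norm_of_nonneg (Real.exp_pos _).le, Complex.norm_exp]
  have e : (-((δ / 4 : ℝ) : ℂ) * (u : ℂ) ^ 2 + c * u + 0) =
    ((-(δ / 4) * u ^ 2 + c * u : ℝ) : ℂ) := by push_cast; ring
  rw [e, Complex.ofReal_re]
  refine Real.exp_le_exp.2 ?_
  have := mul_le_mul_of_nonneg_left (sq_div_four_le_cosh u) hδ.le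
  linarith

lemma norm_exp_sub_cosh (c : ℝ) (z : ℂ) (u : ℝ) :
    ‖Complex.exp (c * u - z * (Real.cosh u : ℝ))‖ = Real.exp (c * u - z.re * Real.cosh u) := by
  rw [Complex.norm_exp, Complex.sub_re, Complex.re_mul_ofReal, Complex.re_mul_ofReal,
    Complex.ofReal_re]

lemma integrable_cexp_sub_cosh (c : ℝ) {z : ℂ} (hz : 0 < z.re) :
    MeasureTheory.Integrable fun u : ℝ => Complex.exp (c * u - z * (Real.cosh u : ℝ)) := by
  refine (integrable_exp_sub_cosh c hz).mono' (Continuous.aestronglyMeasurable (by fun_prop))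
    (Eventually.of_forall fun u => ?_)
  rw [norm_exp_sub_cosh]

lemma cosh_mul_exp (c u : ℝ) (X : ℂ) : ((Real.cosh u : ℝ) : ℂ) * Complex.exp (c * u - X) =
    1 / 2 * (Complex.exp ((c + 1 : ℝ) * u - X) + Complex.exp ((c - 1 : ℝ) * u - X)) := by
  rw [Real.cosh_eq]
  push_cast
  rw [show ((c : ℂ) + 1) * u - X = u + (c * u - X) by ring,
    show ((c : ℂ) - 1) * u - X = -u + (c * u - X) by ring, Complex.exp_add, Complex.exp_add]
  ring

lemma sinh_mul_exp (c u : ℝ) (X : ℂ) : ((Real.sinh u : ℝ) : ℂ) * Complex.exp (c * u - X) =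
    1 / 2 * (Complex.exp ((c + 1 : ℝ) * u - X) - Complex.exp ((c - 1 : ℝ) * u - X)) := by
  rw [Real.sinh_eq]
  push_cast
  rw [show ((c : ℂ) + 1) * u - X = u + (c * u - X) by ring,
    show ((c : ℂ) - 1) * u - X = -u + (c * u - X) by ring, Complex.exp_add, Complex.exp_add]
  ring

lemma hasDerivAt_besselQ (ν : ℝ) {w : ℂ} (hw : 0 < (Complex.exp w).re) :
    HasDerivAt (besselQ ν)
      (-(Complex.exp w / 2) * (besselQ (ν + 1) w + besselQ (ν - 1) w)) w := by
  set δ := (Complex.exp w).re / 2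
  have hδ : 0 < δ := half_pos hw
  set M := ‖Complex.exp w‖ + 1
  have hs : {w' : ℂ | δ < (Complex.exp w').re ∧ ‖Complex.exp w'‖ < M} ∈ 𝓝 w := by
    refine IsOpen.mem_nhds (IsOpen.inter ?_ ?_) ⟨half_lt_self hw, lt_add_one _⟩
    · exact isOpen_lt continuous_const (Complex.continuous_re.comp Complex.continuous_exp)
    · exact isOpen_lt Complex.continuous_exp.norm continuous_const
  have hcosh : ∀ (c : ℝ) {z : ℂ}, 0 < z.re → MeasureTheory.Integrable fun u : ℝ =>
      ((Real.cosh u : ℝ) : ℂ) * Complex.exp (c * u - z * (Real.cosh u : ℝ)) := by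
    intro c z hz
    simp_rw [cosh_mul_exp]
    exact ((integrable_cexp_sub_cosh _ hz).add (integrable_cexp_sub_cosh _ hz)).const_mul _
  have hb : MeasureTheory.Integrable fun u : ℝ =>
      M * ‖((Real.cosh u : ℝ) : ℂ) * Complex.exp (ν * u - (δ : ℂ) * (Real.cosh u : ℝ))‖ :=
    ((hcosh ν (z := (δ : ℂ)) (by simpa using hδ)).norm).const_mul M
  have hm1 : ∀ w' : ℂ, MeasureTheory.AEStronglyMeasurable
      (fun u : ℝ => Complex.exp (ν * u - Complex.exp w' * (Real.cosh u : ℝ))) :=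
    fun w' => Continuous.aestronglyMeasurable (by fun_prop)
  have hm2 : MeasureTheory.AEStronglyMeasurable (fun u : ℝ => -Complex.exp w *
      (((Real.cosh u : ℝ) : ℂ) * Complex.exp (ν * u - Complex.exp w * (Real.cosh u : ℝ)))) :=
    Continuous.aestronglyMeasurable (by fun_prop)
  have h := (hasDerivAt_integral_of_dominated_loc_of_deriv_le (μ := MeasureTheory.volume)
    (F := fun w' (u : ℝ) => Complex.exp (ν * u - Complex.exp w' * (Real.cosh u : ℝ)))
    (F' := fun w' (u : ℝ) => -Complex.exp w' *
      (((Real.cosh u : ℝ) : ℂ) * Complex.exp (ν * u - Complex.exp w' * (Real.cosh u : ℝ)))) hs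
    (Eventually.of_forall hm1) (integrable_cexp_sub_cosh ν hw) hm2
    (Eventually.of_forall fun u w' hw' => by
      rw [norm_mul, norm_mul, norm_mul, norm_neg, norm_exp_sub_cosh, norm_exp_sub_cosh,
        Complex.ofReal_re]
      have h1 := hw'.1.le
      have h2 := hw'.2.le
      have h3 := Real.cosh_pos u
      gcongr) hb
    (Eventually.of_forall fun u w' _ => by
      have h1 := (((Complex.hasDerivAt_exp w').mul_const ((Real.cosh u : ℝ) : ℂ)).const_sub
        ((ν : ℂ) * u)).cexp
      exact h1.congr_deriv (by ring))).2
  refine (h.const_mul (1 / 2)).congr_deriv ?_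
  simp_rw [cosh_mul_exp]
  rw [MeasureTheory.integral_const_mul, MeasureTheory.integral_const_mul,
    MeasureTheory.integral_add (integrable_cexp_sub_cosh _ hw) (integrable_cexp_sub_cosh _ hw)]
  simp only [besselQ]
  ring

lemma besselQ_add_one_sub (ν : ℝ) {w : ℂ} (hw : 0 < (Complex.exp w).re) :
    Complex.exp w * (besselQ (ν + 1) w - besselQ (ν - 1) w) = 2 * ν * besselQ ν w := by
  have hi1 := integrable_cexp_sub_cosh (ν + 1) hw
  have hi2 := integrable_cexp_sub_cosh (ν - 1) hw
  have hi0 := integrable_cexp_sub_cosh ν hw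
  have hi12 : MeasureTheory.Integrable fun u : ℝ =>
      Complex.exp ((ν + 1 : ℝ) * u - Complex.exp w * (Real.cosh u : ℝ)) -
        Complex.exp ((ν - 1 : ℝ) * u - Complex.exp w * (Real.cosh u : ℝ)) := hi1.sub hi2
  have hd : ∀ u : ℝ, HasDerivAt
      (fun u : ℝ => Complex.exp (ν * u - Complex.exp w * (Real.cosh u : ℝ)))
      (ν * Complex.exp (ν * u - Complex.exp w * (Real.cosh u : ℝ)) - Complex.exp w / 2 *
        (Complex.exp ((ν + 1 : ℝ) * u - Complex.exp w * (Real.cosh u : ℝ)) -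
          Complex.exp ((ν - 1 : ℝ) * u - Complex.exp w * (Real.cosh u : ℝ)))) u := by
    intro u
    have h1 : HasDerivAt (fun u : ℝ => (ν : ℂ) * u) (ν : ℂ) u := by
      simpa using (hasDerivAt_id u).ofReal_comp.const_mul (ν : ℂ)
    have h2 := (Real.hasDerivAt_cosh u).ofReal_comp.const_mul (Complex.exp w)
    refine ((h1.sub h2).cexp).congr_deriv ?_
    linear_combination (-Complex.exp w) * sinh_mul_exp ν u (Complex.exp w * (Real.cosh u : ℝ))
  have h := MeasureTheory.integral_eq_zero_of_hasDerivAt_of_integrable hd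
    ((hi0.const_mul _).sub (hi12.const_mul _)) hi0
  rw [MeasureTheory.integral_sub (hi0.const_mul _) (hi12.const_mul _),
    MeasureTheory.integral_const_mul, MeasureTheory.integral_const_mul,
    MeasureTheory.integral_sub hi1 hi2] at h
  simp only [besselQ]
  linear_combination -h

lemma besselQ_neg (ν : ℝ) (w : ℂ) : besselQ (-ν) w = besselQ ν w := by
  unfold besselQ
  rw [← MeasureTheory.integral_neg_eq_self]
  simp

lemma hasDerivAt_besselQ_add_one (ν : ℝ) {w : ℂ} (hw : 0 < (Complex.exp w).re) :
    HasDerivAt (besselQ ν) (ν * besselQ ν w - Complex.exp w * besselQ (ν + 1) w) w :=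
  (hasDerivAt_besselQ ν hw).congr_deriv (by
    linear_combination (1 / 2) * besselQ_add_one_sub ν hw)

lemma hasDerivAt_besselQ_sub_one (ν : ℝ) {w : ℂ} (hw : 0 < (Complex.exp w).re) :
    HasDerivAt (besselQ ν) (-ν * besselQ ν w - Complex.exp w * besselQ (ν - 1) w) w :=
  (hasDerivAt_besselQ ν hw).congr_deriv (by
    linear_combination (-1 / 2) * besselQ_add_one_sub ν hw)

/-! ### Behaviour at the origin -/

/-- Euler's integral for `Γ`, after the substitution `x = e^v`. -/
lemma integral_exp_sub_exp {ν : ℝ} (hν : 0 < ν) :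
    MeasureTheory.Integrable (fun v : ℝ => Real.exp (ν * v - Real.exp v)) ∧
      ∫ v : ℝ, Real.exp (ν * v - Real.exp v) = Real.Gamma ν := by
  have hd : ∀ x ∈ (Set.univ : Set ℝ), HasDerivWithinAt Real.exp (Real.exp x) Set.univ x :=
    fun x _ => (Real.hasDerivAt_exp x).hasDerivWithinAt
  have hinj : Set.InjOn Real.exp Set.univ := Real.exp_injective.injOn
  have himg : Real.exp '' Set.univ = Set.Ioi 0 := by rw [Set.image_univ, Real.range_exp]
  have e : ∀ v : ℝ, |Real.exp v| • (Real.exp (-Real.exp v) * Real.exp v ^ (ν - 1)) =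
      Real.exp (ν * v - Real.exp v) := by
    intro v
    rw [abs_of_pos (Real.exp_pos v), ← Real.exp_mul, ← Real.exp_add, smul_eq_mul, ← Real.exp_add]
    ring_nf
  constructor
  · have h := (MeasureTheory.integrableOn_image_iff_integrableOn_abs_deriv_smul MeasurableSet.univ
      hd hinj (fun x => Real.exp (-x) * x ^ (ν - 1))).1
        (by rw [himg]; exact Real.GammaIntegral_convergent hν)
    simp_rw [e] at h
    rwa [MeasureTheory.integrableOn_univ] at h
  · have h := MeasureTheory.integral_image_eq_integral_abs_deriv_smul MeasurableSet.univ
      hd hinj (fun x => Real.exp (-x) * x ^ (ν - 1))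
    simp_rw [e] at h
    rw [himg, MeasureTheory.setIntegral_univ] at h
    rw [← h, Real.Gamma_eq_integral hν]

/-- The translation `u = v - (t - log 2)` brings the integral into a form with a limit as `x = e^t`
tends to `0`. -/
lemma exp_mul_besselQ_eq (ν t : ℝ) :
    Complex.exp (ν * t) * besselQ ν t = ((1 / 2 * Real.exp (ν * Real.log 2) *
      ∫ v : ℝ, Real.exp (ν * v - Real.exp v - Real.exp (2 * t) / 4 * Real.exp (-v)) : ℝ) : ℂ) := by
  have e : ∀ u : ℝ, Complex.exp (ν * u - Complex.exp t * (Real.cosh u : ℝ)) =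
      ((Real.exp (ν * u - Real.exp t * Real.cosh u) : ℝ) : ℂ) := by
    intro u; push_cast; rfl
  unfold besselQ
  simp_rw [e]
  rw [integral_complex_ofReal, ← MeasureTheory.integral_sub_right_eq_self _ (t - Real.log 2)]
  have e2 : ∀ v : ℝ, Real.exp (ν * (v - (t - Real.log 2)) - Real.exp t *
      Real.cosh (v - (t - Real.log 2))) = Real.exp (ν * Real.log 2 - ν * t) *
        Real.exp (ν * v - Real.exp v - Real.exp (2 * t) / 4 * Real.exp (-v)) := by
    intro v
    have h1 : Real.exp t * Real.cosh (v - (t - Real.log 2)) =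
        Real.exp v + Real.exp (2 * t) / 4 * Real.exp (-v) := by
      have a1 : Real.exp (v - (t - Real.log 2)) = Real.exp v * 2 / Real.exp t := by
        rw [show v - (t - Real.log 2) = v + Real.log 2 - t by ring, Real.exp_sub, Real.exp_add,
          Real.exp_log two_pos]
      have a2 : Real.exp (-(v - (t - Real.log 2))) = Real.exp (-v) * Real.exp t / 2 := by
        rw [show -(v - (t - Real.log 2)) = -v + t - Real.log 2 by ring, Real.exp_sub, Real.exp_add,
          Real.exp_log two_pos]
      have a3 : Real.exp (2 * t) = Real.exp t * Real.exp t := by rw [← Real.exp_add]; ring_nf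
      rw [Real.cosh_eq, a1, a2, a3]
      have := Real.exp_pos t
      field_simp
      ring
    rw [h1, ← Real.exp_add]; ring_nf
  simp_rw [e2]
  rw [MeasureTheory.integral_const_mul, Real.exp_sub]
  generalize (∫ v : ℝ, Real.exp (ν * v - Real.exp v - Real.exp (2 * t) / 4 * Real.exp (-v))) = J
  push_cast
  have := Complex.exp_ne_zero (ν * t : ℂ)
  field_simp

lemma tendsto_exp_mul_besselQ {ν : ℝ} (hν : 0 < ν) :
    Tendsto (fun t : ℝ => Complex.exp (ν * t) * besselQ ν t) atBot
      (𝓝 (1 / 2 * Complex.exp (ν * (Real.log 2 : ℝ)) * Complex.Gamma ν)) := by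
  have hlim : Tendsto (fun t : ℝ => ∫ v : ℝ, Real.exp (ν * v - Real.exp v -
      Real.exp (2 * t) / 4 * Real.exp (-v))) atBot (𝓝 (∫ v : ℝ, Real.exp (ν * v - Real.exp v))) := by
    refine MeasureTheory.tendsto_integral_filter_of_dominated_convergence
      (fun v => Real.exp (ν * v - Real.exp v)) ?_ ?_ (integral_exp_sub_exp hν).1 ?_
    · exact Eventually.of_forall fun t => Continuous.aestronglyMeasurable (by fun_prop)
    · refine Eventually.of_forall fun t => Eventually.of_forall fun v => ?_
      rw [Real.norm_of_nonneg (Real.exp_pos _).le]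
      refine Real.exp_le_exp.2 ?_
      have := Real.exp_pos (2 * t)
      have := Real.exp_pos (-v)
      have : 0 ≤ Real.exp (2 * t) / 4 * Real.exp (-v) := by positivity
      linarith
    · refine Eventually.of_forall fun v => ?_
      have h2 : Tendsto (fun t : ℝ => Real.exp (2 * t)) atBot (𝓝 0) :=
        Real.tendsto_exp_atBot.comp (tendsto_id.const_mul_atBot two_pos)
      have h3 := ((h2.div_const 4).mul_const (Real.exp (-v))).const_sub (ν * v - Real.exp v)
      have h4 := (Real.continuous_exp.tendsto _).comp h3
      simpa [Function.comp_def] using h4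
  rw [(integral_exp_sub_exp hν).2] at hlim
  have h := (Complex.continuous_ofReal.tendsto _).comp
    (hlim.const_mul (1 / 2 * Real.exp (ν * Real.log 2)))
  simp_rw [exp_mul_besselQ_eq]
  have e : 1 / 2 * Complex.exp (ν * (Real.log 2 : ℝ)) * Complex.Gamma ν =
      ((1 / 2 * Real.exp (ν * Real.log 2) * Real.Gamma ν : ℝ) : ℂ) := by
    push_cast [Complex.Gamma_ofReal]; rfl
  rw [e]
  exact h

lemma tendsto_exp_neg_mul_besselI (μ : ℂ) :
    Tendsto (fun t : ℝ => Complex.exp (-μ * t) * besselI μ t) atBot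
      (𝓝 (Complex.exp (-μ * (Real.log 2 : ℝ)) * (Complex.Gamma (μ + 1))⁻¹)) := by
  have e : ∀ t : ℝ, Complex.exp (-μ * t) * besselI μ t =
      Complex.exp (-μ * (Real.log 2 : ℝ)) * besselPhi μ ((Real.exp (2 * t) / 4 : ℝ) : ℂ) := by
    intro t
    rw [besselI, ← mul_assoc, ← Complex.exp_add]
    push_cast
    ring_nf
  simp_rw [e, ← besselPhi_zero]
  refine Tendsto.const_mul _ ?_
  have h2 : Tendsto (fun t : ℝ => Real.exp (2 * t) / 4) atBot (𝓝 (0 / 4)) :=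
    (Real.tendsto_exp_atBot.comp (tendsto_id.const_mul_atBot two_pos)).div_const 4
  rw [zero_div] at h2
  have h3 := (Complex.continuous_ofReal.tendsto _).comp h2
  rw [Complex.ofReal_zero] at h3
  exact ((continuous_besselPhi μ).tendsto _).comp h3

/-- The Wronskian of the integral `besselQ μ` and of `besselI μ` equals `1`. -/
lemma wronskian_besselQ_besselI {μ : ℝ} (h1 : -1 < μ) (h0 : μ ≠ 0) (t : ℝ) :
    Complex.exp t * (besselQ μ t * besselI (μ + 1) t + besselI μ t * besselQ (μ + 1) t) = 1 := by
  set W : ℝ → ℂ := fun t =>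
    Complex.exp t * (besselQ μ t * besselI (μ + 1) t + besselI μ t * besselQ (μ + 1) t) with hW
  have hd : ∀ t : ℝ, HasDerivAt W 0 t := by
    intro t
    have hpos : 0 < (Complex.exp t).re := by
      rw [← Complex.ofReal_exp, Complex.ofReal_re]; exact Real.exp_pos t
    have d1 := hasDerivAt_besselQ_add_one μ hpos
    have d2 := hasDerivAt_besselQ_sub_one (μ + 1) hpos
    have d3 := hasDerivAt_besselI μ t
    have d4 := hasDerivAt_besselI' (μ + 1) t
    rw [add_sub_cancel_right] at d2 d4
    have d := ((Complex.hasDerivAt_exp t).mul ((d1.mul d4).add (d3.mul d2))).comp_ofReal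
    refine d.congr_deriv ?_
    simp only [Pi.add_apply, Pi.mul_apply]
    push_cast
    ring
  have hc : ∀ s, W s = W t := fun s =>
    is_const_of_deriv_eq_zero (fun y => (hd y).differentiableAt) (fun y => (hd y).deriv) s t
  have habs : 0 < |μ| := abs_pos.2 h0
  have hexp : 0 < 2 + μ - |μ| := by
    rcases abs_cases μ with h | h <;> linarith
  have hG : Complex.Gamma (μ + 1) ≠ 0 := by
    have : (μ : ℂ) + 1 = ((μ + 1 : ℝ) : ℂ) := by push_cast; ring
    rw [this, Complex.Gamma_ofReal]
    exact_mod_cast (Real.Gamma_pos_of_pos (by linarith)).ne'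
  have hQabs : ∀ w, besselQ |μ| w = besselQ μ w := by
    intro w
    rcases abs_choice μ with h | h <;> rw [h]
    exact besselQ_neg μ w
  have l1 : Tendsto (fun t : ℝ => Complex.exp ((2 + μ - |μ| : ℝ) * t)) atBot (𝓝 0) := by
    have := (Complex.continuous_ofReal.tendsto _).comp
      (Real.tendsto_exp_atBot.comp (tendsto_id.const_mul_atBot hexp))
    simpa [Function.comp_def] using this
  have l2 := (l1.mul (tendsto_exp_mul_besselQ habs)).mul (tendsto_exp_neg_mul_besselI (μ + 1))
  have l3 := (tendsto_exp_neg_mul_besselI μ).mul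
    (tendsto_exp_mul_besselQ (ν := μ + 1) (by linarith))
  have l := l2.add l3
  have hlim : Tendsto W atBot (𝓝 1) := by
    convert l using 2 with s
    · have a1 : Complex.exp s = Complex.exp ((2 + μ - |μ| : ℝ) * s) * Complex.exp (|μ| * s) *
          Complex.exp (-(μ + 1) * s) := by
        rw [← Complex.exp_add, ← Complex.exp_add]; congr 1; push_cast; ring
      have a2 : Complex.exp s = Complex.exp (-μ * s) * Complex.exp ((μ + 1 : ℝ) * s) := by
        rw [← Complex.exp_add]; congr 1; push_cast; ring
      rw [hW]
      simp only [hQabs]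
      rw [mul_add]
      nth_rewrite 1 [a1]
      rw [a2]
      ring
    · have b1 : Complex.exp (-μ * (Real.log 2 : ℝ)) *
          Complex.exp ((μ + 1 : ℂ) * (Real.log 2 : ℝ)) = 2 := by
        rw [← Complex.exp_add]; refine Eq.trans ?_ exp_log_two; congr 1; ring
      have b2 : ((μ + 1 : ℝ) : ℂ) = μ + 1 := by push_cast; ring
      have b3 : (Complex.Gamma (μ + 1))⁻¹ * Complex.Gamma (μ + 1) = 1 := inv_mul_cancel₀ hG
      rw [zero_mul, zero_mul, zero_add, b2]
      linear_combination (-1 / 2 : ℂ) * b1 - (1 / 2) * (Complex.exp (-μ * (Real.log 2 : ℝ)) *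
          Complex.exp ((μ + 1 : ℂ) * (Real.log 2 : ℝ))) * b3
  have hlim' : Tendsto W atBot (𝓝 (W t)) := by
    rw [show W = fun _ => W t from funext hc]; exact tendsto_const_nhds
  exact tendsto_nhds_unique hlim' hlim

/-- On the real line the integral equals the power series for `K_b`: the Wronskians with `I_b` and
`I_{-b}` form a linear system for the integral and its derivative, which determines both. -/
lemma besselQ_ofReal_eq_besselK {b : ℝ} (h0 : 0 < b) (h1 : b < 1) (t : ℝ) :
    besselQ b t = besselK b t := by
  have hpos : 0 < (Complex.exp t).re := by
    rw [← Complex.ofReal_exp, Complex.ofReal_re]; exact Real.exp_pos t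
  have w1 := wronskian_besselQ_besselI (μ := b) (by linarith) h0.ne' t
  have w2 := wronskian_besselQ_besselI (μ := -b) (by linarith) (neg_ne_zero.2 h0.ne') t
  have w3 := wronskian_besselI b t
  have r1 := besselQ_add_one_sub b hpos
  have r2 := besselI_sub_one b t
  have r3 : besselQ (-b + 1) t = besselQ (b - 1) t := by
    rw [← besselQ_neg]; ring_nf
  rw [besselQ_neg, r3] at w2
  push_cast at w2
  rw [show -(b : ℂ) + 1 = 1 - b by ring] at w2
  have hs : Complex.sin (Real.pi * b) ≠ 0 := by
    rw [← Complex.ofReal_mul, ← Complex.ofReal_sin]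
    have : 0 < Real.sin (Real.pi * b) :=
      Real.sin_pos_of_pos_of_lt_pi (by positivity) (by nlinarith [Real.pi_pos])
    exact_mod_cast this.ne'
  have hpi : (Real.pi : ℂ) ≠ 0 := by exact_mod_cast Real.pi_ne_zero
  have key : besselQ b t * (2 * Complex.sin (Real.pi * b) / Real.pi) =
      besselI (-b) t - besselI b t := by
    rw [← w3]
    linear_combination besselI (-b) t * w1 - besselI b t * w2 +
      besselI (-b) t * besselQ b t * r2 - besselI (-b) t * besselI b t * r1
  rw [besselK, ← key]
  field_simp

lemma re_exp_pos_of_abs_im_lt {w : ℂ} (hw : |w.im| < Real.pi / 2) : 0 < (Complex.exp w).re := by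
  rw [Complex.exp_re]
  exact mul_pos (Real.exp_pos _) (Real.cos_pos_of_mem_Ioo (abs_lt.1 hw))

lemma isOpen_strip (β r : ℝ) : IsOpen {w : ℂ | |w.im - β| < r} :=
  isOpen_lt (by fun_prop) continuous_const

lemma isPreconnected_strip (β r : ℝ) : IsPreconnected {w : ℂ | |w.im - β| < r} := by
  have h : Convex ℝ {w : ℂ | |w.im - β| < r} := by
    have := (convex_ball β r).linear_preimage Complex.imLm
    exact this
  exact h.isPreconnected

/-- The integral representation of `K_b` in the right half plane. -/
lemma besselQ_eq_besselK {b : ℝ} (h0 : 0 < b) (h1 : b < 1) {w : ℂ} (hw : |w.im| < Real.pi / 2) :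
    besselQ b w = besselK b w := by
  refine eqOn_of_eq_on_horizontal_line (isOpen_strip 0 (Real.pi / 2)) (isPreconnected_strip _ _)
    (f := besselQ b) (g := besselK b) (w₀ := 0) ?_ (differentiable_besselK _).differentiableOn
    (by simp; positivity) (fun t => ?_) (by simpa using hw)
  · intro z hz
    exact (hasDerivAt_besselQ b (re_exp_pos_of_abs_im_lt
      (by simpa using hz))).differentiableAt.differentiableWithinAt
  · simpa using besselQ_ofReal_eq_besselK h0 h1 t

/-! ### The inverse hyperbolic sine and the Laplace kernel -/

/-- The principal branch of `√(1 + s²)`. -/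
def rootS (s : ℂ) : ℂ := (1 + s ^ 2) ^ (1 / 2 : ℂ)

/-- The principal branch of the inverse hyperbolic sine. -/
def arsinhC (s : ℂ) : ℂ := Complex.log (s + rootS s)

/-- The kernel `cosh (2 ν arsinh s) / √(1 + s²)` of the integral for `K_ν` in the variable
`s = sinh (u / 2)`. -/
def kernelG (ν : ℝ) (s : ℂ) : ℂ := Complex.cosh (2 * ν * arsinhC s) / rootS s

/-- The derivative of `kernelG`. -/
def kernelG' (ν : ℝ) (s : ℂ) : ℂ :=
  2 * ν * Complex.sinh (2 * ν * arsinhC s) / rootS s ^ 2 -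
    s * Complex.cosh (2 * ν * arsinhC s) / rootS s ^ 3

lemma rootS_sq (s : ℂ) : rootS s ^ 2 = 1 + s ^ 2 := by
  simp [rootS]

lemma rootS_re_pos {s : ℂ} (hs : 1 + s ^ 2 ∈ Complex.slitPlane) : 0 < (rootS s).re := by
  rw [rootS, Complex.cpow_def_of_ne_zero (Complex.slitPlane_ne_zero hs), Complex.exp_re]
  refine mul_pos (Real.exp_pos _) (Real.cos_pos_of_mem_Ioo ?_)
  have h1 : (Complex.log (1 + s ^ 2) * (1 / 2)).im = Complex.arg (1 + s ^ 2) / 2 := by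
    rw [show Complex.log (1 + s ^ 2) * (1 / 2) = Complex.log (1 + s ^ 2) * ((1 / 2 : ℝ) : ℂ) by
      push_cast; ring, Complex.im_mul_ofReal, Complex.log_im]; ring
  rw [h1]
  have h2 := Complex.neg_pi_lt_arg (1 + s ^ 2)
  have h3 := lt_of_le_of_ne (Complex.arg_le_pi (1 + s ^ 2)) (Complex.slitPlane_arg_ne_pi hs)
  constructor <;> linarith

lemma rootS_ne_zero {s : ℂ} (hs : 1 + s ^ 2 ∈ Complex.slitPlane) : rootS s ≠ 0 := fun h => by
  have := rootS_re_pos hs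
  rw [h] at this
  simp at this

lemma add_rootS_mul_sub (s : ℂ) : (s + rootS s) * (rootS s - s) = 1 := by
  linear_combination rootS_sq s

lemma add_rootS_re_pos {s : ℂ} (hs : 1 + s ^ 2 ∈ Complex.slitPlane) : 0 < (s + rootS s).re := by
  have h := add_rootS_mul_sub s
  have hne : s + rootS s ≠ 0 := left_ne_zero_of_mul_eq_one h
  have h2 : rootS s = ((s + rootS s) + (s + rootS s)⁻¹) / 2 := by
    rw [← eq_inv_of_mul_eq_one_right h]; ring
  have h3 := rootS_re_pos hs
  rw [h2] at h3
  set p := s + rootS s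
  have hn : 0 < Complex.normSq p := Complex.normSq_pos.2 hne
  rw [show (p + p⁻¹) / 2 = ((1 / 2 : ℝ) : ℂ) * (p + p⁻¹) by push_cast; ring,
    Complex.re_ofReal_mul, Complex.add_re, Complex.inv_re] at h3
  by_contra! hc
  have : p.re / Complex.normSq p ≤ 0 := div_nonpos_of_nonpos_of_nonneg hc hn.le
  linarith

lemma hasDerivAt_rootS {s : ℂ} (hs : 1 + s ^ 2 ∈ Complex.slitPlane) :
    HasDerivAt rootS (s / rootS s) s := by
  have h1 : HasDerivAt (fun s : ℂ => 1 + s ^ 2) (2 * s) s := by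
    simpa using (hasDerivAt_pow 2 s).const_add 1
  have h2 := h1.cpow_const (c := 1 / 2) hs
  refine h2.congr_deriv ?_
  have hne := Complex.slitPlane_ne_zero hs
  rw [Complex.cpow_sub _ _ hne, Complex.cpow_one]
  have := rootS_ne_zero hs
  change 1 / 2 * (rootS s / (1 + s ^ 2)) * (2 * s) = _
  rw [← rootS_sq]
  field_simp

lemma hasDerivAt_arsinhC {s : ℂ} (hs : 1 + s ^ 2 ∈ Complex.slitPlane) :
    HasDerivAt arsinhC (1 / rootS s) s := by
  have h := ((hasDerivAt_id s).add (hasDerivAt_rootS hs)).clog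
    (Or.inl (add_rootS_re_pos hs))
  refine h.congr_deriv ?_
  have h1 := rootS_ne_zero hs
  have h2 : s + rootS s ≠ 0 := left_ne_zero_of_mul_eq_one (add_rootS_mul_sub s)
  simp only [Pi.add_apply, id]
  field_simp
  ring

lemma hasDerivAt_kernelG (ν : ℝ) {s : ℂ} (hs : 1 + s ^ 2 ∈ Complex.slitPlane) :
    HasDerivAt (kernelG ν) (kernelG' ν s) s := by
  have h1 := ((hasDerivAt_arsinhC hs).const_mul (2 * (ν : ℂ))).ccosh
  have h := h1.div (hasDerivAt_rootS hs) (rootS_ne_zero hs)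
  refine h.congr_deriv ?_
  have := rootS_ne_zero hs
  unfold kernelG'
  field_simp

lemma exp_arsinhC (s : ℂ) : Complex.exp (arsinhC s) = s + rootS s :=
  Complex.exp_log (left_ne_zero_of_mul_eq_one (add_rootS_mul_sub s))

lemma exp_neg_arsinhC (s : ℂ) : Complex.exp (-arsinhC s) = rootS s - s := by
  rw [Complex.exp_neg, exp_arsinhC]
  exact (eq_inv_of_mul_eq_one_right (add_rootS_mul_sub s)).symm

lemma norm_rootS_le (s : ℂ) : ‖rootS s‖ ≤ 1 + ‖s‖ := by
  refine abs_le_of_sq_le_sq' ?_ (by positivity) |>.2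
  rw [← norm_pow, rootS_sq]
  calc ‖1 + s ^ 2‖ ≤ ‖(1 : ℂ)‖ + ‖s ^ 2‖ := norm_add_le _ _
    _ ≤ (1 + ‖s‖) ^ 2 := by rw [norm_one, norm_pow]; nlinarith [norm_nonneg s]

lemma norm_exp_two_mul_arsinhC_le {ν : ℝ} (h0 : 0 ≤ ν) (h1 : ν ≤ 1) (s : ℂ) :
    ‖Complex.exp (2 * ν * arsinhC s)‖ ≤ (1 + 2 * ‖s‖) ^ 2 ∧
      ‖Complex.exp (-(2 * ν * arsinhC s))‖ ≤ (1 + 2 * ‖s‖) ^ 2 := by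
  have hr := norm_rootS_le s
  have a1 : Real.exp (arsinhC s).re ≤ 1 + 2 * ‖s‖ := by
    rw [← Complex.norm_exp, exp_arsinhC]
    have := norm_add_le s (rootS s)
    linarith
  have a2 : Real.exp (-(arsinhC s).re) ≤ 1 + 2 * ‖s‖ := by
    rw [← Complex.neg_re, ← Complex.norm_exp, exp_neg_arsinhC]
    have := norm_sub_le (rootS s) s
    linarith
  have a3 : Real.exp (2 * |(arsinhC s).re|) ≤ (1 + 2 * ‖s‖) ^ 2 := by
    rw [two_mul, Real.exp_add, ← sq]
    refine pow_le_pow_left₀ (Real.exp_pos _).le ?_ 2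
    rcases abs_choice (arsinhC s).re with h | h <;> rw [h] <;> assumption
  have e : (2 * (ν : ℂ) * arsinhC s).re = 2 * ν * (arsinhC s).re := by
    rw [show 2 * (ν : ℂ) * arsinhC s = ((2 * ν : ℝ) : ℂ) * arsinhC s by push_cast; ring,
      Complex.re_ofReal_mul]
  have b1 := le_abs_self (arsinhC s).re
  have b2 := neg_abs_le (arsinhC s).re
  have b3 := abs_nonneg (arsinhC s).re
  constructor
  · rw [Complex.norm_exp, e]
    refine (Real.exp_le_exp.2 ?_).trans a3
    nlinarith
  · rw [Complex.norm_exp, Complex.neg_re, e]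
    refine (Real.exp_le_exp.2 ?_).trans a3
    nlinarith

lemma norm_cosh_sinh_arsinhC_le {ν : ℝ} (h0 : 0 ≤ ν) (h1 : ν ≤ 1) (s : ℂ) :
    ‖Complex.cosh (2 * ν * arsinhC s)‖ ≤ (1 + 2 * ‖s‖) ^ 2 ∧
      ‖Complex.sinh (2 * ν * arsinhC s)‖ ≤ (1 + 2 * ‖s‖) ^ 2 := by
  obtain ⟨a1, a2⟩ := norm_exp_two_mul_arsinhC_le h0 h1 s
  constructor
  · rw [Complex.cosh, norm_div, Complex.norm_ofNat]
    have := norm_add_le (Complex.exp (2 * ν * arsinhC s)) (Complex.exp (-(2 * ν * arsinhC s)))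
    linarith
  · rw [Complex.sinh, norm_div, Complex.norm_ofNat]
    have := norm_sub_le (Complex.exp (2 * ν * arsinhC s)) (Complex.exp (-(2 * ν * arsinhC s)))
    linarith

lemma norm_rootS_lower {κ : ℝ} {s : ℂ} (h : κ ^ 2 ≤ ‖1 + s ^ 2‖) :
    κ ≤ ‖rootS s‖ := by
  rw [← rootS_sq, norm_pow] at h
  exact abs_le_of_sq_le_sq' h (norm_nonneg _) |>.2

lemma norm_kernelG_le {ν : ℝ} (h0 : 0 ≤ ν) (h1 : ν ≤ 1) {κ : ℝ} (hκ : 0 < κ) {s : ℂ}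
    (h : κ ^ 2 ≤ ‖1 + s ^ 2‖) : ‖kernelG ν s‖ ≤ (1 + 2 * ‖s‖) ^ 2 / κ := by
  rw [kernelG, norm_div]
  have := norm_rootS_lower h
  have := (norm_cosh_sinh_arsinhC_le h0 h1 s).1
  gcongr

lemma norm_kernelG'_le {ν : ℝ} (h0 : 0 ≤ ν) (h1 : ν ≤ 1) {κ : ℝ} (hκ : 0 < κ) {s : ℂ}
    (h : κ ^ 2 ≤ ‖1 + s ^ 2‖) :
    ‖kernelG' ν s‖ ≤ 2 * (1 + 2 * ‖s‖) ^ 2 / κ ^ 2 + ‖s‖ * (1 + 2 * ‖s‖) ^ 2 / κ ^ 3 := by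
  have hr := norm_rootS_lower h
  obtain ⟨a1, a2⟩ := norm_cosh_sinh_arsinhC_le h0 h1 s
  have a3 : ‖2 * (ν : ℂ)‖ ≤ 2 := by
    rw [norm_mul, Complex.norm_ofNat, Complex.norm_real, Real.norm_of_nonneg h0]; linarith
  refine (norm_sub_le _ _).trans (add_le_add ?_ ?_)
  · rw [norm_div, norm_mul, norm_pow]
    gcongr
  · rw [norm_div, norm_mul, norm_pow]
    gcongr

/-! ### Taylor expansion of the kernel -/

lemma norm_cosh_sub_le {z : ℂ} (hz : ‖z‖ ≤ 1) :
    ‖Complex.cosh z - 1 - z ^ 2 / 2‖ ≤ ‖z‖ ^ 4 := by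
  have h1 := Complex.exp_bound hz (n := 4) (by norm_num)
  have h2 := Complex.exp_bound (x := -z) (by rwa [norm_neg]) (n := 4) (by norm_num)
  rw [norm_neg] at h2
  have e : Complex.cosh z - 1 - z ^ 2 / 2 =
      ((Complex.exp z - ∑ m ∈ Finset.range 4, z ^ m / (m.factorial : ℂ)) +
        (Complex.exp (-z) - ∑ m ∈ Finset.range 4, (-z) ^ m / (m.factorial : ℂ))) / 2 := by
    rw [Complex.cosh]
    simp only [Finset.sum_range_succ, Finset.sum_range_zero, Nat.factorial]
    push_cast
    ring
  rw [e, norm_div, Complex.norm_ofNat]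
  have h3 := norm_add_le (Complex.exp z - ∑ m ∈ Finset.range 4, z ^ m / (m.factorial : ℂ))
    (Complex.exp (-z) - ∑ m ∈ Finset.range 4, (-z) ^ m / (m.factorial : ℂ))
  have h4 : (((4 : ℕ).succ : ℝ) * (((4 : ℕ).factorial : ℝ) * ((4 : ℕ) : ℝ))⁻¹) ≤ 1 := by
    norm_num [Nat.factorial]
  have h5 := mul_le_mul_of_nonneg_left h4 (pow_nonneg (norm_nonneg z) 4)
  linarith

lemma one_le_norm_rootS_add_one {s : ℂ} (hs : 1 + s ^ 2 ∈ Complex.slitPlane) :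
    1 ≤ ‖rootS s + 1‖ := by
  refine le_trans ?_ (Complex.re_le_norm _)
  have := rootS_re_pos hs
  simp only [Complex.add_re, Complex.one_re]; linarith

lemma rootS_add_one_ne_zero {s : ℂ} (hs : 1 + s ^ 2 ∈ Complex.slitPlane) : rootS s + 1 ≠ 0 :=
  fun h => by
    have := one_le_norm_rootS_add_one hs
    rw [h, norm_zero] at this
    linarith

lemma norm_inv_rootS_sub_le {s : ℂ} (hs : 1 + s ^ 2 ∈ Complex.slitPlane) :
    ‖1 / rootS s - 1‖ ≤ ‖s‖ ^ 2 / ‖rootS s‖ ∧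
      ‖1 / rootS s - 1 + s ^ 2 / 2‖ ≤ ‖s‖ ^ 4 / ‖rootS s‖ := by
  have hq := rootS_ne_zero hs
  have hq1 := rootS_add_one_ne_zero hs
  have hn := one_le_norm_rootS_add_one hs
  have hs2 : s ^ 2 = (rootS s - 1) * (rootS s + 1) := by linear_combination -rootS_sq s
  have hqp : 0 < ‖rootS s‖ := norm_pos_iff.2 hq
  constructor
  · have e : 1 / rootS s - 1 = -(s ^ 2 / rootS s * (1 / (rootS s + 1))) := by
      rw [hs2]; field_simp; ring
    rw [e, norm_neg, norm_mul, norm_div, norm_pow, norm_div, norm_one]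
    have : 1 / ‖rootS s + 1‖ ≤ 1 := by rw [div_le_one (by linarith)]; exact hn
    exact mul_le_of_le_one_right (by positivity) this
  · have e : 1 / rootS s - 1 + s ^ 2 / 2 =
        s ^ 4 / rootS s * ((rootS s + 2) / (2 * (rootS s + 1) ^ 2)) := by
      rw [show s ^ 4 = (s ^ 2) ^ 2 by ring, hs2]; field_simp; ring
    rw [e, norm_mul, norm_div, norm_pow, norm_div]
    have h3 : ‖rootS s + 2‖ ≤ ‖rootS s + 1‖ + 1 := by
      have := norm_add_le (rootS s + 1) 1
      rwa [norm_one, add_assoc, one_add_one_eq_two] at this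
    have : ‖rootS s + 2‖ / ‖2 * (rootS s + 1) ^ 2‖ ≤ 1 := by
      rw [norm_mul, norm_pow, Complex.norm_ofNat, div_le_one (by positivity)]
      nlinarith
    exact mul_le_of_le_one_right (by positivity) this

lemma small_mem {s : ℂ} (h : ‖s‖ ≤ 1 / 2) :
    1 + s ^ 2 ∈ Complex.slitPlane ∧ 1 / 2 ≤ ‖rootS s‖ := by
  have h1 : ‖s ^ 2‖ ≤ 1 / 4 := by rw [norm_pow]; nlinarith [norm_nonneg s]
  have h2 : 3 / 4 ≤ (1 + s ^ 2).re := by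
    have := (abs_le.1 ((Complex.abs_re_le_norm (s ^ 2)).trans h1)).1
    rw [Complex.add_re, Complex.one_re]; linarith
  refine ⟨Or.inl (by linarith), norm_rootS_lower ?_⟩
  refine le_trans ?_ (Complex.re_le_norm _)
  linarith

lemma norm_arsinhC_sub_le {s : ℂ} (h : ‖s‖ ≤ 1 / 2) : ‖arsinhC s - s‖ ≤ 2 * ‖s‖ ^ 3 := by
  have hd : ∀ z ∈ Metric.closedBall (0 : ℂ) ‖s‖,
      HasDerivWithinAt (fun z => arsinhC z - z) (1 / rootS z - 1)
        (Metric.closedBall (0 : ℂ) ‖s‖) z := by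
    intro z hz
    have hz' : ‖z‖ ≤ 1 / 2 := (mem_closedBall_zero_iff.1 hz).trans h
    exact ((hasDerivAt_arsinhC (small_mem hz').1).sub (hasDerivAt_id z)).hasDerivWithinAt
  have hb : ∀ z ∈ Metric.closedBall (0 : ℂ) ‖s‖, ‖1 / rootS z - 1‖ ≤ 2 * ‖s‖ ^ 2 := by
    intro z hz
    have hz0 : ‖z‖ ≤ ‖s‖ := mem_closedBall_zero_iff.1 hz
    have hz' : ‖z‖ ≤ 1 / 2 := hz0.trans h
    obtain ⟨h1, h2⟩ := small_mem hz'
    refine (norm_inv_rootS_sub_le h1).1.trans ?_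
    rw [div_le_iff₀ (by linarith)]
    have : ‖z‖ ^ 2 ≤ ‖s‖ ^ 2 := pow_le_pow_left₀ (norm_nonneg z) hz0 2
    nlinarith [sq_nonneg ‖s‖]
  have := (convex_closedBall (0 : ℂ) ‖s‖).norm_image_sub_le_of_norm_hasDerivWithin_le hd hb
    (Metric.mem_closedBall_self (norm_nonneg s)) (mem_closedBall_zero_iff.2 le_rfl)
  have h0 : arsinhC 0 = 0 := by simp [arsinhC, rootS]
  simp only [h0, sub_zero] at this
  linarith

lemma norm_kernelG_sub_le_small {ν : ℝ} (h0 : 0 ≤ ν) (h1 : ν ≤ 1) {s : ℂ} (h : ‖s‖ ≤ 1 / 4) :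
    ‖kernelG ν s - (1 + (2 * ν ^ 2 - 1 / 2) * s ^ 2)‖ ≤ 600 * ‖s‖ ^ 4 := by
  have hs : ‖s‖ ≤ 1 / 2 := by linarith
  obtain ⟨m1, m2⟩ := small_mem hs
  have hpos := norm_nonneg s
  set y := arsinhC s
  have hy1 : ‖y - s‖ ≤ 2 * ‖s‖ ^ 3 := norm_arsinhC_sub_le hs
  have hs2 : ‖s‖ ^ 2 ≤ 1 / 16 := by nlinarith
  have hs4 : 0 ≤ ‖s‖ ^ 4 := by positivity
  have hs3 : 2 * ‖s‖ ^ 3 ≤ ‖s‖ / 8 := by nlinarith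
  have hy2 : ‖y‖ ≤ 2 * ‖s‖ := by
    have := norm_add_le (y - s) s
    rw [sub_add_cancel] at this
    linarith
  have hν : ‖(ν : ℂ)‖ ≤ 1 := by rwa [Complex.norm_real, Real.norm_of_nonneg h0]
  have hz : ‖2 * (ν : ℂ) * y‖ ≤ 4 * ‖s‖ := by
    rw [norm_mul, norm_mul, Complex.norm_ofNat]
    nlinarith [norm_nonneg y, norm_nonneg (ν : ℂ)]
  -- The error in `cosh (2νy) = 1 + 2ν²s² + O(s⁴)`.
  have c1 : ‖Complex.cosh (2 * ν * y) - 1 - 2 * ν ^ 2 * s ^ 2‖ ≤ 270 * ‖s‖ ^ 4 := by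
    have a1 : ‖Complex.cosh (2 * ν * y) - 1 - (2 * ν * y) ^ 2 / 2‖ ≤ 256 * ‖s‖ ^ 4 := by
      refine (norm_cosh_sub_le (by linarith)).trans ?_
      refine (pow_le_pow_left₀ (norm_nonneg _) hz 4).trans ?_
      rw [mul_pow]; norm_num
    have a2 : ‖2 * (ν : ℂ) ^ 2 * ((y - s) * (y + s))‖ ≤ 14 * ‖s‖ ^ 4 := by
      have b1 : ‖y + s‖ ≤ 3 * ‖s‖ := (norm_add_le _ _).trans (by linarith)
      have b2 : ‖(ν : ℂ)‖ ^ 2 ≤ 1 := pow_le_one₀ (norm_nonneg _) hν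
      rw [norm_mul, norm_mul, norm_mul, norm_pow, Complex.norm_ofNat]
      have b3 : ‖y - s‖ * ‖y + s‖ ≤ (2 * ‖s‖ ^ 3) * (3 * ‖s‖) := by gcongr
      calc 2 * ‖(ν : ℂ)‖ ^ 2 * (‖y - s‖ * ‖y + s‖)
          ≤ 2 * 1 * ((2 * ‖s‖ ^ 3) * (3 * ‖s‖)) := by gcongr
        _ ≤ 14 * ‖s‖ ^ 4 := by nlinarith
    have e : Complex.cosh (2 * ν * y) - 1 - 2 * ν ^ 2 * s ^ 2 =
        (Complex.cosh (2 * ν * y) - 1 - (2 * ν * y) ^ 2 / 2) +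
          2 * (ν : ℂ) ^ 2 * ((y - s) * (y + s)) := by ring
    rw [e]
    exact (norm_add_le _ _).trans (by linarith)
  have d := (norm_inv_rootS_sub_le m1).2
  have d1 : ‖1 / rootS s - 1 + s ^ 2 / 2‖ ≤ 2 * ‖s‖ ^ 4 := by
    refine d.trans ?_
    rw [div_le_iff₀ (by linarith)]
    nlinarith
  have d2 : ‖1 / rootS s‖ ≤ 2 := by
    rw [norm_div, norm_one, div_le_iff₀ (by linarith)]; linarith
  have hν2 : ‖(ν : ℂ)‖ ^ 2 ≤ 1 := pow_le_one₀ (norm_nonneg _) hν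
  have d3 : ‖1 + 2 * (ν : ℂ) ^ 2 * s ^ 2‖ ≤ 2 := by
    refine (norm_add_le _ _).trans ?_
    rw [norm_one, norm_mul, norm_mul, norm_pow, norm_pow, Complex.norm_ofNat]
    nlinarith [sq_nonneg ‖s‖]
  have e : kernelG ν s - (1 + (2 * ν ^ 2 - 1 / 2) * s ^ 2) =
      (Complex.cosh (2 * ν * y) - 1 - 2 * ν ^ 2 * s ^ 2) * (1 / rootS s) +
        (1 + 2 * (ν : ℂ) ^ 2 * s ^ 2) * (1 / rootS s - 1 + s ^ 2 / 2) - (ν : ℂ) ^ 2 * s ^ 4 := by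
    rw [kernelG]; ring
  have f1 : ‖(Complex.cosh (2 * ν * y) - 1 - 2 * ν ^ 2 * s ^ 2) * (1 / rootS s)‖ ≤
      270 * ‖s‖ ^ 4 * 2 := by
    rw [norm_mul]; gcongr
  have f2 : ‖(1 + 2 * (ν : ℂ) ^ 2 * s ^ 2) * (1 / rootS s - 1 + s ^ 2 / 2)‖ ≤
      2 * (2 * ‖s‖ ^ 4) := by
    rw [norm_mul]; gcongr
  have f3 : ‖(ν : ℂ) ^ 2 * s ^ 4‖ ≤ 1 * ‖s‖ ^ 4 := by
    rw [norm_mul, norm_pow, norm_pow]; gcongr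
  rw [e]
  refine (norm_sub_le _ _).trans ?_
  have f4 := norm_add_le ((Complex.cosh (2 * ν * y) - 1 - 2 * ν ^ 2 * s ^ 2) * (1 / rootS s))
    ((1 + 2 * (ν : ℂ) ^ 2 * s ^ 2) * (1 / rootS s - 1 + s ^ 2 / 2))
  linarith

lemma norm_kernelG_sub_le {ν : ℝ} (h0 : 0 ≤ ν) (h1 : ν ≤ 1) {κ : ℝ} (hκ : 0 < κ) {s : ℂ}
    (h : κ ^ 2 ≤ ‖1 + s ^ 2‖) :
    ‖kernelG ν s - (1 + (2 * ν ^ 2 - 1 / 2) * s ^ 2)‖ ≤ (600 + 576 / κ) * ‖s‖ ^ 4 := by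
  have hk : 0 < 576 / κ := by positivity
  rcases le_total ‖s‖ (1 / 4) with hs | hs
  · refine (norm_kernelG_sub_le_small h0 h1 hs).trans ?_
    have : 0 ≤ ‖s‖ ^ 4 := by positivity
    nlinarith
  · have a1 : ‖kernelG ν s‖ ≤ 576 / κ * ‖s‖ ^ 4 := by
      refine (norm_kernelG_le h0 h1 hκ h).trans ?_
      rw [div_mul_eq_mul_div]
      gcongr
      have b1 : (1 + 2 * ‖s‖) ^ 2 ≤ (6 * ‖s‖) ^ 2 := by gcongr; linarith
      have b2 : 1 / 16 ≤ ‖s‖ ^ 2 := by nlinarith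
      nlinarith [sq_nonneg ‖s‖]
    have b2 : 1 / 16 ≤ ‖s‖ ^ 2 := by nlinarith
    have b3 : ‖s‖ ^ 2 ≤ 16 * ‖s‖ ^ 4 := by nlinarith [sq_nonneg ‖s‖]
    have a2 : ‖1 + (2 * (ν : ℂ) ^ 2 - 1 / 2) * s ^ 2‖ ≤ 600 * ‖s‖ ^ 4 := by
      refine (norm_add_le _ _).trans ?_
      have c : ‖2 * (ν : ℂ) ^ 2 - 1 / 2‖ ≤ 2 := by
        rw [show 2 * (ν : ℂ) ^ 2 - 1 / 2 = ((2 * ν ^ 2 - 1 / 2 : ℝ) : ℂ) by push_cast; ring,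
          Complex.norm_real, Real.norm_eq_abs, abs_le]
        constructor <;> nlinarith
      rw [norm_one, norm_mul, norm_pow]
      nlinarith [sq_nonneg ‖s‖]
    exact (norm_sub_le _ _).trans (by linarith)

/-! ### Gaussian moments -/

lemma integrable_gaussian_poly {δ : ℝ} (hδ : 0 < δ) :
    MeasureTheory.Integrable fun r : ℝ => (1 + r ^ 4) * Real.exp (-δ * r ^ 2) := by
  have h1 := integrable_exp_neg_mul_sq hδ
  have h2 := integrable_rpow_mul_exp_neg_mul_sq hδ (s := (4 : ℕ)) (by norm_num)
  simp_rw [Real.rpow_natCast] at h2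
  refine (h1.add h2).congr (Eventually.of_forall fun r => ?_)
  simp only [Pi.add_apply]; ring

lemma norm_cexp_neg_mul_sq (B : ℂ) (r : ℝ) :
    ‖Complex.exp (-B * r ^ 2)‖ = Real.exp (-B.re * r ^ 2) := by
  rw [Complex.norm_exp, ← Complex.ofReal_pow, Complex.re_mul_ofReal, Complex.neg_re]

lemma integrable_mul_gaussian {B : ℂ} (hB : 0 < B.re) {f : ℝ → ℂ} {C : ℝ}
    (hf : MeasureTheory.AEStronglyMeasurable f) (hb : ∀ r, ‖f r‖ ≤ C * (1 + r ^ 4)) :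
    MeasureTheory.Integrable fun r : ℝ => f r * Complex.exp (-B * r ^ 2) := by
  refine ((integrable_gaussian_poly hB).const_mul C).mono'
    (hf.mul (Continuous.aestronglyMeasurable (by fun_prop))) (Eventually.of_forall fun r => ?_)
  rw [norm_mul, norm_cexp_neg_mul_sq, ← mul_assoc]
  gcongr
  exact hb r

lemma integral_sq_mul_gaussian {B : ℂ} (hB : 0 < B.re) :
    2 * B * ∫ r : ℝ, (r : ℂ) ^ 2 * Complex.exp (-B * r ^ 2) =
      ∫ r : ℝ, Complex.exp (-B * r ^ 2) := by
  have i0 : MeasureTheory.Integrable fun r : ℝ => Complex.exp (-B * r ^ 2) := by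
    have := integrable_mul_gaussian hB (f := fun _ => 1) (C := 1)
      (Continuous.aestronglyMeasurable (by fun_prop)) (fun r => by
        rw [norm_one]; nlinarith [sq_nonneg (r ^ 2)])
    simpa using this
  have i1 := integrable_mul_gaussian hB (f := fun r => (r : ℂ)) (C := 1)
      (Continuous.aestronglyMeasurable (by fun_prop)) (fun r => by
        rw [Complex.norm_real, Real.norm_eq_abs, abs_le]
        constructor <;> nlinarith [sq_nonneg (r ^ 2 - 1), sq_nonneg (r - 1), sq_nonneg (r + 1)])
  have i2 := integrable_mul_gaussian hB (f := fun r => (r : ℂ) ^ 2) (C := 1)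
      (Continuous.aestronglyMeasurable (by fun_prop)) (fun r => by
        rw [norm_pow, Complex.norm_real, Real.norm_eq_abs, sq_abs]
        nlinarith [sq_nonneg (r ^ 2 - 1), sq_nonneg r])
  have hd : ∀ r : ℝ, HasDerivAt (fun r : ℝ => (r : ℂ) * Complex.exp (-B * r ^ 2))
      (Complex.exp (-B * r ^ 2) - 2 * B * ((r : ℂ) ^ 2 * Complex.exp (-B * r ^ 2))) r := by
    intro r
    have h1 := (((hasDerivAt_pow 2 (r : ℂ)).const_mul (-B)).cexp)
    have h2 := ((hasDerivAt_id (r : ℂ)).mul h1).comp_ofReal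
    refine h2.congr_deriv ?_
    simp only [id]
    push_cast
    ring
  have h := MeasureTheory.integral_eq_zero_of_hasDerivAt_of_integrable hd
    (i0.sub (i2.const_mul _)) i1
  rw [MeasureTheory.integral_sub i0 (i2.const_mul _), MeasureTheory.integral_const_mul] at h
  linear_combination -h

/-- The Gaussian integral with complex coefficient `2 e^{iβ}`, in which the phase of the square root
is determined by `|β| < π / 2`. -/
lemma exp_half_mul_integral_gaussian {β : ℝ} (hβ : |β| < Real.pi / 2) :
    Complex.exp (β * Complex.I / 2) *
      ∫ r : ℝ, Complex.exp (-(2 * Complex.exp (β * Complex.I)) * r ^ 2) =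
        ((Real.sqrt (Real.pi / 2) : ℝ) : ℂ) := by
  obtain ⟨hβ1, hβ2⟩ := abs_lt.1 hβ
  have hre : 0 < (2 * Complex.exp (β * Complex.I)).re := by
    rw [show (2 : ℂ) * Complex.exp (β * Complex.I) = ((2 : ℝ) : ℂ) * Complex.exp (β * Complex.I) by
      norm_num, Complex.re_ofReal_mul, Complex.exp_ofReal_mul_I_re]
    exact mul_pos two_pos (Real.cos_pos_of_mem_Ioo (abs_lt.1 hβ))
  have hpi := Real.pi_pos
  have e : Real.pi / (2 * Complex.exp (β * Complex.I)) =
      Complex.exp ((Real.log (Real.pi / 2) : ℝ) - β * Complex.I) := by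
    rw [Complex.exp_sub, ← Complex.ofReal_exp, Real.exp_log (by positivity)]
    push_cast
    rw [div_div]
  have him : ((Real.log (Real.pi / 2) : ℝ) - β * Complex.I : ℂ).im = -β := by
    simp
  rw [integral_gaussian_complex hre, e, Complex.cpow_def_of_ne_zero (Complex.exp_ne_zero _),
    Complex.log_exp (by rw [him]; linarith) (by rw [him]; linarith), ← Complex.exp_add]
  have e2 : β * Complex.I / 2 + ((Real.log (Real.pi / 2) : ℝ) - β * Complex.I) * (1 / 2 : ℂ) =
      ((Real.log (Real.pi / 2) * (1 / 2) : ℝ) : ℂ) := by push_cast; ring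
  rw [e2, ← Complex.ofReal_exp, ← Real.rpow_def_of_pos (by positivity), Real.sqrt_eq_rpow]

/-! ### The square root on lines through the origin -/

/-- On the line through the origin in a direction `φ` with `|φ| < π / 2`, `1 + s²` avoids the cut of
the square root, and its modulus is at least `cos φ`. -/
lemma one_add_sq_mem_of_sector {φ : ℝ} (hφ : |φ| < Real.pi / 2) {s : ℂ} {ρ : ℝ}
    (hs : s = ρ * Complex.exp (φ * Complex.I)) :
    1 + s ^ 2 ∈ Complex.slitPlane ∧ Real.cos φ ≤ ‖1 + s ^ 2‖ := by
  obtain ⟨hφ1, hφ2⟩ := abs_lt.1 hφ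
  have hc : 0 < Real.cos φ := Real.cos_pos_of_mem_Ioo ⟨hφ1, hφ2⟩
  have e : 1 + s ^ 2 = ((1 + ρ ^ 2 * Real.cos (2 * φ) : ℝ) : ℂ) +
      ((ρ ^ 2 * Real.sin (2 * φ) : ℝ) : ℂ) * Complex.I := by
    rw [hs, mul_pow, ← Complex.exp_nat_mul,
      show ((2 : ℕ) : ℂ) * (φ * Complex.I) = ((2 * φ : ℝ) : ℂ) * Complex.I by push_cast; ring,
      Complex.exp_mul_I, ← Complex.ofReal_cos, ← Complex.ofReal_sin]
    push_cast; ring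
  have hre : (1 + s ^ 2).re = 1 + ρ ^ 2 * Real.cos (2 * φ) := by
    rw [e]
    simp only [Complex.add_re, Complex.re_ofReal_mul, Complex.ofReal_re, Complex.I_re, mul_zero,
      add_zero]
  have him : (1 + s ^ 2).im = ρ ^ 2 * Real.sin (2 * φ) := by
    rw [e]
    simp only [Complex.add_im, Complex.im_ofReal_mul, Complex.ofReal_im, Complex.I_im, mul_one,
      zero_add]
  have hlow : Real.cos φ ≤ ‖1 + s ^ 2‖ := by
    refine abs_le_of_sq_le_sq' ?_ (norm_nonneg _) |>.2
    rw [← Complex.normSq_eq_norm_sq, Complex.normSq_apply, hre, him]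
    have h1 := Real.sin_sq_add_cos_sq (2 * φ)
    have h2 := Real.cos_two_mul φ
    have h3 : Real.cos φ ^ 2 ≤ 1 := by nlinarith [Real.sin_sq_add_cos_sq φ]
    have h4 : (1 + ρ ^ 2 * Real.cos (2 * φ)) * (1 + ρ ^ 2 * Real.cos (2 * φ)) +
        ρ ^ 2 * Real.sin (2 * φ) * (ρ ^ 2 * Real.sin (2 * φ)) =
        1 + 2 * ρ ^ 2 * Real.cos (2 * φ) + ρ ^ 4 := by
      linear_combination ρ ^ 4 * h1
    rw [h4, h2]
    have h5 : 1 + 2 * ρ ^ 2 * (2 * Real.cos φ ^ 2 - 1) + ρ ^ 4 - Real.cos φ ^ 2 =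
      (1 - ρ ^ 2) ^ 2 * (1 - Real.cos φ ^ 2) + Real.cos φ ^ 2 * ρ ^ 2 * (2 + ρ ^ 2) := by ring
    have h6 : 0 ≤ (1 - ρ ^ 2) ^ 2 * (1 - Real.cos φ ^ 2) :=
      mul_nonneg (sq_nonneg _) (by linarith)
    have h7 : 0 ≤ Real.cos φ ^ 2 * ρ ^ 2 * (2 + ρ ^ 2) := by positivity
    linarith
  refine ⟨?_, hlow⟩
  by_cases h : Real.sin (2 * φ) = 0
  · have hφ0 : φ = 0 := by
      have := (Real.sin_eq_zero_iff_of_lt_of_lt (by linarith) (by linarith)).1 h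
      linarith
    left
    rw [hre, hφ0, mul_zero, Real.cos_zero]
    positivity
  · by_cases hρ : ρ = 0
    · left; rw [hre, hρ]; norm_num
    · right
      rw [him]
      exact mul_ne_zero (pow_ne_zero 2 hρ) h

/-! ### The rotated integral -/

/-- The integral of the kernel along a ray: with the Gaussian `exp (-2 e^{iβ} r²)` it continues
`e^x K_ν(x)` from the line `arg x = β` to the strip `|arg x - β| < π`. -/
def rotatedIntegral (ν β : ℝ) (w : ℂ) : ℂ :=
  Complex.exp ((β * Complex.I - w) / 2) *
    ∫ r : ℝ, kernelG ν (r * Complex.exp ((β * Complex.I - w) / 2)) *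
      Complex.exp (-(2 * Complex.exp (β * Complex.I)) * r ^ 2)

lemma two_mul_exp_re_pos {β : ℝ} (hβ : |β| < Real.pi / 2) :
    0 < (2 * Complex.exp (β * Complex.I)).re := by
  rw [show (2 : ℂ) * Complex.exp (β * Complex.I) = ((2 : ℝ) : ℂ) * Complex.exp (β * Complex.I) by
    norm_num, Complex.re_ofReal_mul, Complex.exp_ofReal_mul_I_re]
  exact mul_pos two_pos (Real.cos_pos_of_mem_Ioo (abs_lt.1 hβ))

/-- For `w` in the strip `|Im w - β| ≤ ψ < π`, the ray of integration stays away from the branch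
points `± i` of the kernel. -/
lemma sector_of_strip {β ψ : ℝ} (hψ : ψ < Real.pi) {w : ℂ} (hw : |w.im - β| ≤ ψ) (r : ℝ) :
    1 + (r * Complex.exp ((β * Complex.I - w) / 2)) ^ 2 ∈ Complex.slitPlane ∧
      Real.sqrt (Real.cos (ψ / 2)) ^ 2 ≤
        ‖1 + (r * Complex.exp ((β * Complex.I - w) / 2)) ^ 2‖ := by
  have h0 : 0 ≤ ψ := (abs_nonneg _).trans hw
  have hφ : |(β - w.im) / 2| ≤ ψ / 2 := by
    rw [abs_div, abs_two, abs_sub_comm]; linarith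
  have e : r * Complex.exp ((β * Complex.I - w) / 2) =
      ((r * Real.exp (-w.re / 2) : ℝ) : ℂ) *
        Complex.exp (((β - w.im) / 2 : ℝ) * Complex.I) := by
    push_cast
    rw [mul_assoc, ← Complex.exp_add]
    congr 2
    nth_rewrite 1 [← Complex.re_add_im w]
    ring
  obtain ⟨h1, h2⟩ := one_add_sq_mem_of_sector (hφ.trans_lt (by linarith)) e
  refine ⟨h1, le_trans ?_ h2⟩
  have hc : 0 ≤ Real.cos (ψ / 2) :=
    (Real.cos_pos_of_mem_Ioo ⟨by linarith, by linarith⟩).le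
  rw [Real.sq_sqrt hc, ← Real.cos_abs ((β - w.im) / 2)]
  exact Real.cos_le_cos_of_nonneg_of_le_pi (abs_nonneg _) (by linarith) hφ

lemma sqrt_cos_pos {ψ : ℝ} (h0 : 0 ≤ ψ) (hψ : ψ < Real.pi) :
    0 < Real.sqrt (Real.cos (ψ / 2)) :=
  Real.sqrt_pos.2 (Real.cos_pos_of_mem_Ioo ⟨by linarith, by linarith⟩)

lemma one_add_pow_four_le {M : ℝ} (hM : 1 ≤ M) (r : ℝ) :
    (1 + 2 * (M * |r|)) ^ 4 ≤ 128 * M ^ 4 * (1 + r ^ 4) := by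
  have h1 : 1 + 2 * (M * |r|) ≤ 2 * M * (1 + |r|) := by nlinarith [abs_nonneg r]
  have h2 : (1 + |r|) ^ 4 ≤ 8 * (1 + r ^ 4) := by
    have e : r ^ 4 = |r| ^ 4 := by rw [pow_abs, abs_of_nonneg (by positivity)]
    rw [e]
    nlinarith [sq_nonneg (|r| - 1), sq_nonneg (|r| ^ 2 - 1), abs_nonneg r,
      mul_nonneg (abs_nonneg r) (sq_nonneg (|r| - 1)), sq_nonneg (|r| ^ 2 - |r|)]
  calc (1 + 2 * (M * |r|)) ^ 4 ≤ (2 * M * (1 + |r|)) ^ 4 :=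
        pow_le_pow_left₀ (by positivity) h1 4
    _ = 16 * M ^ 4 * (1 + |r|) ^ 4 := by ring
    _ ≤ 16 * M ^ 4 * (8 * (1 + r ^ 4)) := by gcongr
    _ = _ := by ring

lemma norm_kernelG_mul_le {ν : ℝ} (h0 : 0 ≤ ν) (h1 : ν ≤ 1) {κ : ℝ} (hκ : 0 < κ) {σ : ℂ} {M r : ℝ}
    (hM : 1 ≤ M) (hσ : ‖σ‖ ≤ M) (h : κ ^ 2 ≤ ‖1 + (r * σ) ^ 2‖) :
    ‖kernelG ν (r * σ)‖ ≤ 128 * M ^ 4 / κ * (1 + r ^ 4) := by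
  have hs : ‖r * σ‖ ≤ M * |r| := by
    rw [norm_mul, Complex.norm_real, Real.norm_eq_abs, mul_comm]; gcongr
  refine (norm_kernelG_le h0 h1 hκ h).trans ?_
  rw [div_mul_eq_mul_div]
  gcongr
  refine le_trans ?_ (one_add_pow_four_le hM r)
  have hP : 1 ≤ 1 + 2 * (M * |r|) := by have := abs_nonneg r; nlinarith
  calc (1 + 2 * ‖r * σ‖) ^ 2 ≤ (1 + 2 * (M * |r|)) ^ 2 := by gcongr
    _ ≤ (1 + 2 * (M * |r|)) ^ 4 := pow_le_pow_right₀ hP (by norm_num)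

lemma norm_kernelG'_mul_le {ν : ℝ} (h0 : 0 ≤ ν) (h1 : ν ≤ 1) {κ : ℝ} (hκ : 0 < κ) {σ : ℂ}
    {M r : ℝ} (hM : 1 ≤ M) (hσ : ‖σ‖ ≤ M) (h : κ ^ 2 ≤ ‖1 + (r * σ) ^ 2‖) :
    ‖kernelG' ν (r * σ) * (r * (σ * (-1 / 2)))‖ ≤
      (2 / κ ^ 2 + 1 / κ ^ 3) * (128 * M ^ 4) * (1 + r ^ 4) := by
  have hs : ‖r * σ‖ ≤ M * |r| := by
    rw [norm_mul, Complex.norm_real, Real.norm_eq_abs, mul_comm]; gcongr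
  have hr := abs_nonneg r
  set P := 1 + 2 * (M * |r|)
  have hP : 1 ≤ P := by simp only [P]; nlinarith
  have hs' : ‖r * σ‖ ≤ P := hs.trans (by simp only [P]; nlinarith)
  have h2 : ‖(r : ℂ) * (σ * (-1 / 2))‖ ≤ P := by
    rw [← mul_assoc, norm_mul]
    have : ‖(-1 / 2 : ℂ)‖ = 1 / 2 := by norm_num
    rw [this]
    nlinarith [norm_nonneg (r * σ)]
  have h3 : ‖kernelG' ν (r * σ)‖ ≤ (2 / κ ^ 2 + 1 / κ ^ 3) * P ^ 3 := by
    refine (norm_kernelG'_le h0 h1 hκ h).trans ?_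
    have hq : (1 + 2 * ‖r * σ‖) ^ 2 ≤ P ^ 2 := by
      simp only [P]; gcongr
    have hp : P ^ 2 ≤ P ^ 3 := pow_le_pow_right₀ hP (by norm_num)
    rw [add_mul, div_mul_eq_mul_div, div_mul_eq_mul_div, one_mul]
    refine add_le_add ?_ ?_
    · gcongr; linarith
    · gcongr
      calc ‖r * σ‖ * (1 + 2 * ‖r * σ‖) ^ 2 ≤ P * P ^ 2 := by gcongr
        _ = P ^ 3 := by ring
  rw [norm_mul]
  calc ‖kernelG' ν (r * σ)‖ * ‖(r : ℂ) * (σ * (-1 / 2))‖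
      ≤ (2 / κ ^ 2 + 1 / κ ^ 3) * P ^ 3 * P := by gcongr
    _ = (2 / κ ^ 2 + 1 / κ ^ 3) * P ^ 4 := by ring
    _ ≤ (2 / κ ^ 2 + 1 / κ ^ 3) * (128 * M ^ 4 * (1 + r ^ 4)) := by
        gcongr; exact one_add_pow_four_le hM r
    _ = _ := by ring

lemma continuous_kernelG_ray (ν : ℝ) {β ψ : ℝ} (hψ : ψ < Real.pi) {w : ℂ}
    (hw : |w.im - β| ≤ ψ) :
    Continuous fun r : ℝ => kernelG ν (r * Complex.exp ((β * Complex.I - w) / 2)) := by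
  refine continuous_iff_continuousAt.2 fun r => ?_
  exact ContinuousAt.comp (f := fun r : ℝ => r * Complex.exp ((β * Complex.I - w) / 2))
    (hasDerivAt_kernelG ν (sector_of_strip hψ hw r).1).continuousAt
    (Continuous.continuousAt (by fun_prop))

lemma integrable_rotated {ν : ℝ} (h0 : 0 ≤ ν) (h1 : ν ≤ 1) {β : ℝ} (hβ : |β| < Real.pi / 2)
    {ψ : ℝ} (hψ : ψ < Real.pi) {w : ℂ} (hw : |w.im - β| ≤ ψ) :
    MeasureTheory.Integrable fun r : ℝ =>
      kernelG ν (r * Complex.exp ((β * Complex.I - w) / 2)) *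
        Complex.exp (-(2 * Complex.exp (β * Complex.I)) * r ^ 2) := by
  refine integrable_mul_gaussian (two_mul_exp_re_pos hβ)
    (continuous_kernelG_ray ν hψ hw).aestronglyMeasurable (fun r => ?_)
    (C := 128 * (‖Complex.exp ((β * Complex.I - w) / 2)‖ + 1) ^ 4 /
      Real.sqrt (Real.cos (ψ / 2)))
  exact norm_kernelG_mul_le h0 h1 (sqrt_cos_pos ((abs_nonneg _).trans hw) hψ)
    (by linarith [norm_nonneg (Complex.exp ((β * Complex.I - w) / 2))]) (by linarith)
    (sector_of_strip hψ hw r).2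

lemma differentiableAt_rotatedIntegral {ν : ℝ} (h0 : 0 ≤ ν) (h1 : ν ≤ 1) {β : ℝ}
    (hβ : |β| < Real.pi / 2) {w : ℂ} (hw : |w.im - β| < Real.pi) :
    DifferentiableAt ℂ (rotatedIntegral ν β) w := by
  obtain ⟨ψ, hψ1, hψ⟩ := exists_between hw
  set M := ‖Complex.exp ((β * Complex.I - w) / 2)‖ + 1
  have hM : 1 ≤ M := by simp [M]
  have hcσ : Continuous fun w' : ℂ => ‖Complex.exp ((β * Complex.I - w') / 2)‖ := by fun_prop
  have hs : {w' : ℂ | |w'.im - β| < ψ ∧ ‖Complex.exp ((β * Complex.I - w') / 2)‖ < M} ∈ 𝓝 w :=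
    IsOpen.mem_nhds ((isOpen_strip β ψ).inter (isOpen_lt hcσ continuous_const))
      ⟨hψ1, lt_add_one _⟩
  have hκ := sqrt_cos_pos ((abs_nonneg _).trans hψ1.le) hψ
  set κ := Real.sqrt (Real.cos (ψ / 2))
  have hdσ : ∀ w' : ℂ, HasDerivAt (fun w' => Complex.exp ((β * Complex.I - w') / 2))
      (Complex.exp ((β * Complex.I - w') / 2) * (-1 / 2)) w' := fun w' =>
    (((hasDerivAt_id w').const_sub (β * Complex.I)).div_const 2).cexp
  have hF' : MeasureTheory.AEStronglyMeasurable (fun r : ℝ =>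
      kernelG' ν (r * Complex.exp ((β * Complex.I - w) / 2)) *
        (r * (Complex.exp ((β * Complex.I - w) / 2) * (-1 / 2))) *
          Complex.exp (-(2 * Complex.exp (β * Complex.I)) * r ^ 2)) := by
    have hm : Measurable fun r : ℝ =>
        deriv (kernelG ν) (r * Complex.exp ((β * Complex.I - w) / 2)) :=
      (measurable_deriv (kernelG ν)).comp (by fun_prop)
    have e : (fun r : ℝ => kernelG' ν (r * Complex.exp ((β * Complex.I - w) / 2))) =
        fun r : ℝ => deriv (kernelG ν) (r * Complex.exp ((β * Complex.I - w) / 2)) := by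
      ext r
      exact (hasDerivAt_kernelG ν (sector_of_strip hψ hψ1.le r).1).deriv.symm
    refine MeasureTheory.AEStronglyMeasurable.mul (MeasureTheory.AEStronglyMeasurable.mul ?_ ?_) ?_
    · rw [e]; exact hm.aestronglyMeasurable
    · exact Continuous.aestronglyMeasurable (by fun_prop)
    · exact Continuous.aestronglyMeasurable (by fun_prop)
  have h := (hasDerivAt_integral_of_dominated_loc_of_deriv_le (μ := MeasureTheory.volume)
    (F := fun w' (r : ℝ) => kernelG ν (r * Complex.exp ((β * Complex.I - w') / 2)) *
      Complex.exp (-(2 * Complex.exp (β * Complex.I)) * r ^ 2))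
    (F' := fun w' (r : ℝ) => kernelG' ν (r * Complex.exp ((β * Complex.I - w') / 2)) *
      (r * (Complex.exp ((β * Complex.I - w') / 2) * (-1 / 2))) *
        Complex.exp (-(2 * Complex.exp (β * Complex.I)) * r ^ 2))
    (bound := fun r => (2 / κ ^ 2 + 1 / κ ^ 3) * (128 * M ^ 4) * ((1 + r ^ 4) *
      Real.exp (-(2 * Complex.exp (β * Complex.I)).re * r ^ 2))) hs
    (by
      filter_upwards [hs] with w' hw'
      exact (integrable_rotated h0 h1 hβ hψ hw'.1.le).aestronglyMeasurable)
    (integrable_rotated h0 h1 hβ hψ hψ1.le) hF'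
    (Eventually.of_forall fun r w' hw' => by
      rw [norm_mul, norm_cexp_neg_mul_sq]
      exact (mul_le_mul_of_nonneg_right (norm_kernelG'_mul_le h0 h1 hκ hM hw'.2.le
        (sector_of_strip hψ hw'.1.le r).2) (Real.exp_pos _).le).trans (mul_assoc _ _ _).le)
    ((integrable_gaussian_poly (two_mul_exp_re_pos hβ)).const_mul _)
    (Eventually.of_forall fun r w' hw' => by
      have h2 := (hasDerivAt_kernelG ν (sector_of_strip hψ hw'.1.le r).1).comp w'
        ((hdσ w').const_mul (r : ℂ))
      exact h2.mul_const _)).2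
  exact ((hdσ w).mul h).differentiableAt

/-! ### The kernel on the real line -/

lemma rootS_sinh (v : ℝ) : rootS (Real.sinh v : ℝ) = (Real.cosh v : ℝ) := by
  have hmem : 1 + ((Real.sinh v : ℝ) : ℂ) ^ 2 ∈ Complex.slitPlane := by
    left
    rw [← Complex.ofReal_pow, ← Complex.ofReal_one, ← Complex.ofReal_add, Complex.ofReal_re]
    positivity
  have h1 := rootS_sq (Real.sinh v : ℝ)
  have h2 : rootS (Real.sinh v : ℝ) ^ 2 = ((Real.cosh v : ℝ) : ℂ) ^ 2 := by
    rw [h1]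
    have := Real.cosh_sq v
    rw [← Complex.ofReal_pow, ← Complex.ofReal_pow, this]
    push_cast; ring
  rcases sq_eq_sq_iff_eq_or_eq_neg.1 h2 with h | h
  · exact h
  · have h3 := rootS_re_pos hmem
    rw [h, Complex.neg_re, Complex.ofReal_re] at h3
    linarith [Real.cosh_pos v]

lemma kernelG_sinh (ν v : ℝ) : kernelG ν (Real.sinh v : ℝ) =
    Complex.cosh (2 * ν * v) / (Real.cosh v : ℝ) := by
  rw [kernelG, arsinhC, rootS_sinh, ← Complex.ofReal_add, Real.sinh_add_cosh, ← Complex.ofReal_log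
    (Real.exp_pos v).le, Real.log_exp]

lemma besselQ_eq_integral_cosh (ν : ℝ) {w : ℂ} (hw : 0 < (Complex.exp w).re) :
    besselQ ν w = ∫ v : ℝ, Complex.cosh (2 * ν * v) *
      Complex.exp (-Complex.exp w * (Real.cosh (2 * v) : ℝ)) := by
  have h1 : besselQ ν w = 1 / 2 * ∫ u : ℝ, Complex.cosh (ν * u) *
      Complex.exp (-Complex.exp w * (Real.cosh u : ℝ)) := by
    have h2 : besselQ ν w = 1 / 2 * (besselQ ν w + besselQ (-ν) w) := by
      rw [besselQ_neg]; ring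
    have e : ∀ u : ℝ, Complex.cosh (ν * u) *
      Complex.exp (-Complex.exp w * (Real.cosh u : ℝ)) =
        1 / 2 * (Complex.exp (ν * u - Complex.exp w * (Real.cosh u : ℝ)) +
          Complex.exp ((-ν : ℝ) * u - Complex.exp w * (Real.cosh u : ℝ))) := by
      intro u
      rw [sub_eq_add_neg, sub_eq_add_neg, Complex.exp_add, Complex.exp_add, Complex.cosh]
      push_cast
      rw [neg_mul, neg_mul]
      ring
    rw [h2]
    simp_rw [e]
    rw [MeasureTheory.integral_const_mul, MeasureTheory.integral_add
      (integrable_cexp_sub_cosh _ hw) (integrable_cexp_sub_cosh _ hw)]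
    simp only [besselQ]
    ring
  have h3 := MeasureTheory.Measure.integral_comp_mul_left (fun u : ℝ => Complex.cosh (ν * u) *
      Complex.exp (-Complex.exp w * (Real.cosh u : ℝ))) 2
  rw [h1]
  have e : ∀ v : ℝ, Complex.cosh (2 * ν * v) *
      Complex.exp (-Complex.exp w * (Real.cosh (2 * v) : ℝ)) =
      Complex.cosh (ν * ((2 * v : ℝ) : ℂ)) *
        Complex.exp (-Complex.exp w * (Real.cosh (2 * v) : ℝ)) := by
    intro v; push_cast; ring_nf
  simp_rw [e]
  rw [h3]
  simp

/-- On the line `Im w = β` the rotated integral is the integral representation of `K_ν`, by the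
substitution `r = sinh v / τ`, `τ = e^{-t/2}`. -/
lemma rotatedIntegral_line (ν : ℝ) {β : ℝ} (hβ : |β| < Real.pi / 2) (t : ℝ) :
    rotatedIntegral ν β (β * Complex.I + t) =
      Complex.exp (Complex.exp (β * Complex.I + t)) * besselQ ν (β * Complex.I + t) := by
  set x := Complex.exp (β * Complex.I + t) with hx
  have hxre : 0 < x.re := re_exp_pos_of_abs_im_lt (by simpa using hβ)
  set τ : ℝ := Real.exp (-t / 2)
  have hτ : 0 < τ := Real.exp_pos _
  have hσ : Complex.exp ((β * Complex.I - (β * Complex.I + t)) / 2) = (τ : ℂ) := by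
    simp only [τ]; push_cast; congr 1; ring
  have hτx : Complex.exp (β * Complex.I) = x * (τ : ℂ) ^ 2 := by
    rw [hx, ← hσ, ← Complex.exp_nat_mul, ← Complex.exp_add]; congr 1; push_cast; ring
  have himg : (fun v : ℝ => Real.sinh v / τ) '' Set.univ = Set.univ := by
    rw [Set.image_univ]
    refine Set.range_eq_univ.2 fun y => ?_
    obtain ⟨v, hv⟩ := Real.sinh_surjective (y * τ)
    exact ⟨v, by simp only [hv]; field_simp⟩
  have hinj : Set.InjOn (fun v : ℝ => Real.sinh v / τ) Set.univ := by
    intro u _ v _ huv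
    have : Real.sinh u / τ = Real.sinh v / τ := huv
    rw [div_left_inj' hτ.ne'] at this
    exact Real.sinh_injective this
  have hcv := MeasureTheory.integral_image_eq_integral_abs_deriv_smul MeasurableSet.univ
    (fun v _ => ((Real.hasDerivAt_sinh v).div_const τ).hasDerivWithinAt) hinj
    (fun r : ℝ => kernelG ν (r * (τ : ℂ)) *
      Complex.exp (-(2 * Complex.exp (β * Complex.I)) * r ^ 2))
  rw [himg, MeasureTheory.setIntegral_univ, MeasureTheory.setIntegral_univ] at hcv
  rw [rotatedIntegral, hσ, hcv, besselQ_eq_integral_cosh ν hxre, ← MeasureTheory.integral_const_mul,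
    ← MeasureTheory.integral_const_mul]
  refine MeasureTheory.integral_congr_ae (Eventually.of_forall fun v => ?_)
  have hcosh := Real.cosh_pos v
  have hτc : (τ : ℂ) ≠ 0 := by exact_mod_cast hτ.ne'
  have hcc : ((Real.cosh v : ℝ) : ℂ) ≠ 0 := by exact_mod_cast hcosh.ne'
  have e1 : ((Real.sinh v / τ : ℝ) : ℂ) * (τ : ℂ) = (Real.sinh v : ℝ) := by
    push_cast; field_simp
  have e2 : -(2 * Complex.exp (β * Complex.I)) * ((Real.sinh v / τ : ℝ) : ℂ) ^ 2 =
      x + -x * (Real.cosh (2 * v) : ℝ) := by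
    rw [hτx, Real.cosh_two_mul, Real.cosh_sq]
    push_cast; field_simp; ring
  simp only
  rw [e1, e2, kernelG_sinh, Complex.exp_add, abs_of_pos (by positivity), Complex.real_smul]
  push_cast
  push_cast at hcc
  rw [← hx]
  field_simp

/-- The Macdonald function as a rotated integral, by the identity theorem on the strip. -/
lemma exp_mul_besselK_eq_rotatedIntegral {b : ℝ} (h0 : 0 < b) (h1 : b < 1) {β : ℝ}
    (hβ : |β| < Real.pi / 2) {w : ℂ} (hw : |w.im - β| < Real.pi) :
    Complex.exp (Complex.exp w) * besselK b w = rotatedIntegral b β w := by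
  have hpi := Real.pi_pos
  refine eqOn_of_eq_on_horizontal_line (isOpen_strip β Real.pi) (isPreconnected_strip _ _)
    (f := fun w => Complex.exp (Complex.exp w) * besselK b w) (g := rotatedIntegral b β)
    (w₀ := β * Complex.I) ?_ ?_ (by simpa using hpi) (fun t => ?_) hw
  · exact ((Complex.differentiable_exp.comp Complex.differentiable_exp).mul
      (differentiable_besselK _)).differentiableOn
  · exact fun z hz =>
      (differentiableAt_rotatedIntegral h0.le h1.le hβ hz).differentiableWithinAt
  · rw [rotatedIntegral_line b hβ, besselQ_eq_besselK h0 h1 (by simpa using hβ)]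

/-! ### Asymptotics of the Macdonald function -/

lemma rotatedIntegral_asymptotic {ν : ℝ} (h0 : 0 ≤ ν) (h1 : ν ≤ 1) {β : ℝ}
    (hβ : |β| < Real.pi / 2) {ψ : ℝ} (hψ0 : 0 ≤ ψ) (hψ : ψ < Real.pi) :
    ∃ C : ℝ, ∀ w : ℂ, |w.im - β| ≤ ψ →
      ‖rotatedIntegral ν β w * Complex.exp (w / 2) - (Real.sqrt (Real.pi / 2) : ℝ) *
        (1 + (4 * ν ^ 2 - 1) / 8 * Complex.exp (-w))‖ ≤ C * ‖Complex.exp (-w)‖ ^ 2 := by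
  have hκ := sqrt_cos_pos hψ0 hψ
  set κ := Real.sqrt (Real.cos (ψ / 2))
  have hB := two_mul_exp_re_pos hβ
  set B := 2 * Complex.exp (β * Complex.I) with hBdef
  set J : ℝ := ∫ r : ℝ, (1 + r ^ 4) * Real.exp (-B.re * r ^ 2)
  refine ⟨(600 + 576 / κ) * J, fun w hw => ?_⟩
  set σ := Complex.exp ((β * Complex.I - w) / 2) with hσ
  have i0 : MeasureTheory.Integrable fun r : ℝ => Complex.exp (-B * r ^ 2) := by
    have := integrable_mul_gaussian hB (f := fun _ => 1) (C := 1)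
      (Continuous.aestronglyMeasurable (by fun_prop)) (fun r => by
        rw [norm_one]; nlinarith [sq_nonneg (r ^ 2)])
    simpa using this
  have i2 := integrable_mul_gaussian hB (f := fun r => (r : ℂ) ^ 2) (C := 1)
      (Continuous.aestronglyMeasurable (by fun_prop)) (fun r => by
        rw [norm_pow, Complex.norm_real, Real.norm_eq_abs, sq_abs]
        nlinarith [sq_nonneg (r ^ 2 - 1), sq_nonneg r])
  have ig : MeasureTheory.Integrable fun r : ℝ => kernelG ν (r * σ) * Complex.exp (-B * r ^ 2) :=
    integrable_rotated h0 h1 hβ hψ hw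
  have hM2 := integral_sq_mul_gaussian hB
  have hM0 := exp_half_mul_integral_gaussian hβ
  rw [← hBdef] at hM0
  set M0 := ∫ r : ℝ, Complex.exp (-B * r ^ 2)
  set M2 := ∫ r : ℝ, (r : ℂ) ^ 2 * Complex.exp (-B * r ^ 2)
  set c : ℂ := 2 * (ν : ℂ) ^ 2 - 1 / 2
  have i02 : MeasureTheory.Integrable fun r : ℝ => Complex.exp (-B * r ^ 2) +
      c * σ ^ 2 * ((r : ℂ) ^ 2 * Complex.exp (-B * r ^ 2)) := i0.add (i2.const_mul _)
  have hdiff : (∫ r : ℝ, kernelG ν (r * σ) * Complex.exp (-B * r ^ 2)) - (M0 + c * σ ^ 2 * M2) =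
      ∫ r : ℝ, (kernelG ν (r * σ) - (1 + c * (r * σ) ^ 2)) * Complex.exp (-B * r ^ 2) := by
    rw [← MeasureTheory.integral_const_mul, ← MeasureTheory.integral_add i0 (i2.const_mul _),
      ← MeasureTheory.integral_sub ig i02]
    refine MeasureTheory.integral_congr_ae (Eventually.of_forall fun r => ?_)
    simp only
    ring
  have hbound : ‖∫ r : ℝ, (kernelG ν (r * σ) - (1 + c * (r * σ) ^ 2)) *
      Complex.exp (-B * r ^ 2)‖ ≤ (600 + 576 / κ) * ‖σ‖ ^ 4 * J := by
    rw [← MeasureTheory.integral_const_mul]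
    refine MeasureTheory.norm_integral_le_of_norm_le
      ((integrable_gaussian_poly hB).const_mul _) (Eventually.of_forall fun r => ?_)
    rw [norm_mul, norm_cexp_neg_mul_sq, ← mul_assoc]
    gcongr
    refine (norm_kernelG_sub_le h0 h1 hκ (sector_of_strip hψ hw r).2).trans ?_
    rw [mul_assoc]
    gcongr
    rw [norm_mul, mul_pow, Complex.norm_real, Real.norm_eq_abs, pow_abs,
      abs_of_nonneg (by positivity), mul_comm]
    gcongr
    linarith
  have hσ4 : ‖σ‖ ^ 4 = ‖Complex.exp (-w)‖ ^ 2 := by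
    rw [Complex.norm_exp, Complex.norm_exp, ← Real.exp_nat_mul, ← Real.exp_nat_mul]
    congr 1
    rw [show (β * Complex.I - w) / 2 = ((1 / 2 : ℝ) : ℂ) * (β * Complex.I - w) by push_cast; ring,
      Complex.re_ofReal_mul]
    simp
    ring
  have hσ2 : σ ^ 2 = Complex.exp (β * Complex.I) * Complex.exp (-w) := by
    rw [hσ, ← Complex.exp_nat_mul, ← Complex.exp_add]; congr 1; push_cast; ring
  have hσw : σ * Complex.exp (w / 2) = Complex.exp (β * Complex.I / 2) := by
    rw [hσ, ← Complex.exp_add]; congr 1; ring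
  have key : rotatedIntegral ν β w * Complex.exp (w / 2) - (Real.sqrt (Real.pi / 2) : ℝ) *
        (1 + (4 * ν ^ 2 - 1) / 8 * Complex.exp (-w)) =
      Complex.exp (β * Complex.I / 2) *
        ((∫ r : ℝ, kernelG ν (r * σ) * Complex.exp (-B * r ^ 2)) - (M0 + c * σ ^ 2 * M2)) := by
    rw [rotatedIntegral, ← hσ, ← hM0, ← hσw]
    rw [← hBdef]
    have hM2' : Complex.exp (β * Complex.I) * M2 = M0 / 4 := by
      rw [hBdef] at hM2; linear_combination hM2 / 4
    rw [hσ2]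
    linear_combination (c * σ * Complex.exp (w / 2) * Complex.exp (-w)) * hM2'
  have hnorm : ‖Complex.exp (β * Complex.I / 2)‖ = 1 := by
    rw [show (β * Complex.I / 2 : ℂ) = ((β / 2 : ℝ) : ℂ) * Complex.I by push_cast; ring,
      Complex.norm_exp_ofReal_mul_I]
  rw [key, norm_mul, hnorm, one_mul, hdiff]
  refine hbound.trans (le_of_eq ?_)
  rw [hσ4]; ring

/-- The expansion of `K_b` at infinity, uniform in the closed sector `|arg x| ≤ 11π/8`. -/
lemma besselK_asymptotic {b : ℝ} (h0 : 0 < b) (h1 : b < 1) :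
    ∃ C : ℝ, 0 ≤ C ∧ ∀ w : ℂ, |w.im| ≤ 11 * Real.pi / 8 →
      ‖besselK b w * Complex.exp (w / 2) * Complex.exp (Complex.exp w) -
        (Real.sqrt (Real.pi / 2) : ℝ) * (1 + (4 * b ^ 2 - 1) / 8 * Complex.exp (-w))‖ ≤
          C * ‖Complex.exp (-w)‖ ^ 2 := by
  have hpi := Real.pi_pos
  -- The rotations `β = ± 7π/16` suffice: each covers `|arg x - β| ≤ 15π/16`.
  have hb1 : |7 * Real.pi / 16| < Real.pi / 2 := by rw [abs_of_pos (by positivity)]; linarith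
  have hb2 : |-(7 * Real.pi / 16)| < Real.pi / 2 := by rwa [abs_neg]
  obtain ⟨C1, hC1⟩ := rotatedIntegral_asymptotic h0.le h1.le hb1 (ψ := 15 * Real.pi / 16)
    (by positivity) (by linarith)
  obtain ⟨C2, hC2⟩ := rotatedIntegral_asymptotic h0.le h1.le hb2 (ψ := 15 * Real.pi / 16)
    (by positivity) (by linarith)
  refine ⟨max 0 (max C1 C2), le_max_left _ _, fun w hw => ?_⟩
  have e : besselK b w * Complex.exp (w / 2) * Complex.exp (Complex.exp w) =
    Complex.exp (Complex.exp w) * besselK b w * Complex.exp (w / 2) := by ring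
  obtain ⟨hw1, hw2⟩ := abs_le.1 hw
  rcases le_total 0 w.im with hs | hs
  · have hm : |w.im - 7 * Real.pi / 16| ≤ 15 * Real.pi / 16 := by
      rw [abs_le]; constructor <;> linarith
    rw [e, exp_mul_besselK_eq_rotatedIntegral h0 h1 hb1 (hm.trans_lt (by linarith))]
    refine (hC1 w hm).trans ?_
    gcongr
    exact (le_max_left _ _).trans (le_max_right _ _)
  · have hm : |w.im - -(7 * Real.pi / 16)| ≤ 15 * Real.pi / 16 := by
      rw [abs_le]; constructor <;> linarith
    rw [e, exp_mul_besselK_eq_rotatedIntegral h0 h1 hb2 (hm.trans_lt (by linarith))]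
    refine (hC2 w hm).trans ?_
    gcongr
    exact (le_max_right _ _).trans (le_max_right _ _)

/-! ### The branches of the logarithm and of the argument -/

/-- The logarithm of `√ξ / 2`. -/
def logHalfSqrt (θ : ℝ) (ξ : ℂ) : ℂ := logBr θ ξ / 2 - (Real.log 2 : ℝ)

/-- The rotated variable in which the cut `Γ₀` becomes the negative real axis. -/
def unrotate (θ : ℝ) (ξ : ℂ) : ℂ :=
  ξ * Complex.exp (-(((Real.pi / 2 - 2 * θ : ℝ) : ℂ) * Complex.I))

lemma unrotate_mul_exp (θ : ℝ) (ξ : ℂ) :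
    unrotate θ ξ * Complex.exp (((Real.pi / 2 - 2 * θ : ℝ) : ℂ) * Complex.I) = ξ := by
  rw [unrotate, mul_assoc, ← Complex.exp_add, neg_add_cancel, Complex.exp_zero, mul_one]

lemma unrotate_ne_zero {θ : ℝ} {ξ : ℂ} (h : ξ ≠ 0) : unrotate θ ξ ≠ 0 :=
  mul_ne_zero h (Complex.exp_ne_zero _)

lemma continuous_unrotate (θ : ℝ) : Continuous (unrotate θ) := by
  unfold unrotate; fun_prop

lemma argBr_eq (θ : ℝ) (ξ : ℂ) :
    argBr θ ξ = Complex.arg (unrotate θ ξ) + (Real.pi / 2 - 2 * θ) := by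
  rw [argBr, logBr, Complex.add_im, Complex.im_ofReal_mul, Complex.I_im, mul_one, Complex.log_im]
  rfl

lemma exp_logBr {θ : ℝ} {ξ : ℂ} (h : ξ ≠ 0) : Complex.exp (logBr θ ξ) = ξ := by
  have := Complex.exp_log (unrotate_ne_zero (θ := θ) h)
  rw [logBr, Complex.exp_add]
  change Complex.exp (Complex.log (unrotate θ ξ)) * _ = _
  rw [this, unrotate_mul_exp]

lemma exp_two_mul_logHalfSqrt {θ : ℝ} {ξ : ℂ} (h : ξ ≠ 0) :
    Complex.exp (2 * logHalfSqrt θ ξ) / 4 = ξ / 16 := by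
  have e : 2 * logHalfSqrt θ ξ = logBr θ ξ - (Real.log 2 : ℝ) - (Real.log 2 : ℝ) := by
    rw [logHalfSqrt]; ring
  rw [e, Complex.exp_sub, Complex.exp_sub, exp_log_two, exp_logBr h]; ring

lemma ray_dir_zero_iff (θ : ℝ) (ξ : ℂ) :
    ξ ∉ ray (dir θ 0) ↔ unrotate θ ξ ∈ Complex.slitPlane := by
  have e : Complex.exp ((dir θ 0 : ℝ) * Complex.I) =
      -Complex.exp (((Real.pi / 2 - 2 * θ : ℝ) : ℂ) * Complex.I) := by
    have : ((dir θ 0 : ℝ) : ℂ) * Complex.I =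
        ((Real.pi / 2 - 2 * θ : ℝ) : ℂ) * Complex.I - Real.pi * Complex.I := by
      simp only [dir, Matrix.cons_val_zero]; push_cast; ring
    rw [this, Complex.exp_sub, Complex.exp_pi_mul_I]; ring
  rw [not_iff_comm, Complex.mem_slitPlane_iff_not_le_zero, not_not]
  constructor
  · intro h
    obtain ⟨h1, h2⟩ := Complex.le_def.1 h
    refine ⟨-(unrotate θ ξ).re, by simpa using h1, ?_⟩
    have h3 : unrotate θ ξ = ((unrotate θ ξ).re : ℂ) := by
      apply Complex.ext <;> simp [h2]
    rw [e]
    conv_lhs => rw [← unrotate_mul_exp θ ξ, h3]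
    push_cast; ring
  · rintro ⟨r, hr, h⟩
    have h3 : unrotate θ ξ = ((-r : ℝ) : ℂ) := by
      have h4 := Complex.exp_ne_zero (((Real.pi / 2 - 2 * θ : ℝ) : ℂ) * Complex.I)
      apply mul_right_cancel₀ h4
      rw [unrotate_mul_exp, h, e]; push_cast; ring
    rw [h3, ← Complex.ofReal_zero]
    exact Complex.real_le_real.2 (by linarith)

lemma argBr_gt (θ : ℝ) (ξ : ℂ) : -Real.pi / 2 - 2 * θ < argBr θ ξ := by
  rw [argBr_eq]
  have := Complex.neg_pi_lt_arg (unrotate θ ξ)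
  linarith

lemma argBr_lt {θ : ℝ} {ξ : ℂ} (h : ξ ∉ ray (dir θ 0)) : argBr θ ξ < 3 * Real.pi / 2 - 2 * θ := by
  rw [argBr_eq]
  have := lt_of_le_of_ne (Complex.arg_le_pi (unrotate θ ξ))
    (Complex.slitPlane_arg_ne_pi ((ray_dir_zero_iff θ ξ).1 h))
  linarith

lemma notMem_ray_zero_of_argBr_lt {θ : ℝ} {ξ : ℂ} (h0 : ξ ≠ 0)
    (h : argBr θ ξ < 3 * Real.pi / 2 - 2 * θ) : ξ ∉ ray (dir θ 0) := by
  rw [ray_dir_zero_iff, Complex.mem_slitPlane_iff_arg]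
  refine ⟨fun h1 => ?_, unrotate_ne_zero h0⟩
  rw [argBr_eq, h1] at h
  linarith

lemma mem_ray_argBr {θ : ℝ} {ξ : ℂ} : ξ ∈ ray (argBr θ ξ) := by
  refine ⟨‖unrotate θ ξ‖, norm_nonneg _, ?_⟩
  conv_lhs => rw [← unrotate_mul_exp θ ξ, ← Complex.norm_mul_exp_arg_mul_I (unrotate θ ξ)]
  rw [mul_assoc, ← Complex.exp_add, argBr_eq]
  congr 2; push_cast; ring

lemma argBr_of_mem_ray {θ φ : ℝ} {ξ : ℂ} (h : ξ ∈ ray φ) (h0 : ξ ≠ 0)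
    (h1 : -Real.pi / 2 - 2 * θ < φ) (h2 : φ < 3 * Real.pi / 2 - 2 * θ) : argBr θ ξ = φ := by
  obtain ⟨r, hr, rfl⟩ := h
  have hr' : 0 < r := lt_of_le_of_ne hr fun h => h0 (by simp [← h])
  have e : unrotate θ (r * Complex.exp (φ * Complex.I)) =
      r * Complex.exp ((φ - (Real.pi / 2 - 2 * θ) : ℝ) * Complex.I) := by
    rw [unrotate, mul_assoc, ← Complex.exp_add]; congr 2; push_cast; ring
  rw [argBr_eq, e, Complex.arg_real_mul _ hr', Complex.arg_exp_mul_I,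
    (toIocMod_eq_self _).2 ⟨by linarith, by linarith⟩]
  ring

lemma notMem_ray_zero_of_notMem_contour {θ : ℝ} {ξ : ℂ} (h : ξ ∉ contour θ) :
    ξ ∉ ray (dir θ 0) := fun h' => h (Set.mem_iUnion.2 ⟨0, h'⟩)

lemma zero_mem_ray (φ : ℝ) : (0 : ℂ) ∈ ray φ := ⟨0, le_rfl, by simp⟩

lemma ne_zero_of_notMem_ray {φ : ℝ} {ξ : ℂ} (h : ξ ∉ ray φ) : ξ ≠ 0 := by
  rintro rfl
  exact h (zero_mem_ray φ)

/-- Off the contour the argument avoids the directions of `Γ₁` and `Γ₂`. -/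
lemma argBr_ne_of_notMem_contour {θ : ℝ} {ξ : ℂ} (h : ξ ∉ contour θ) :
    argBr θ ξ ≠ Real.pi / 4 - 2 * θ ∧ argBr θ ξ ≠ 3 * Real.pi / 4 - 2 * θ := by
  have h1 : ξ ∈ ray (argBr θ ξ) := mem_ray_argBr
  constructor
  · intro h2
    rw [h2] at h1
    exact h (Set.mem_iUnion.2 ⟨1, by simpa [dir] using h1⟩)
  · intro h2
    rw [h2] at h1
    exact h (Set.mem_iUnion.2 ⟨2, by simpa [dir] using h1⟩)

lemma hasDerivAt_logBr {θ : ℝ} {ξ : ℂ} (h : ξ ∉ ray (dir θ 0)) :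
    HasDerivAt (logBr θ) ξ⁻¹ ξ := by
  have h1 : HasDerivAt (unrotate θ)
      (Complex.exp (-(((Real.pi / 2 - 2 * θ : ℝ) : ℂ) * Complex.I))) ξ := by
    simpa only [one_mul, id] using! (hasDerivAt_id ξ).mul_const
      (Complex.exp (-(((Real.pi / 2 - 2 * θ : ℝ) : ℂ) * Complex.I)))
  refine ((h1.clog ((ray_dir_zero_iff θ ξ).1 h)).add_const _).congr_deriv ?_
  have h2 := Complex.exp_ne_zero (-(((Real.pi / 2 - 2 * θ : ℝ) : ℂ) * Complex.I))
  have h3 := ne_zero_of_notMem_ray h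
  rw [unrotate]
  field_simp

lemma hasDerivAt_logHalfSqrt {θ : ℝ} {ξ : ℂ} (h : ξ ∉ ray (dir θ 0)) :
    HasDerivAt (logHalfSqrt θ) (ξ⁻¹ / 2) ξ :=
  ((hasDerivAt_logBr h).div_const 2).sub_const _

lemma continuousAt_argBr {θ : ℝ} {ξ : ℂ} (h : ξ ∉ ray (dir θ 0)) : ContinuousAt (argBr θ) ξ :=
  Complex.continuous_im.continuousAt.comp (hasDerivAt_logBr h).continuousAt

/-! ### The explicit solution in terms of the Macdonald function -/

lemma matrix_ext_two {M N : Matrix (Fin 2) (Fin 2) ℂ} (h00 : M 0 0 = N 0 0)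
    (h01 : M 0 1 = N 0 1) (h10 : M 1 0 = N 1 0) (h11 : M 1 1 = N 1 1) : M = N := by
  ext i j
  fin_cases i <;> fin_cases j <;> assumption

/-- The matrix of `K_b` and its logarithmic derivative at `x e^{iπ}` and `x`, which is `Ψ` up to
the sectorwise constant right factor. -/
def coreMatrix (b w : ℂ) : Matrix (Fin 2) (Fin 2) ℂ :=
  (Complex.I / (Real.sqrt Real.pi : ℝ)) •
    !![besselK b (w + Real.pi * Complex.I) / 2, -(besselK b w / 2);
      derivK b (w + Real.pi * Complex.I), -derivK b w]

lemma ofReal_sqrt_pi_sq : ((Real.sqrt Real.pi : ℝ) : ℂ) ^ 2 = Real.pi := by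
  rw [← Complex.ofReal_pow, Real.sq_sqrt Real.pi_pos.le]

lemma ofReal_sqrt_pi_ne_zero : ((Real.sqrt Real.pi : ℝ) : ℂ) ≠ 0 := by
  exact_mod_cast (Real.sqrt_pos.2 Real.pi_pos).ne'

/-- Off the cut, `Ψ` is `coreMatrix` times the sectorwise constant right factor. -/
lemma Psi0_eq (a : ℝ) {θ : ℝ} {ξ : ℂ} (h : ξ ∉ ray (dir θ 0)) :
    Psi0 a θ ξ = coreMatrix (a / 2) (logHalfSqrt θ ξ) * rightFactor a θ ξ := by
  set b : ℂ := (a : ℂ) / 2 with hb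
  have hξ : ξ ≠ 0 := ne_zero_of_notMem_ray h
  have harg : ∀ η, logArg θ η = logHalfSqrt θ η + ((Real.pi / 2 : ℝ) : ℂ) * Complex.I := by
    intro η; rw [logArg, logHalfSqrt]; ring
  have hw := hasDerivAt_logHalfSqrt h
  have d2 : deriv (fun η => hankel2 (-b) (logArg θ η)) ξ =
      2 * Complex.I / Real.pi * Complex.exp (-(b * (Real.pi * Complex.I) / 2)) *
        (derivK b (logHalfSqrt θ ξ + Real.pi * Complex.I) * (ξ⁻¹ / 2)) := by
    simp_rw [harg, hankel2_neg_eq]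
    exact (((hasDerivAt_besselK b _).comp ξ (hw.add_const (Real.pi * Complex.I))).const_mul _).deriv
  have d1 : deriv (fun η => hankel1 (-b) (logArg θ η)) ξ =
      -(2 * Complex.I / Real.pi) * Complex.exp (b * (Real.pi * Complex.I) / 2) *
        (derivK b (logHalfSqrt θ ξ) * (ξ⁻¹ / 2)) := by
    simp_rw [harg, hankel1_neg_eq]
    exact (((hasDerivAt_besselK b _).comp ξ hw).const_mul _).deriv
  have hs := ofReal_sqrt_pi_sq
  have hs0 := ofReal_sqrt_pi_ne_zero
  have hpi : (Real.pi : ℂ) ≠ 0 := by exact_mod_cast Real.pi_ne_zero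
  have hE : Complex.exp (b * (Real.pi * Complex.I) / 2) *
      Complex.exp (-(b * (Real.pi * Complex.I) / 2)) = 1 := by
    rw [← Complex.exp_add, add_neg_cancel, Complex.exp_zero]
  have hab : (Real.pi : ℂ) * Complex.I * a / 4 = b * (Real.pi * Complex.I) / 2 := by
    rw [hb]; ring
  rw [Psi0, ← Matrix.smul_mul]
  congr 1
  rw [hankelMatrix, d1, d2, harg, hankel1_neg_eq, hankel2_neg_eq, expSigma, hab, coreMatrix]
  have hc : ((Real.sqrt Real.pi / 2 : ℝ) : ℂ) * (2 * Complex.I / Real.pi) =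
      Complex.I / (Real.sqrt Real.pi : ℝ) := by
    rw [← hs]; push_cast; field_simp
  have hξ' : ξ * ξ⁻¹ = 1 := mul_inv_cancel₀ hξ
  refine matrix_ext_two ?_ ?_ ?_ ?_ <;>
    simp only [Matrix.smul_apply, smul_eq_mul, Matrix.mul_apply, Fin.sum_univ_two,
      Matrix.of_apply, Matrix.cons_val', Matrix.cons_val_zero, Matrix.cons_val_one,
      Matrix.cons_val_fin_one, mul_zero, zero_mul, add_zero, zero_add]
  all_goals
    generalize besselK b (logHalfSqrt θ ξ + Real.pi * Complex.I) = K₁,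
      besselK b (logHalfSqrt θ ξ) = K₀, derivK b (logHalfSqrt θ ξ + Real.pi * Complex.I) = D₁,
      derivK b (logHalfSqrt θ ξ) = D₀, Complex.exp (b * (Real.pi * Complex.I) / 2) = e,
      Complex.exp (-(b * (Real.pi * Complex.I) / 2)) = e',
      Complex.I / ((Real.sqrt Real.pi : ℝ) : ℂ) = L at hE hc ⊢
  · linear_combination (e * e' * K₁ / 2) * hc + (L * K₁ / 2) * hE
  · linear_combination (-(e * e' * K₀ / 2)) * hc - (L * K₀ / 2) * hE
  · linear_combination (e * e' * D₁ * (ξ * ξ⁻¹)) * hc + (L * D₁ * (ξ * ξ⁻¹)) * hE + L * D₁ * hξ'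
  · linear_combination (-(e * e' * D₀ * (ξ * ξ⁻¹))) * hc - (L * D₀ * (ξ * ξ⁻¹)) * hE - L * D₀ * hξ'

lemma differentiable_coreMatrix (b : ℂ) (i j : Fin 2) :
    Differentiable ℂ fun w => coreMatrix b w i j := by
  have h1 := differentiable_besselK b
  have h2 := differentiable_derivK b
  have h3 : Differentiable ℂ fun w : ℂ => w + Real.pi * Complex.I := by fun_prop
  have h4 := h1.comp h3
  have h5 := h2.comp h3
  fin_cases i <;> fin_cases j
  · exact (h4.div_const 2).const_mul _
  · exact (h1.div_const 2).neg.const_mul _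
  · exact h5.const_mul _
  · exact h2.neg.const_mul _

lemma continuous_coreMatrix (b : ℂ) : Continuous (coreMatrix b) :=
  continuous_pi fun i => continuous_pi fun j => (differentiable_coreMatrix b i j).continuous

/-- Passing once around the origin multiplies `coreMatrix` by a constant matrix. -/
lemma coreMatrix_monodromy (b w : ℂ) :
    coreMatrix b w = coreMatrix b (w + Real.pi * Complex.I) *
      lower (2 * Complex.cos (Real.pi * b)) * !![0, 1; -1, 0] := by
  have h1 := besselK_add_pi_add_sub_pi b (w + Real.pi * Complex.I)
  have h2 := derivK_add_pi_add_sub_pi b (w + Real.pi * Complex.I)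
  rw [add_sub_cancel_right] at h1 h2
  rw [coreMatrix, coreMatrix, lower]
  refine matrix_ext_two ?_ ?_ ?_ ?_ <;>
    simp only [Matrix.smul_apply, smul_eq_mul, Matrix.mul_apply, Fin.sum_univ_two,
      Matrix.of_apply, Matrix.cons_val', Matrix.cons_val_zero, Matrix.cons_val_one,
      Matrix.cons_val_fin_one, mul_zero, add_zero, zero_add]
  · ring
  · linear_combination (-(Complex.I / ((Real.sqrt Real.pi : ℝ) : ℂ)) / 2) * h1
  · ring
  · linear_combination (-(Complex.I / ((Real.sqrt Real.pi : ℝ) : ℂ))) * h2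

lemma lower_mul_lower (c d : ℂ) : lower c * lower d = lower (c + d) := by
  simp [lower]

/-! ### The right factor in the three sectors -/

lemma rightFactor_of_lt {a θ : ℝ} {ξ : ℂ} (h : argBr θ ξ < Real.pi / 4 - 2 * θ) :
    rightFactor a θ ξ = 1 := if_pos h

lemma rightFactor_of_mid {a θ : ℝ} {ξ : ℂ} (h1 : Real.pi / 4 - 2 * θ < argBr θ ξ)
    (h2 : argBr θ ξ < 3 * Real.pi / 4 - 2 * θ) :
    rightFactor a θ ξ = lower (Complex.exp (Complex.I * Real.pi * a / 2)) := by
  rw [rightFactor, if_neg (not_lt.2 h1.le), if_pos h2]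

lemma rightFactor_of_gt {a θ : ℝ} {ξ : ℂ} (h : 3 * Real.pi / 4 - 2 * θ < argBr θ ξ) :
    rightFactor a θ ξ = lower (2 * Complex.cos (Real.pi * a / 2)) := by
  have hpi := Real.pi_pos
  rw [rightFactor, if_neg (not_lt.2 (by linarith)), if_neg (not_lt.2 h.le)]

lemma sector_cases {θ : ℝ} {ξ : ℂ} (h : ξ ∉ contour θ) :
    argBr θ ξ < Real.pi / 4 - 2 * θ ∨
      (Real.pi / 4 - 2 * θ < argBr θ ξ ∧ argBr θ ξ < 3 * Real.pi / 4 - 2 * θ) ∨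
        3 * Real.pi / 4 - 2 * θ < argBr θ ξ := by
  obtain ⟨h1, h2⟩ := argBr_ne_of_notMem_contour h
  rcases lt_or_gt_of_ne h1 with h | h
  · exact Or.inl h
  · rcases lt_or_gt_of_ne h2 with h' | h'
    · exact Or.inr (Or.inl ⟨h, h'⟩)
    · exact Or.inr (Or.inr h')

lemma eventually_rightFactor_eq (a : ℝ) {θ : ℝ} {ξ : ℂ} (h : ξ ∉ contour θ) :
    ∀ᶠ η in 𝓝 ξ, rightFactor a θ η = rightFactor a θ ξ := by
  have hc := continuousAt_argBr (notMem_ray_zero_of_notMem_contour h)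
  rcases sector_cases h with h1 | ⟨h1, h2⟩ | h1
  · filter_upwards [hc.eventually_lt_const h1] with η hη
    rw [rightFactor_of_lt hη, rightFactor_of_lt h1]
  · filter_upwards [hc.eventually_const_lt h1, hc.eventually_lt_const h2] with η hη hη'
    rw [rightFactor_of_mid hη hη', rightFactor_of_mid h1 h2]
  · filter_upwards [hc.eventually_const_lt h1] with η hη
    rw [rightFactor_of_gt hη, rightFactor_of_gt h1]

lemma eventually_notMem_ray_zero {θ : ℝ} {ξ : ℂ} (h : ξ ∉ ray (dir θ 0)) :
    ∀ᶠ η in 𝓝 ξ, η ∉ ray (dir θ 0) := by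
  have := (Complex.isOpen_slitPlane.preimage (continuous_unrotate θ)).mem_nhds
    ((ray_dir_zero_iff θ ξ).1 h)
  filter_upwards [this] with η hη
  exact (ray_dir_zero_iff θ η).2 hη

lemma Psi0_analytic (a θ : ℝ) (i j : Fin 2) :
    DifferentiableOn ℂ (fun ξ => Psi0 a θ ξ i j) (contour θ)ᶜ := by
  intro ξ hξ
  have h0 := notMem_ray_zero_of_notMem_contour hξ
  have hev : (fun η => Psi0 a θ η i j) =ᶠ[𝓝 ξ]
      fun η => (coreMatrix (a / 2) (logHalfSqrt θ η) * rightFactor a θ ξ) i j := by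
    filter_upwards [eventually_rightFactor_eq a hξ, eventually_notMem_ray_zero h0] with η h1 h2
    rw [Psi0_eq a h2, h1]
  have hd : DifferentiableAt ℂ
      (fun η => (coreMatrix (a / 2) (logHalfSqrt θ η) * rightFactor a θ ξ) i j) ξ := by
    simp only [Matrix.mul_apply, Fin.sum_univ_two]
    have hw := (hasDerivAt_logHalfSqrt h0).differentiableAt
    have hk : ∀ k, DifferentiableAt ℂ (fun η => coreMatrix (a / 2) (logHalfSqrt θ η) i k) ξ :=
      fun k => ((differentiable_coreMatrix (a / 2) i k) (logHalfSqrt θ ξ)).comp ξ hw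
    exact ((hk 0).mul_const _).add ((hk 1).mul_const _)
  exact (hd.congr_of_eventuallyEq hev).differentiableWithinAt

/-! ### The jumps -/

lemma tendsto_Psi0_of_sector {a θ : ℝ} {ξ : ℂ} {S : Set ℂ} {F : Matrix (Fin 2) (Fin 2) ℂ}
    {w : ℂ} (hS : ∀ η ∈ S, η ∉ ray (dir θ 0) ∧ rightFactor a θ η = F)
    (hw : Tendsto (logHalfSqrt θ) (𝓝[S] ξ) (𝓝 w)) :
    Tendsto (Psi0 a θ) (𝓝[S] ξ) (𝓝 (coreMatrix (a / 2) w * F)) := by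
  have h1 : Tendsto (fun η => coreMatrix (a / 2) (logHalfSqrt θ η) * F) (𝓝[S] ξ)
      (𝓝 (coreMatrix (a / 2) w * F)) :=
    (((continuous_coreMatrix _).matrix_mul continuous_const).tendsto w).comp hw
  refine h1.congr' ?_
  filter_upwards [self_mem_nhdsWithin] with η hη
  rw [Psi0_eq a (hS η hη).1, (hS η hη).2]

lemma sector01_spec (a : ℝ) {θ : ℝ} {η : ℂ} (h : η ∈ sector01 θ) :
    η ∉ ray (dir θ 0) ∧ rightFactor a θ η = 1 := by
  have hpi := Real.pi_pos
  exact ⟨notMem_ray_zero_of_argBr_lt h.1 (by have := h.2.2; linarith), rightFactor_of_lt h.2.2⟩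

lemma sector12_spec (a : ℝ) {θ : ℝ} {η : ℂ} (h : η ∈ sector12 θ) :
    η ∉ ray (dir θ 0) ∧
      rightFactor a θ η = lower (Complex.exp (Complex.I * Real.pi * a / 2)) := by
  have hpi := Real.pi_pos
  exact ⟨notMem_ray_zero_of_argBr_lt h.1 (by have := h.2.2; linarith),
    rightFactor_of_mid h.2.1 h.2.2⟩

lemma sector20_spec (a : ℝ) {θ : ℝ} {η : ℂ} (h : η ∈ sector20 θ) :
    η ∉ ray (dir θ 0) ∧ rightFactor a θ η = lower (2 * Complex.cos (Real.pi * a / 2)) :=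
  ⟨notMem_ray_zero_of_argBr_lt h.1 h.2.2, rightFactor_of_gt h.2.1⟩

lemma exp_add_exp_neg_eq (a : ℝ) : Complex.exp (Complex.I * Real.pi * a / 2) +
    Complex.exp (-(Complex.I * Real.pi * a / 2)) = 2 * Complex.cos (Real.pi * a / 2) := by
  rw [Complex.cos, show (Real.pi : ℂ) * a / 2 * Complex.I = Complex.I * Real.pi * a / 2 by ring,
    show -((Real.pi : ℂ) * a / 2) * Complex.I = -(Complex.I * Real.pi * a / 2) by ring]
  ring

/-- On `Γ₀` the two boundary values of the logarithm differ by `2πi`. -/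
lemma tendsto_logHalfSqrt_cut {θ : ℝ} {ξ : ℂ} (hξ : ξ ∈ ray (dir θ 0)) (h0 : ξ ≠ 0) :
    ∃ w, Tendsto (logHalfSqrt θ) (𝓝[sector01 θ] ξ) (𝓝 w) ∧
      Tendsto (logHalfSqrt θ) (𝓝[sector20 θ] ξ) (𝓝 (w + Real.pi * Complex.I)) := by
  have hpi := Real.pi_pos
  have hz0 : unrotate θ ξ ≠ 0 := unrotate_ne_zero h0
  have hns : unrotate θ ξ ∉ Complex.slitPlane := fun h => (ray_dir_zero_iff θ ξ).2 h hξ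
  rw [Complex.mem_slitPlane_iff, not_or, not_lt, not_not] at hns
  obtain ⟨hre, him⟩ := hns
  have hre' : (unrotate θ ξ).re < 0 :=
    lt_of_le_of_ne hre fun h => hz0 (Complex.ext h him)
  set d : ℂ := ((Real.pi / 2 - 2 * θ : ℝ) : ℂ) * Complex.I
  have t1 := Complex.tendsto_log_nhdsWithin_im_neg_of_re_neg_of_im_zero hre' him
  have t2 := Complex.tendsto_log_nhdsWithin_im_nonneg_of_re_neg_of_im_zero hre' him
  have u1 : Tendsto (unrotate θ) (𝓝[sector01 θ] ξ) (𝓝[{z : ℂ | z.im < 0}] (unrotate θ ξ)) := by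
    refine tendsto_nhdsWithin_iff.2
      ⟨((continuous_unrotate θ).tendsto ξ).mono_left nhdsWithin_le_nhds, ?_⟩
    filter_upwards [self_mem_nhdsWithin] with η hη
    refine Complex.arg_neg_iff.1 ?_
    have := hη.2.2
    rw [argBr_eq] at this
    linarith
  have u2 : Tendsto (unrotate θ) (𝓝[sector20 θ] ξ) (𝓝[{z : ℂ | 0 ≤ z.im}] (unrotate θ ξ)) := by
    refine tendsto_nhdsWithin_iff.2
      ⟨((continuous_unrotate θ).tendsto ξ).mono_left nhdsWithin_le_nhds, ?_⟩
    filter_upwards [self_mem_nhdsWithin] with η hη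
    refine Complex.arg_nonneg_iff.1 ?_
    have := hη.2.1
    rw [argBr_eq] at this
    linarith
  refine ⟨_, (((t1.comp u1).add_const d).div_const 2).sub_const _, ?_⟩
  have h2 := (((t2.comp u2).add_const d).div_const 2).sub_const ((Real.log 2 : ℝ) : ℂ)
  have e : ((Real.log ‖unrotate θ ξ‖ : ℂ) - Real.pi * Complex.I + d) / 2 - (Real.log 2 : ℝ) +
      Real.pi * Complex.I = ((Real.log ‖unrotate θ ξ‖ : ℂ) + Real.pi * Complex.I + d) / 2 -
        (Real.log 2 : ℝ) := by ring
  rw [e]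
  exact h2

lemma Psi0_jumps (a θ : ℝ) (k : Fin 3) {ξ : ℂ} (hξ : ξ ∈ ray (dir θ k)) (h0 : ξ ≠ 0) :
    ∃ Ψp Ψm : Matrix (Fin 2) (Fin 2) ℂ,
      Tendsto (Psi0 a θ) (𝓝[plusSide θ k] ξ) (𝓝 Ψp) ∧
      Tendsto (Psi0 a θ) (𝓝[minusSide θ k] ξ) (𝓝 Ψm) ∧
      Ψp = Ψm * jump a k := by
  have hpi := Real.pi_pos
  have hcont : ∀ S, ξ ∉ ray (dir θ 0) →
      Tendsto (logHalfSqrt θ) (𝓝[S] ξ) (𝓝 (logHalfSqrt θ ξ)) := fun S h =>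
    (hasDerivAt_logHalfSqrt h).continuousAt.tendsto.mono_left nhdsWithin_le_nhds
  fin_cases k
  · obtain ⟨w, h1, h2⟩ := tendsto_logHalfSqrt_cut hξ h0
    refine ⟨_, _, tendsto_Psi0_of_sector (fun η hη => sector01_spec a hη) h1,
      tendsto_Psi0_of_sector (fun η hη => sector20_spec a hη) h2, ?_⟩
    have := coreMatrix_monodromy (a / 2) w
    rw [← mul_div_assoc] at this
    rw [mul_one, this]
    rfl
  · have hr : ξ ∈ ray (Real.pi / 4 - 2 * θ) := by simpa [dir] using hξ
    have harg := argBr_of_mem_ray (θ := θ) hr h0 (by linarith) (by linarith)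
    have hn : ξ ∉ ray (dir θ 0) := notMem_ray_zero_of_argBr_lt h0 (by linarith)
    refine ⟨_, _, tendsto_Psi0_of_sector (fun η hη => sector12_spec a hη) (hcont _ hn),
      tendsto_Psi0_of_sector (fun η hη => sector01_spec a hη) (hcont _ hn), ?_⟩
    rw [mul_one]
    rfl
  · have hr : ξ ∈ ray (3 * Real.pi / 4 - 2 * θ) := by simpa [dir] using hξ
    have harg := argBr_of_mem_ray (θ := θ) hr h0 (by linarith) (by linarith)
    have hn : ξ ∉ ray (dir θ 0) := notMem_ray_zero_of_argBr_lt h0 (by linarith)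
    refine ⟨_, _, tendsto_Psi0_of_sector (fun η hη => sector20_spec a hη) (hcont _ hn),
      tendsto_Psi0_of_sector (fun η hη => sector12_spec a hη) (hcont _ hn), ?_⟩
    rw [← exp_add_exp_neg_eq, ← lower_mul_lower, ← mul_assoc]
    rfl

/-! ### Behaviour of the solution at the origin -/

/-- The derivative of `I_μ` with respect to `w = log x`. -/
def derivI (μ w : ℂ) : ℂ := μ * besselI μ w + Complex.exp w * besselI (μ + 1) w

lemma derivI_add_pi (μ w : ℂ) :
    derivI μ (w + Real.pi * Complex.I) = Complex.exp (μ * (Real.pi * Complex.I)) * derivI μ w := by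
  have e : Complex.exp ((μ + 1) * (Real.pi * Complex.I)) =
      -Complex.exp (μ * (Real.pi * Complex.I)) := by
    rw [add_mul, one_mul, Complex.exp_add, Complex.exp_pi_mul_I]; ring
  rw [derivI, derivI, besselI_add_pi, besselI_add_pi, Complex.exp_add, Complex.exp_pi_mul_I, e]
  ring

lemma derivK_eq (b w : ℂ) : derivK b w =
    Real.pi / (2 * Complex.sin (Real.pi * b)) * (derivI (-b) w - derivI b w) :=
  (hasDerivAt_besselK b w).unique
    (((hasDerivAt_besselI (-b) w).sub (hasDerivAt_besselI b w)).const_mul _)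

lemma two_mul_I_mul_sin (b : ℂ) : 2 * Complex.I * Complex.sin (Real.pi * b) =
    Complex.exp (b * (Real.pi * Complex.I)) - Complex.exp (-b * (Real.pi * Complex.I)) := by
  rw [Complex.sin, show -(Real.pi * b) * Complex.I = -b * (Real.pi * Complex.I) by ring,
    show (Real.pi : ℂ) * b * Complex.I = b * (Real.pi * Complex.I) by ring]
  linear_combination (Complex.exp (-b * (Real.pi * Complex.I)) -
    Complex.exp (b * (Real.pi * Complex.I))) * Complex.I_sq

/-- The combination of `K_b` that is proportional to `I_{-b}`. -/
lemma besselK_add_pi_sub {b : ℂ} (hs : Complex.sin (Real.pi * b) ≠ 0) (w : ℂ) :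
    besselK b (w + Real.pi * Complex.I) - Complex.exp (b * (Real.pi * Complex.I)) * besselK b w =
      -(Complex.I * Real.pi) * besselI (-b) w := by
  have h := two_mul_I_mul_sin b
  have hc : Real.pi / (2 * Complex.sin (Real.pi * b)) * Complex.sin (Real.pi * b) =
    (Real.pi : ℂ) / 2 := by field_simp
  rw [besselK, besselK, besselI_add_pi, besselI_add_pi]
  generalize (Real.pi : ℂ) / (2 * Complex.sin (Real.pi * b)) = k at hc ⊢
  linear_combination k * besselI (-b) w * h - 2 * Complex.I * besselI (-b) w * hc

lemma derivK_add_pi_sub {b : ℂ} (hs : Complex.sin (Real.pi * b) ≠ 0) (w : ℂ) :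
    derivK b (w + Real.pi * Complex.I) - Complex.exp (b * (Real.pi * Complex.I)) * derivK b w =
      -(Complex.I * Real.pi) * derivI (-b) w := by
  have h := two_mul_I_mul_sin b
  have hc : Real.pi / (2 * Complex.sin (Real.pi * b)) * Complex.sin (Real.pi * b) =
    (Real.pi : ℂ) / 2 := by field_simp
  rw [derivK_eq, derivK_eq, derivI_add_pi, derivI_add_pi]
  generalize (Real.pi : ℂ) / (2 * Complex.sin (Real.pi * b)) = k at hc ⊢
  linear_combination k * derivI (-b) w * h - 2 * Complex.I * derivI (-b) w * hc

/-- The holomorphic factor `E` in the local representation of the solution at the origin, with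
`4 ^ b` written as `exp (b · 2 log 2)`. -/
def localE (b ξ : ℂ) : Matrix (Fin 2) (Fin 2) ℂ :=
  !![(Real.sqrt Real.pi : ℝ) * Complex.exp (b * (2 * (Real.log 2 : ℝ))) *
      (besselPhi (-b) (ξ / 16) / 2),
    Complex.I * (Real.sqrt Real.pi : ℝ) / (2 * Complex.sin (Real.pi * b)) *
      Complex.exp (-b * (2 * (Real.log 2 : ℝ))) * (besselPhi b (ξ / 16) / 2);
    (Real.sqrt Real.pi : ℝ) * Complex.exp (b * (2 * (Real.log 2 : ℝ))) *
      (-b * besselPhi (-b) (ξ / 16) + ξ / 8 * besselPhi (-b + 1) (ξ / 16)),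
    Complex.I * (Real.sqrt Real.pi : ℝ) / (2 * Complex.sin (Real.pi * b)) *
      Complex.exp (-b * (2 * (Real.log 2 : ℝ))) *
        (b * besselPhi b (ξ / 16) + ξ / 8 * besselPhi (b + 1) (ξ / 16))]

lemma differentiable_localE (b : ℂ) (i j : Fin 2) :
    Differentiable ℂ fun ξ => localE b ξ i j := by
  have hΦ : ∀ μ, Differentiable ℂ fun ξ : ℂ => besselPhi μ (ξ / 16) := fun μ =>
    (differentiable_besselPhi μ).comp (differentiable_id.div_const 16)
  have hξ : Differentiable ℂ fun ξ : ℂ => ξ / 8 := differentiable_id.div_const 8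
  fin_cases i <;> fin_cases j
  · exact ((hΦ _).div_const 2).const_mul _
  · exact ((hΦ _).div_const 2).const_mul _
  · exact (((hΦ _).const_mul _).add (hξ.mul (hΦ _))).const_mul _
  · exact (((hΦ _).const_mul _).add (hξ.mul (hΦ _))).const_mul _

lemma det_localE {b : ℂ} (hs : Complex.sin (Real.pi * b) ≠ 0) (ξ : ℂ) :
    (localE b ξ).det = Complex.I / 2 := by
  have h := wronskian_besselPhi b (ξ / 16)
  have h1 := besselPhi_sub_one b (ξ / 16)
  have hpi : (Real.pi : ℂ) ≠ 0 := by exact_mod_cast Real.pi_ne_zero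
  have hE : Complex.exp (b * (2 * (Real.log 2 : ℝ))) *
      Complex.exp (-b * (2 * (Real.log 2 : ℝ))) = 1 := by
    rw [← Complex.exp_add, ← Complex.exp_zero]; congr 1; ring
  have hk : ((Real.sqrt Real.pi : ℝ) : ℂ) *
      (Complex.I * (Real.sqrt Real.pi : ℝ) / (2 * Complex.sin (Real.pi * b))) *
        (Complex.sin (Real.pi * b) / Real.pi) = Complex.I / 2 := by
    generalize Complex.sin (Real.pi * b) = s at hs
    rw [← ofReal_sqrt_pi_sq]
    have := ofReal_sqrt_pi_ne_zero
    field_simp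
  rw [localE, Matrix.det_fin_two_of]
  rw [show -b + 1 = 1 - b by ring]
  generalize Complex.I * ((Real.sqrt Real.pi : ℝ) : ℂ) / (2 * Complex.sin (Real.pi * b)) = k at hk ⊢
  generalize Complex.exp (b * (2 * (Real.log 2 : ℝ))) = e at hE ⊢
  generalize Complex.exp (-b * (2 * (Real.log 2 : ℝ))) = e' at hE ⊢
  generalize ((Real.sqrt Real.pi : ℝ) : ℂ) = p at hk ⊢
  generalize Complex.sin (Real.pi * b) / Real.pi = s at h hk
  linear_combination hk + p * k * h * (e * e') + p * k * s * hE -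
    p * k * e * e' * besselPhi (-b) (ξ / 16) * h1

lemma besselI_logHalfSqrt (μ : ℂ) {θ : ℝ} {ξ : ℂ} (h : ξ ≠ 0) :
    besselI μ (logHalfSqrt θ ξ) = Complex.exp (μ * (logBr θ ξ / 2)) *
      Complex.exp (-μ * (2 * (Real.log 2 : ℝ))) * besselPhi μ (ξ / 16) := by
  rw [besselI, exp_two_mul_logHalfSqrt h, ← Complex.exp_add, logHalfSqrt]
  congr 2; ring

lemma derivI_logHalfSqrt (μ : ℂ) {θ : ℝ} {ξ : ℂ} (h : ξ ≠ 0) :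
    derivI μ (logHalfSqrt θ ξ) = Complex.exp (μ * (logBr θ ξ / 2)) *
      Complex.exp (-μ * (2 * (Real.log 2 : ℝ))) *
        (μ * besselPhi μ (ξ / 16) + ξ / 8 * besselPhi (μ + 1) (ξ / 16)) := by
  have e : Complex.exp (logHalfSqrt θ ξ) * (Complex.exp ((μ + 1) * (logBr θ ξ / 2)) *
      Complex.exp (-(μ + 1) * (2 * (Real.log 2 : ℝ)))) = Complex.exp (μ * (logBr θ ξ / 2)) *
      Complex.exp (-μ * (2 * (Real.log 2 : ℝ))) * (ξ / 8) := by
    have h8 : Complex.exp (logBr θ ξ - (Real.log 2 : ℝ) - (Real.log 2 : ℝ) - (Real.log 2 : ℝ)) =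
        ξ / 8 := by
      rw [Complex.exp_sub, Complex.exp_sub, Complex.exp_sub, exp_log_two, exp_logBr h]; ring
    rw [← h8, ← Complex.exp_add, ← Complex.exp_add, ← Complex.exp_add, ← Complex.exp_add,
      logHalfSqrt]
    congr 1; ring
  rw [derivI, besselI_logHalfSqrt _ h, besselI_logHalfSqrt _ h]
  linear_combination besselPhi (μ + 1) (ξ / 16) * e

/-- The upper triangular constant factor of the local representation at the origin. -/
def upperC (a : ℝ) : Matrix (Fin 2) (Fin 2) ℂ :=
  !![1, 1 / (2 * Complex.I * Complex.sin (Real.pi * a / 2)); 0, 1]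

/-- The local representation at the origin, in the form valid in the sector between `Γ₁` and
`Γ₂`. -/
lemma coreMatrix_mul_lower_eq {a : ℝ} (hs : Complex.sin (Real.pi * ((a : ℂ) / 2)) ≠ 0) {θ : ℝ}
    {ξ : ℂ} (h : ξ ≠ 0) :
    coreMatrix (a / 2) (logHalfSqrt θ ξ) * lower (Complex.exp (Complex.I * Real.pi * a / 2)) =
      localE (a / 2) ξ * expSigma (-(a * logBr θ ξ / 4)) * upperC a := by
  set b : ℂ := (a : ℂ) / 2 with hb
  set w := logHalfSqrt θ ξ
  have e1 : Complex.I * Real.pi * a / 2 = b * (Real.pi * Complex.I) := by rw [hb]; ring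
  have e2 : (Real.pi : ℂ) * a / 2 = Real.pi * b := by rw [hb]; ring
  have e3 : -((a : ℂ) * logBr θ ξ / 4) = -b * (logBr θ ξ / 2) := by rw [hb]; ring
  have e4 : -(-b * (logBr θ ξ / 2)) = b * (logBr θ ξ / 2) := by ring
  have k1 := besselK_add_pi_sub hs w
  have k2 := derivK_add_pi_sub hs w
  have i1 := besselI_logHalfSqrt (-b) (θ := θ) h
  have i2 := besselI_logHalfSqrt b (θ := θ) h
  have i3 := derivI_logHalfSqrt (-b) (θ := θ) h
  have i4 := derivI_logHalfSqrt b (θ := θ) h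
  rw [neg_neg] at i1 i3
  have kk : besselK b w = Real.pi / (2 * Complex.sin (Real.pi * b)) *
      (besselI (-b) w - besselI b w) := rfl
  have dk := derivK_eq b w
  have hL : Complex.I / ((Real.sqrt Real.pi : ℝ) : ℂ) * (Complex.I * Real.pi) =
      -((Real.sqrt Real.pi : ℝ) : ℂ) := by
    rw [← ofReal_sqrt_pi_sq]
    have := ofReal_sqrt_pi_ne_zero
    field_simp
    rw [Complex.I_sq]
  have hL2 : Complex.I / ((Real.sqrt Real.pi : ℝ) : ℂ) *
      (Real.pi / (2 * Complex.sin (Real.pi * b))) =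
      Complex.I * ((Real.sqrt Real.pi : ℝ) : ℂ) / (2 * Complex.sin (Real.pi * b)) := by
    rw [← ofReal_sqrt_pi_sq]
    have := ofReal_sqrt_pi_ne_zero
    field_simp
  have hL3 : ((Real.sqrt Real.pi : ℝ) : ℂ) * (1 / (2 * Complex.I * Complex.sin (Real.pi * b))) =
      -(Complex.I * ((Real.sqrt Real.pi : ℝ) : ℂ) / (2 * Complex.sin (Real.pi * b))) := by
    have := Complex.I_ne_zero
    field_simp
    rw [Complex.I_sq, neg_neg]
  rw [coreMatrix, lower, localE, expSigma, upperC, e1, e2, e3, e4]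
  generalize Complex.I / ((Real.sqrt Real.pi : ℝ) : ℂ) = L at *
  generalize Complex.I * ((Real.sqrt Real.pi : ℝ) : ℂ) / (2 * Complex.sin (Real.pi * b)) = k at *
  generalize 1 / (2 * Complex.I * Complex.sin (Real.pi * b)) = u at *
  generalize (Real.pi : ℂ) / (2 * Complex.sin (Real.pi * b)) = m at *
  refine matrix_ext_two ?_ ?_ ?_ ?_ <;>
    simp only [Matrix.smul_apply, smul_eq_mul, Matrix.mul_apply, Fin.sum_univ_two,
      Matrix.of_apply, Matrix.cons_val', Matrix.cons_val_zero, Matrix.cons_val_one,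
      Matrix.cons_val_fin_one, mul_zero, add_zero, zero_add, mul_one]
  · linear_combination L / 2 * k1 - besselI (-b) w / 2 * hL +
      (Real.sqrt Real.pi : ℝ) / 2 * i1
  · rw [kk]
    linear_combination (-(besselI (-b) w - besselI b w) / 2) * hL2 - k / 2 * i1 + k / 2 * i2 -
      (Complex.exp (-b * (logBr θ ξ / 2)) * Complex.exp (b * (2 * (Real.log 2 : ℝ))) *
        besselPhi (-b) (ξ / 16) / 2) * hL3
  · linear_combination L * k2 - derivI (-b) w * hL + (Real.sqrt Real.pi : ℝ) * i3
  · rw [dk]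
    linear_combination (-(derivI (-b) w - derivI b w)) * hL2 - k * i3 + k * i4 -
      (Complex.exp (-b * (logBr θ ξ / 2)) * Complex.exp (b * (2 * (Real.log 2 : ℝ))) *
        (-b * besselPhi (-b) (ξ / 16) + ξ / 8 * besselPhi (-b + 1) (ξ / 16))) * hL3

lemma lower_zero : lower 0 = 1 := by
  rw [lower, Matrix.one_fin_two]

/-- The local representation off the contour. In each sector the constants `G` and `F` satisfy
`F = lower (e^{iπa/2}) G`, so that the three sectors reduce to one identity. -/
lemma Psi0_local {a : ℝ} (hs : Complex.sin (Real.pi * ((a : ℂ) / 2)) ≠ 0) {θ : ℝ}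
    {ξ : ℂ} (h : ξ ∉ contour θ) :
    Psi0 a θ ξ = localE (a / 2) ξ * expSigma (-(a * logBr θ ξ / 4)) * matC a θ ξ := by
  have hpi := Real.pi_pos
  have h0 := notMem_ray_zero_of_notMem_contour h
  have hξ : ξ ≠ 0 := ne_zero_of_notMem_ray h0
  have key := coreMatrix_mul_lower_eq hs (θ := θ) hξ
  rw [Psi0_eq a h0, matC, ← upperC, ← mul_assoc, ← key, mul_assoc]
  congr 1
  rcases sector_cases h with h1 | ⟨h1, h2⟩ | h1
  · rw [rightFactor_of_lt h1, if_pos h1, lower_mul_lower, add_neg_cancel, lower_zero]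
  · rw [rightFactor_of_mid h1 h2, if_neg (not_lt.2 h1.le), if_pos h2, mul_one]
  · rw [rightFactor_of_gt h1, if_neg (not_lt.2 (by linarith)), if_neg (not_lt.2 h1.le),
      lower_mul_lower, exp_add_exp_neg_eq]

lemma Psi0_zero {a : ℝ} (hs : Complex.sin (Real.pi * ((a : ℂ) / 2)) ≠ 0) (θ : ℝ) :
    ∃ (B₀ : Matrix (Fin 2) (Fin 2) ℂ) (E R : ℂ → Matrix (Fin 2) (Fin 2) ℂ),
    (∀ i j, AnalyticAt ℂ (fun ξ => E ξ i j) 0) ∧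
    (∀ᶠ ξ in 𝓝 (0 : ℂ), (E ξ).det = Complex.I / 2) ∧
    (∀ i j, (fun ξ => R ξ i j) =O[𝓝 (0 : ℂ)] (fun ξ => ξ)) ∧
    (∀ᶠ ξ in 𝓝 (0 : ℂ), E ξ = B₀ * (1 + R ξ)) ∧
    ∀ᶠ ξ in 𝓝 (0 : ℂ) ⊓ 𝓟 (contour θ)ᶜ,
      Psi0 a θ ξ = E ξ * expSigma (-(a * logBr θ ξ / 4)) * matC a θ ξ := by
  set E := localE ((a : ℂ) / 2)
  have hdet : ∀ ξ, (E ξ).det = Complex.I / 2 := det_localE hs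
  have hunit : IsUnit (E 0).det := by
    rw [hdet]; exact (div_ne_zero Complex.I_ne_zero two_ne_zero).isUnit
  refine ⟨E 0, E, fun ξ => (E 0)⁻¹ * E ξ - 1, ?_, Eventually.of_forall hdet, ?_,
    Eventually.of_forall fun ξ => ?_, ?_⟩
  · exact fun i j => (differentiable_localE _ i j).analyticAt 0
  · intro i j
    have hd : DifferentiableAt ℂ (fun ξ => ((E 0)⁻¹ * E ξ) i j) 0 := by
      simp only [Matrix.mul_apply, Fin.sum_univ_two]
      exact ((differentiable_localE _ 0 j 0).const_mul _).add
        ((differentiable_localE _ 1 j 0).const_mul _)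
    have h := hd.isBigO_sub
    simp only [sub_zero, Matrix.nonsing_inv_mul _ hunit] at h
    exact h
  · rw [add_sub_cancel, ← mul_assoc, Matrix.mul_nonsing_inv _ hunit, one_mul]
  · rw [eventually_inf_principal]
    exact Eventually.of_forall fun ξ hξ => Psi0_local hs hξ

/-! ### Behaviour of the solution at infinity -/

/-- The expansions of `K_b` and of its logarithmic derivative. -/
lemma besselK_derivK_expansion {b : ℝ} (h0 : 0 < b) (h1 : b < 1) :
    ∃ C : ℝ, 0 ≤ C ∧ ∀ w : ℂ, |w.im| ≤ 11 * Real.pi / 8 → ‖Complex.exp (-w)‖ ≤ 1 →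
      ∃ ε δ : ℂ, ‖ε‖ ≤ C * ‖Complex.exp (-w)‖ ^ 2 ∧ ‖δ‖ ≤ C * ‖Complex.exp (-w)‖ ^ 2 ∧
        besselK b w = (Real.sqrt (Real.pi / 2) : ℝ) * (Complex.exp (-w / 2) *
          Complex.exp (-Complex.exp w) * (1 + (4 * b ^ 2 - 1) / 8 * Complex.exp (-w) + ε)) ∧
        derivK b w = -((Real.sqrt (Real.pi / 2) : ℝ) * (Complex.exp (w / 2) *
          Complex.exp (-Complex.exp w) * (1 + (4 * b ^ 2 + 3) / 8 * Complex.exp (-w) + δ))) := by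
  obtain ⟨C1, hC1, H1⟩ := besselK_asymptotic h0 h1
  obtain ⟨C2, hC2, H2⟩ := besselK_asymptotic (b := 1 - b) (by linarith) (by linarith)
  have hp : 0 < Real.sqrt (Real.pi / 2) := Real.sqrt_pos.2 (by positivity)
  generalize Real.sqrt (Real.pi / 2) = p at *
  have hpc : (p : ℂ) ≠ 0 := by exact_mod_cast hp.ne'
  refine ⟨C2 / p + 1 + C1 / p, by positivity, fun w hw hw1 => ?_⟩
  have G1 := H1 w hw
  have G2 := H2 w hw
  have e1 : Complex.exp (w / 2) * Complex.exp (-w / 2) = 1 := by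
    rw [← Complex.exp_add, ← Complex.exp_zero]; congr 1; ring
  have e2 : Complex.exp (Complex.exp w) * Complex.exp (-Complex.exp w) = 1 := by
    rw [← Complex.exp_add, add_neg_cancel, Complex.exp_zero]
  have e3 : Complex.exp w * Complex.exp (-w / 2) = Complex.exp (w / 2) := by
    rw [← Complex.exp_add]; congr 1; ring
  have e4 : Complex.exp (w / 2) * Complex.exp (-w) = Complex.exp (-w / 2) := by
    rw [← Complex.exp_add]; congr 1; ring
  -- The relative errors of the two Macdonald functions.
  set ε : ℂ := (besselK b w * Complex.exp (w / 2) * Complex.exp (Complex.exp w) -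
    p * (1 + (4 * b ^ 2 - 1) / 8 * Complex.exp (-w))) / p with hε
  set ε' : ℂ := (besselK (1 - b : ℝ) w * Complex.exp (w / 2) * Complex.exp (Complex.exp w) -
    p * (1 + (4 * ((1 - b : ℝ) : ℂ) ^ 2 - 1) / 8 * Complex.exp (-w))) / p with hε'
  have n1 : ‖ε‖ ≤ C1 / p * ‖Complex.exp (-w)‖ ^ 2 := by
    rw [hε, norm_div, Complex.norm_real, Real.norm_of_nonneg hp.le]
    exact (div_le_div_of_nonneg_right G1 hp.le).trans_eq (by ring)
  have n2 : ‖ε'‖ ≤ C2 / p * ‖Complex.exp (-w)‖ ^ 2 := by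
    rw [hε', norm_div, Complex.norm_real, Real.norm_of_nonneg hp.le]
    exact (div_le_div_of_nonneg_right G2 hp.le).trans_eq (by ring)
  have k1 : besselK b w = p * (Complex.exp (-w / 2) *
      Complex.exp (-Complex.exp w) * (1 + (4 * b ^ 2 - 1) / 8 * Complex.exp (-w) + ε)) := by
    have hpe : (p : ℂ) * ε = besselK b w * Complex.exp (w / 2) * Complex.exp (Complex.exp w) -
      p * (1 + (4 * b ^ 2 - 1) / 8 * Complex.exp (-w)) := by rw [hε]; field_simp
    linear_combination (-(Complex.exp (-w / 2) * Complex.exp (-Complex.exp w))) * hpe -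
      besselK b w * (Complex.exp (Complex.exp w) * Complex.exp (-Complex.exp w)) * e1 -
      besselK b w * e2
  have k2 : besselK (1 - b : ℝ) w = p * (Complex.exp (-w / 2) *
      Complex.exp (-Complex.exp w) *
        (1 + (4 * ((1 - b : ℝ) : ℂ) ^ 2 - 1) / 8 * Complex.exp (-w) + ε')) := by
    have hpe : (p : ℂ) * ε' = besselK (1 - b : ℝ) w * Complex.exp (w / 2) *
      Complex.exp (Complex.exp w) -
      p * (1 + (4 * ((1 - b : ℝ) : ℂ) ^ 2 - 1) / 8 * Complex.exp (-w)) := by rw [hε']; field_simp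
    linear_combination (-(Complex.exp (-w / 2) * Complex.exp (-Complex.exp w))) * hpe -
      besselK (1 - b : ℝ) w * (Complex.exp (Complex.exp w) * Complex.exp (-Complex.exp w)) * e1 -
      besselK (1 - b : ℝ) w * e2
  set q := ‖Complex.exp (-w)‖ with hq
  have hq0 : 0 ≤ q := norm_nonneg _
  have hb : ‖(b : ℂ)‖ ≤ 1 := by
    rw [Complex.norm_real, Real.norm_of_nonneg h0.le]; exact h1.le
  refine ⟨ε, ε' + b * Complex.exp (-w) * ((4 * b ^ 2 - 1) / 8 * Complex.exp (-w) + ε), ?_, ?_,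
    k1, ?_⟩
  · refine n1.trans ?_
    gcongr
    have : 0 ≤ C2 / p := by positivity
    linarith
  · have hc : ‖(4 * (b : ℂ) ^ 2 - 1) / 8‖ ≤ 1 := by
      rw [show (4 * (b : ℂ) ^ 2 - 1) / 8 = (((4 * b ^ 2 - 1) / 8 : ℝ) : ℂ) by push_cast; ring,
        Complex.norm_real, Real.norm_eq_abs, abs_le]
      constructor <;> nlinarith
    have m1 : ‖(4 * (b : ℂ) ^ 2 - 1) / 8 * Complex.exp (-w) + ε‖ ≤ q + C1 / p * q ^ 2 := by
      refine (norm_add_le _ _).trans (add_le_add ?_ n1)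
      rw [norm_mul]
      nlinarith
    have m2 : ‖(b : ℂ) * Complex.exp (-w) * ((4 * b ^ 2 - 1) / 8 * Complex.exp (-w) + ε)‖ ≤
        (1 + C1 / p) * q ^ 2 := by
      rw [norm_mul, norm_mul, ← hq]
      have hC : 0 ≤ C1 / p := by positivity
      calc ‖(b : ℂ)‖ * q * ‖(4 * (b : ℂ) ^ 2 - 1) / 8 * Complex.exp (-w) + ε‖
          ≤ 1 * q * (q + C1 / p * q ^ 2) := by gcongr
        _ = q ^ 2 + C1 / p * (q ^ 2 * q) := by ring
        _ ≤ q ^ 2 + C1 / p * (q ^ 2 * 1) := by gcongr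
        _ = _ := by ring
    refine (norm_add_le _ _).trans ((add_le_add n2 m2).trans (le_of_eq ?_))
    ring
  · have hcast : (1 : ℂ) - b = ((1 - b : ℝ) : ℂ) := by push_cast; ring
    rw [derivK, hcast, k1, k2]
    push_cast
    linear_combination (-(p * Complex.exp (-Complex.exp w) *
      (1 + (4 * (1 - (b : ℂ)) ^ 2 - 1) / 8 * Complex.exp (-w) + ε'))) * e3 +
      (b * p * Complex.exp (-Complex.exp w) *
        (1 + (4 * (b : ℂ) ^ 2 - 1) / 8 * Complex.exp (-w) + ε)) * e4

/-- In a sector inside the right half plane `e^{-2x}` is negligible against every power. -/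
lemma norm_exp_neg_two_mul_exp_le : ∃ C : ℝ, 0 ≤ C ∧ ∀ w : ℂ, |w.im| ≤ 3 * Real.pi / 8 →
    ‖Complex.exp (-(2 * Complex.exp w))‖ ≤ C * ‖Complex.exp (-w)‖ ^ 2 := by
  have hpi := Real.pi_pos
  have hc : 0 < Real.cos (3 * Real.pi / 8) :=
    Real.cos_pos_of_mem_Ioo ⟨by linarith, by linarith⟩
  set c := Real.cos (3 * Real.pi / 8)
  refine ⟨2 / (2 * c) ^ 2, by positivity, fun w hw => ?_⟩
  have h1 : c ≤ Real.cos w.im := by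
    rw [← Real.cos_abs w.im]
    exact Real.cos_le_cos_of_nonneg_of_le_pi (abs_nonneg _) (by linarith) hw
  have hx := Real.exp_pos w.re
  have h2 : (-(2 * Complex.exp w)).re ≤ -(2 * (Real.exp w.re * c)) := by
    rw [show -(2 * Complex.exp w) = ((-2 : ℝ) : ℂ) * Complex.exp w by push_cast; ring,
      Complex.re_ofReal_mul, Complex.exp_re]
    nlinarith
  rw [Complex.norm_exp, Complex.norm_exp, Complex.neg_re w, Real.exp_neg w.re]
  refine (Real.exp_le_exp.2 h2).trans ?_
  have h3 := Real.quadratic_le_exp_of_nonneg (x := 2 * (Real.exp w.re * c)) (by positivity)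
  have hy : 0 < 2 * (Real.exp w.re * c) := by positivity
  have h4 : (2 * (Real.exp w.re * c)) ^ 2 / 2 ≤ Real.exp (2 * (Real.exp w.re * c)) := by linarith
  rw [Real.exp_neg]
  calc (Real.exp (2 * (Real.exp w.re * c)))⁻¹ ≤ ((2 * (Real.exp w.re * c)) ^ 2 / 2)⁻¹ := by
        gcongr
    _ = 2 / (2 * c) ^ 2 * (Real.exp w.re)⁻¹ ^ 2 := by field_simp

/-- `X` and `X'` behave like a solution dominant in the right half plane and its logarithmic
derivative, with constant `C` in the error. -/
def DominantExpansion (b : ℝ) (C : ℝ) (w X X' : ℂ) : Prop :=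
  ∃ ε δ : ℂ, ‖ε‖ ≤ C * ‖Complex.exp (-w)‖ ^ 2 ∧ ‖δ‖ ≤ C * ‖Complex.exp (-w)‖ ^ 2 ∧
    X = (Real.sqrt (Real.pi / 2) : ℝ) * (-Complex.I * Complex.exp (-w / 2) *
      Complex.exp (Complex.exp w) * (1 - (4 * b ^ 2 - 1) / 8 * Complex.exp (-w) + ε)) ∧
    X' = -((Real.sqrt (Real.pi / 2) : ℝ) * (Complex.I * Complex.exp (w / 2) *
      Complex.exp (Complex.exp w) * (1 - (4 * b ^ 2 + 3) / 8 * Complex.exp (-w) + δ)))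

lemma exp_half_pi_mul_I : Complex.exp (Real.pi * Complex.I / 2) = Complex.I := by
  rw [show (Real.pi : ℂ) * Complex.I / 2 = Real.pi / 2 * Complex.I by ring,
    Complex.exp_pi_div_two_mul_I]

lemma exp_neg_half_pi_mul_I : Complex.exp (-(Real.pi * Complex.I / 2)) = -Complex.I := by
  rw [Complex.exp_neg, exp_half_pi_mul_I, Complex.inv_I]

lemma exp_neg_pi_mul_I : Complex.exp (-(Real.pi * Complex.I)) = -1 := by
  rw [Complex.exp_neg, Complex.exp_pi_mul_I]; norm_num

/-- The first column of the solution is dominant in each of the three sectors. -/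
lemma dominantExpansion_column {b : ℝ} (h0 : 0 < b) (h1 : b < 1) :
    ∃ C : ℝ, 0 ≤ C ∧ ∀ w : ℂ, ‖Complex.exp (-w)‖ ≤ 1 →
      (|w.im + Real.pi| ≤ 11 * Real.pi / 8 → DominantExpansion b C w
        (besselK b (w + Real.pi * Complex.I)) (derivK b (w + Real.pi * Complex.I))) ∧
      (|w.im - Real.pi| ≤ 11 * Real.pi / 8 → DominantExpansion b C w
        (-besselK b (w - Real.pi * Complex.I)) (-derivK b (w - Real.pi * Complex.I))) ∧
      (|w.im| ≤ 3 * Real.pi / 8 → ∀ η : ℂ, ‖η‖ = 1 → DominantExpansion b C w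
        (besselK b (w + Real.pi * Complex.I) - η * besselK b w)
        (derivK b (w + Real.pi * Complex.I) - η * derivK b w)) := by
  obtain ⟨C, hC, H⟩ := besselK_derivK_expansion h0 h1
  obtain ⟨D, hD, HD⟩ := norm_exp_neg_two_mul_exp_le
  have hpi := Real.pi_pos
  have hA : ∀ w : ℂ, ‖Complex.exp (-w)‖ ≤ 1 → |w.im + Real.pi| ≤ 11 * Real.pi / 8 →
      DominantExpansion b C w
        (besselK b (w + Real.pi * Complex.I)) (derivK b (w + Real.pi * Complex.I)) := by
    intro w hw hm
    have a1 : Complex.exp (-(w + Real.pi * Complex.I)) = -Complex.exp (-w) := by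
      rw [neg_add, Complex.exp_add, exp_neg_pi_mul_I]; ring
    have a2 : Complex.exp (w + Real.pi * Complex.I) = -Complex.exp w := by
      rw [Complex.exp_add, Complex.exp_pi_mul_I]; ring
    have a3 : Complex.exp (-(w + Real.pi * Complex.I) / 2) =
        -Complex.I * Complex.exp (-w / 2) := by
      rw [show -(w + Real.pi * Complex.I) / 2 = -w / 2 + -(Real.pi * Complex.I / 2) by ring,
        Complex.exp_add, exp_neg_half_pi_mul_I]; ring
    have a4 : Complex.exp ((w + Real.pi * Complex.I) / 2) =
        Complex.I * Complex.exp (w / 2) := by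
      rw [add_div, Complex.exp_add, exp_half_pi_mul_I]; ring
    obtain ⟨ε, δ, h2, h3, h4, h5⟩ := H (w + Real.pi * Complex.I) (by simpa using hm)
      (by rwa [a1, norm_neg])
    rw [a1, norm_neg] at h2 h3
    rw [a1, a2, neg_neg] at h4 h5
    rw [a3] at h4
    rw [a4] at h5
    exact ⟨ε, δ, h2, h3, by rw [h4]; ring, by rw [h5]; ring⟩
  refine ⟨C + D * (2 + C), by positivity, fun w hw => ⟨fun hm => ?_, fun hm => ?_, ?_⟩⟩
  · obtain ⟨ε, δ, h2, h3, h4, h5⟩ := hA w hw hm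
    have : C ≤ C + D * (2 + C) := le_add_of_nonneg_right (by positivity)
    exact ⟨ε, δ, h2.trans (by gcongr), h3.trans (by gcongr), h4, h5⟩
  · have a1 : Complex.exp (-(w - Real.pi * Complex.I)) = -Complex.exp (-w) := by
      rw [neg_sub, sub_eq_neg_add, Complex.exp_add, Complex.exp_pi_mul_I]; ring
    have a2 : Complex.exp (w - Real.pi * Complex.I) = -Complex.exp w := by
      rw [sub_eq_add_neg, Complex.exp_add, exp_neg_pi_mul_I]; ring
    have a3 : Complex.exp (-(w - Real.pi * Complex.I) / 2) =
        Complex.I * Complex.exp (-w / 2) := by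
      rw [show -(w - Real.pi * Complex.I) / 2 = -w / 2 + Real.pi * Complex.I / 2 by ring,
        Complex.exp_add, exp_half_pi_mul_I]; ring
    have a4 : Complex.exp ((w - Real.pi * Complex.I) / 2) =
        -Complex.I * Complex.exp (w / 2) := by
      rw [show (w - Real.pi * Complex.I) / 2 = w / 2 + -(Real.pi * Complex.I / 2) by ring,
        Complex.exp_add, exp_neg_half_pi_mul_I]; ring
    obtain ⟨ε, δ, h2, h3, h4, h5⟩ := H (w - Real.pi * Complex.I) (by simpa using hm)
      (by rwa [a1, norm_neg])
    rw [a1, norm_neg] at h2 h3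
    rw [a1, a2, neg_neg] at h4 h5
    rw [a3] at h4
    rw [a4] at h5
    have : C ≤ C + D * (2 + C) := le_add_of_nonneg_right (by positivity)
    exact ⟨ε, δ, h2.trans (by gcongr), h3.trans (by gcongr), by rw [h4]; ring, by rw [h5]; ring⟩
  · intro hm η hη
    obtain ⟨hm1, hm2⟩ := abs_le.1 hm
    have hm' : |w.im + Real.pi| ≤ 11 * Real.pi / 8 := by
      rw [abs_le]; constructor <;> linarith
    obtain ⟨ε, δ, h2, h3, h4, h5⟩ := hA w hw hm'
    obtain ⟨ε', δ', g2, g3, g4, g5⟩ := H w (by linarith) hw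
    have hx := HD w hm
    have hE : Complex.exp (-Complex.exp w) =
        Complex.exp (Complex.exp w) * Complex.exp (-(2 * Complex.exp w)) := by
      rw [← Complex.exp_add]; congr 1; ring
    have bnd : ∀ c τ ζ : ℂ, ‖c‖ ≤ 1 → ‖τ‖ ≤ C * ‖Complex.exp (-w)‖ ^ 2 →
        ‖ζ‖ ≤ C * ‖Complex.exp (-w)‖ ^ 2 →
        ‖ζ + Complex.I * η * Complex.exp (-(2 * Complex.exp w)) *
          (1 + c * Complex.exp (-w) + τ)‖ ≤ (C + D * (2 + C)) * ‖Complex.exp (-w)‖ ^ 2 ∧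
        ‖ζ + -Complex.I * η * Complex.exp (-(2 * Complex.exp w)) *
          (1 + c * Complex.exp (-w) + τ)‖ ≤ (C + D * (2 + C)) * ‖Complex.exp (-w)‖ ^ 2 := by
      intro c τ ζ hc hτ hζ
      have b1 : ‖1 + c * Complex.exp (-w) + τ‖ ≤ 2 + C := by
        have c1 : ‖c * Complex.exp (-w)‖ ≤ 1 := by
          rw [norm_mul]; exact mul_le_one₀ hc (norm_nonneg _) hw
        have c2 : ‖τ‖ ≤ C := hτ.trans (mul_le_of_le_one_right hC (pow_le_one₀ (norm_nonneg _) hw))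
        have c3 := norm_add₃_le (a := (1 : ℂ)) (b := c * Complex.exp (-w)) (c := τ)
        rw [norm_one] at c3
        linarith
      have b2 : ‖Complex.exp (-(2 * Complex.exp w))‖ * ‖1 + c * Complex.exp (-w) + τ‖ ≤
          D * ‖Complex.exp (-w)‖ ^ 2 * (2 + C) := by gcongr
      constructor
      · refine (norm_add_le _ _).trans ?_
        rw [norm_mul, norm_mul, norm_mul, Complex.norm_I, hη, one_mul, one_mul]
        linarith
      · refine (norm_add_le _ _).trans ?_
        rw [norm_mul, norm_mul, norm_mul, norm_neg, Complex.norm_I, hη, one_mul, one_mul]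
        linarith
    have hc1 : ‖(4 * (b : ℂ) ^ 2 - 1) / 8‖ ≤ 1 := by
      rw [show (4 * (b : ℂ) ^ 2 - 1) / 8 = (((4 * b ^ 2 - 1) / 8 : ℝ) : ℂ) by push_cast; ring,
        Complex.norm_real, Real.norm_eq_abs, abs_le]
      constructor <;> nlinarith
    have hc2 : ‖(4 * (b : ℂ) ^ 2 + 3) / 8‖ ≤ 1 := by
      rw [show (4 * (b : ℂ) ^ 2 + 3) / 8 = (((4 * b ^ 2 + 3) / 8 : ℝ) : ℂ) by push_cast; ring,
        Complex.norm_real, Real.norm_eq_abs, abs_le]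
      constructor <;> nlinarith
    refine ⟨_, _, (bnd _ ε' ε hc1 g2 h2).2, (bnd _ δ' δ hc2 g3 h3).1, ?_, ?_⟩
    · rw [h4, g4, hE]
      generalize Complex.exp (-(2 * Complex.exp w)) = t
      linear_combination (-(Real.sqrt (Real.pi / 2) : ℝ) * Complex.exp (-w / 2) *
        Complex.exp (Complex.exp w) * η * t * (1 + (4 * b ^ 2 - 1) / 8 * Complex.exp (-w) + ε')) *
          Complex.I_sq
    · rw [h5, g5, hE]
      generalize Complex.exp (-(2 * Complex.exp w)) = t
      linear_combination ((Real.sqrt (Real.pi / 2) : ℝ) * Complex.exp (w / 2) *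
        Complex.exp (Complex.exp w) * η * t * (1 + (4 * b ^ 2 + 3) / 8 * Complex.exp (-w) + δ')) *
          Complex.I_sq

lemma coreMatrix_mul_lower (b w c : ℂ) : coreMatrix b w * lower c =
    (Complex.I / (Real.sqrt Real.pi : ℝ)) •
      !![(besselK b (w + Real.pi * Complex.I) - c * besselK b w) / 2, -(besselK b w / 2);
        derivK b (w + Real.pi * Complex.I) - c * derivK b w, -derivK b w] := by
  rw [coreMatrix, lower]
  refine matrix_ext_two ?_ ?_ ?_ ?_ <;>
    simp only [Matrix.smul_apply, smul_eq_mul, Matrix.mul_apply, Fin.sum_univ_two,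
      Matrix.of_apply, Matrix.cons_val', Matrix.cons_val_zero, Matrix.cons_val_one,
      Matrix.cons_val_fin_one, mul_zero, mul_one, zero_add] <;> ring

lemma logHalfSqrt_im (θ : ℝ) (ξ : ℂ) : (logHalfSqrt θ ξ).im = argBr θ ξ / 2 := by
  rw [logHalfSqrt, Complex.sub_im, Complex.ofReal_im, sub_zero,
    show logBr θ ξ / 2 = ((1 / 2 : ℝ) : ℂ) * logBr θ ξ by push_cast; ring,
    Complex.im_ofReal_mul, argBr]
  ring

lemma sqrtBr_sq {θ : ℝ} {ξ : ℂ} (h : ξ ≠ 0) : sqrtBr θ ξ ^ 2 = ξ := by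
  rw [sqrtBr, ← Complex.exp_nat_mul, Nat.cast_two, mul_div_cancel₀ _ two_ne_zero, exp_logBr h]

lemma norm_sqrtBr_sq {θ : ℝ} {ξ : ℂ} (h : ξ ≠ 0) : ‖sqrtBr θ ξ‖ ^ 2 = ‖ξ‖ := by
  rw [← norm_pow, sqrtBr_sq h]

lemma exp_logHalfSqrt (θ : ℝ) (ξ : ℂ) : Complex.exp (logHalfSqrt θ ξ) = sqrtBr θ ξ / 2 := by
  rw [logHalfSqrt, Complex.exp_sub, exp_log_two, sqrtBr]

lemma exp_neg_logHalfSqrt (θ : ℝ) (ξ : ℂ) :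
    Complex.exp (-logHalfSqrt θ ξ) = 2 * (sqrtBr θ ξ)⁻¹ := by
  rw [Complex.exp_neg, exp_logHalfSqrt, inv_div, div_eq_mul_inv]

lemma norm_exp_neg_logHalfSqrt_sq {θ : ℝ} {ξ : ℂ} (h : ξ ≠ 0) :
    ‖Complex.exp (-logHalfSqrt θ ξ)‖ ^ 2 = 4 / ‖ξ‖ := by
  rw [exp_neg_logHalfSqrt, norm_mul, norm_inv, mul_pow, inv_pow, norm_sqrtBr_sq h,
    Complex.norm_ofNat, div_eq_mul_inv]
  norm_num

/-- Uniformly in `θ`, the second column of `Ψ` consists of Macdonald functions, which are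
recessive in the right half plane, and the first column of dominant solutions. -/
lemma Psi0_columns {a : ℝ} (h0 : 0 < a) (h1 : a < 2) :
    ∃ C : ℝ, 0 ≤ C ∧ ∀ θ ∈ Set.Icc (0 : ℝ) (Real.pi / 2), ∀ ξ ∉ contour θ, 4 ≤ ‖ξ‖ →
      ∃ X X' : ℂ, DominantExpansion (a / 2) C (logHalfSqrt θ ξ) X X' ∧
        Psi0 a θ ξ = (Complex.I / (Real.sqrt Real.pi : ℝ)) •
          !![X / 2, -(besselK (a / 2 : ℝ) (logHalfSqrt θ ξ) / 2);
            X', -derivK (a / 2 : ℝ) (logHalfSqrt θ ξ)] := by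
  obtain ⟨C, hC, H⟩ := dominantExpansion_column (b := a / 2) (by linarith) (by linarith)
  refine ⟨C, hC, fun θ hθ ξ hξ hn => ?_⟩
  have hpi := Real.pi_pos
  obtain ⟨t0, t1⟩ := hθ
  have hr := notMem_ray_zero_of_notMem_contour hξ
  have hξ0 := ne_zero_of_notMem_ray hr
  have hq : ‖Complex.exp (-logHalfSqrt θ ξ)‖ ≤ 1 := by
    rw [← sq_le_one_iff₀ (norm_nonneg _), norm_exp_neg_logHalfSqrt_sq hξ0]
    exact (div_le_one (by linarith)).2 hn
  obtain ⟨H1, H2, H3⟩ := H _ hq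
  have him := logHalfSqrt_im θ ξ
  have hgt := argBr_gt θ ξ
  have hlt := argBr_lt hr
  have hb : (a : ℂ) / 2 = ((a / 2 : ℝ) : ℂ) := by push_cast; ring
  rw [Psi0_eq a hr, hb]
  rcases sector_cases hξ with h | ⟨h, h'⟩ | h
  · refine ⟨_, _, H1 ?_, ?_⟩
    · rw [him, abs_le]; constructor <;> linarith
    · rw [rightFactor_of_lt h, mul_one]; rfl
  · refine ⟨_, _, H3 ?_ (Complex.exp (Complex.I * Real.pi * a / 2)) ?_, ?_⟩
    · rw [him, abs_le]; constructor <;> linarith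
    · rw [show Complex.I * Real.pi * a / 2 = ((Real.pi * a / 2 : ℝ) : ℂ) * Complex.I by
        push_cast; ring, Complex.norm_exp_ofReal_mul_I]
    · rw [rightFactor_of_mid h h', coreMatrix_mul_lower]
  · refine ⟨_, _, H2 ?_, ?_⟩
    · rw [him, abs_le]; constructor <;> linarith
    -- The relation between the values of `K` at `x e^{iπ}`, `x` and `x e^{-iπ}` turns this
    -- column into a single Macdonald function at `x e^{-iπ}`.
    · have m1 := besselK_add_pi_add_sub_pi ((a / 2 : ℝ) : ℂ) (logHalfSqrt θ ξ)
      have m2 := derivK_add_pi_add_sub_pi ((a / 2 : ℝ) : ℂ) (logHalfSqrt θ ξ)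
      rw [rightFactor_of_gt h, coreMatrix_mul_lower, mul_div_assoc, hb, ← eq_sub_of_add_eq' ?_,
        ← eq_sub_of_add_eq' ?_]
      · linear_combination -m2
      · linear_combination -m1

/-- The uniform two-term expansion of the solution at infinity. -/
lemma Psi0_expansion {a : ℝ} (h0 : 0 < a) (h1 : a < 2) :
    ∃ K : ℝ, ∀ θ ∈ Set.Icc (0 : ℝ) (Real.pi / 2), ∀ ξ ∉ contour θ, 4 ≤ ‖ξ‖ →
      ∃ E : Matrix (Fin 2) (Fin 2) ℂ, (∀ i j, ‖E i j‖ ≤ K / ‖ξ‖) ∧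
        Psi0 a θ ξ = expSigma (-(logBr θ ξ / 4)) *
          (1 + (sqrtBr θ ξ)⁻¹ • Psi1 a + E) * matT * expSigma (sqrtBr θ ξ / 2) := by
  obtain ⟨C, hC, H⟩ := Psi0_columns h0 h1
  obtain ⟨D, hD, HK⟩ := besselK_derivK_expansion (b := a / 2) (by linarith) (by linarith)
  refine ⟨(C + D) * 4, fun θ hθ ξ hξ hn => ?_⟩
  have hpi := Real.pi_pos
  obtain ⟨t0, t1⟩ := hθ
  have hr := notMem_ray_zero_of_notMem_contour hξ
  have hξ0 := ne_zero_of_notMem_ray hr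
  have hq : ‖Complex.exp (-logHalfSqrt θ ξ)‖ ≤ 1 := by
    rw [← sq_le_one_iff₀ (norm_nonneg _), norm_exp_neg_logHalfSqrt_sq hξ0]
    exact (div_le_one (by linarith)).2 hn
  have him := logHalfSqrt_im θ ξ
  have hgt := argBr_gt θ ξ
  have hlt := argBr_lt hr
  obtain ⟨X, X', ⟨ε, δ, n1, n2, e1, e2⟩, hP⟩ := H θ ⟨t0, t1⟩ ξ hξ hn
  obtain ⟨ε', δ', n3, n4, e3, e4⟩ := HK (logHalfSqrt θ ξ)
    (by rw [him, abs_le]; constructor <;> linarith) hq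
  have hbound : ∀ x y : ℂ, ‖x‖ ≤ C * ‖Complex.exp (-logHalfSqrt θ ξ)‖ ^ 2 →
      ‖y‖ ≤ D * ‖Complex.exp (-logHalfSqrt θ ξ)‖ ^ 2 →
      ‖(x + y) / 2‖ ≤ (C + D) * 4 / ‖ξ‖ ∧ ‖(x - y) / 2‖ ≤ (C + D) * 4 / ‖ξ‖ := by
    intro x y hx hy
    rw [norm_exp_neg_logHalfSqrt_sq hξ0] at hx hy
    have h3 : (C + D) * 4 / ‖ξ‖ = C * (4 / ‖ξ‖) + D * (4 / ‖ξ‖) := by ring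
    have h4 := norm_add_le x y
    have h5 := norm_sub_le x y
    have h6 := norm_nonneg (x + y)
    have h7 := norm_nonneg (x - y)
    rw [norm_div, norm_div, Complex.norm_ofNat, h3]
    constructor <;> linarith
  refine ⟨!![(ε + ε') / 2, (ε - ε') / 2; (δ - δ') / 2, (δ + δ') / 2], ?_, ?_⟩
  · intro i j
    fin_cases i <;> fin_cases j
    · exact (hbound _ _ n1 n3).1
    · exact (hbound _ _ n1 n3).2
    · exact (hbound _ _ n2 n4).2
    · exact (hbound _ _ n2 n4).1
  · -- `r = √2` collects the constants.
    set r : ℂ := Complex.exp ((Real.log 2 : ℝ) / 2) with hrdef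
    have hr2 : r ^ 2 = 2 := by
      rw [hrdef, ← Complex.exp_nat_mul, Nat.cast_two, mul_div_cancel₀ _ two_ne_zero, exp_log_two]
    have hr0 : r ≠ 0 := Complex.exp_ne_zero _
    have x1 : Complex.exp (-logHalfSqrt θ ξ / 2) = Complex.exp (-(logBr θ ξ / 4)) * r := by
      rw [hrdef, ← Complex.exp_add, logHalfSqrt]; congr 1; ring
    have x2 : Complex.exp (logHalfSqrt θ ξ / 2) = Complex.exp (logBr θ ξ / 4) / r := by
      rw [hrdef, ← Complex.exp_sub, logHalfSqrt]; congr 1; ring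
    have hpr : ((Real.sqrt (Real.pi / 2) : ℝ) : ℂ) * r = (Real.sqrt Real.pi : ℝ) := by
      have hr' : r = ((Real.sqrt 2 : ℝ) : ℂ) := by
        rw [hrdef, Real.sqrt_eq_rpow, Real.rpow_def_of_pos two_pos]
        push_cast; congr 1; ring
      rw [hr', ← Complex.ofReal_mul, ← Real.sqrt_mul (by positivity),
        div_mul_cancel₀ _ two_ne_zero]
    have hs0 := ofReal_sqrt_pi_ne_zero
    rw [x1, exp_logHalfSqrt, exp_neg_logHalfSqrt] at e1 e3
    rw [x2, exp_logHalfSqrt, exp_neg_logHalfSqrt] at e2 e4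
    have c1 : Complex.I / ((Real.sqrt Real.pi : ℝ) : ℂ) * (Real.sqrt (Real.pi / 2) : ℝ) * r =
        Complex.I := by
      rw [mul_assoc, hpr]; field_simp
    have c2 : Complex.I / ((Real.sqrt Real.pi : ℝ) : ℂ) * (Real.sqrt (Real.pi / 2) : ℝ) / r =
        Complex.I / 2 := by
      rw [div_eq_div_iff hr0 two_ne_zero]
      linear_combination (-(Complex.I / ((Real.sqrt Real.pi : ℝ) : ℂ) *
        (Real.sqrt (Real.pi / 2) : ℝ))) * hr2 + r * c1
    rw [hP, e1, e2, e3, e4, expSigma, expSigma, matT, Psi1, psi1]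
    generalize (sqrtBr θ ξ)⁻¹ = t
    push_cast
    refine matrix_ext_two ?_ ?_ ?_ ?_ <;>
      simp only [Matrix.smul_apply, Matrix.add_apply, smul_eq_mul, Matrix.mul_apply,
        Fin.sum_univ_two, Matrix.one_apply_eq, Matrix.one_apply_ne, ne_eq, zero_ne_one, one_ne_zero,
        not_false_eq_true, neg_neg, Matrix.of_apply, Matrix.cons_val', Matrix.cons_val_zero, Matrix.cons_val_one,
        Matrix.cons_val_fin_one, mul_zero, zero_mul, add_zero, zero_add]
    all_goals
      generalize Complex.I / ((Real.sqrt Real.pi : ℝ) : ℂ) = g,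
        ((Real.sqrt (Real.pi / 2) : ℝ) : ℂ) = p, Complex.exp (-(logBr θ ξ / 4)) = l',
        Complex.exp (logBr θ ξ / 4) = l, Complex.exp (-(sqrtBr θ ξ / 2)) = z',
        Complex.exp (sqrtBr θ ξ / 2) = z at c1 c2 ⊢
    · linear_combination (-Complex.I * l' * z * (1 + (1 - (a : ℂ) ^ 2) / 4 * t + ε) / 2) * c1 -
        (l' * z * (1 + (1 - (a : ℂ) ^ 2) / 4 * t + ε) / 2) * Complex.I_sq
    · linear_combination (-(l' * z' * (1 - (1 - (a : ℂ) ^ 2) / 4 * t + ε') / 2)) * c1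
    · linear_combination (-Complex.I * l * z * (1 + ((1 - (a : ℂ) ^ 2) / 4 - 1) * t + δ)) * c2 -
        (l * z * (1 + ((1 - (a : ℂ) ^ 2) / 4 - 1) * t + δ) / 2) * Complex.I_sq
    · linear_combination (l * z' * (1 - ((1 - (a : ℂ) ^ 2) / 4 - 1) * t + δ')) * c2

/-- The inverse of `T`. -/
def matTInv : Matrix (Fin 2) (Fin 2) ℂ := !![1, 1; Complex.I, -Complex.I]

lemma matT_mul_matTInv : matT * matTInv = 1 := by
  rw [matT, matTInv, Matrix.one_fin_two]
  refine matrix_ext_two ?_ ?_ ?_ ?_ <;>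
    simp only [Matrix.mul_apply, Fin.sum_univ_two,
      Matrix.of_apply, Matrix.cons_val', Matrix.cons_val_zero, Matrix.cons_val_one,
      Matrix.cons_val_fin_one]
  · linear_combination (-1 / 2 : ℂ) * Complex.I_sq
  · linear_combination (1 / 2 : ℂ) * Complex.I_sq
  · linear_combination (1 / 2 : ℂ) * Complex.I_sq
  · linear_combination (-1 / 2 : ℂ) * Complex.I_sq

lemma norm_mul_apply_le {M N : Matrix (Fin 2) (Fin 2) ℂ} {r s : ℝ}
    (hM : ∀ i j, ‖M i j‖ ≤ r) (hN : ∀ i j, ‖N i j‖ ≤ s) (i j : Fin 2) :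
    ‖(M * N) i j‖ ≤ 2 * r * s := by
  have hr : 0 ≤ r := (norm_nonneg _).trans (hM 0 0)
  rw [Matrix.mul_apply, Fin.sum_univ_two]
  refine (norm_add_le _ _).trans ?_
  rw [norm_mul, norm_mul]
  have h1 := mul_le_mul (hM i 0) (hN 0 j) (norm_nonneg _) hr
  have h2 := mul_le_mul (hM i 1) (hN 1 j) (norm_nonneg _) hr
  linarith

/-- The normalization at infinity, which follows from the uniform expansion by moving the
correction to the right of `T`. -/
lemma Psi0_infinity {a θ : ℝ} (h0 : 0 < a) (h1 : a < 2) (hθ : θ ∈ Set.Icc (0 : ℝ) (Real.pi / 2)) :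
    ∃ R : ℂ → Matrix (Fin 2) (Fin 2) ℂ,
      (∀ i j, (fun ξ => R ξ i j) =O[Bornology.cobounded ℂ ⊓ 𝓟 (contour θ)ᶜ]
        (fun ξ => (sqrtBr θ ξ)⁻¹)) ∧
      ∀ᶠ ξ in Bornology.cobounded ℂ ⊓ 𝓟 (contour θ)ᶜ,
        Psi0 a θ ξ = expSigma (-(logBr θ ξ / 4)) * matT * (1 + R ξ) * expSigma (sqrtBr θ ξ / 2) := by
  obtain ⟨K, HK⟩ := Psi0_expansion h0 h1
  have hev : ∀ᶠ ξ in Bornology.cobounded ℂ ⊓ 𝓟 (contour θ)ᶜ, 4 ≤ ‖ξ‖ ∧ ξ ∉ contour θ := by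
    rw [eventually_inf_principal]
    filter_upwards [tendsto_norm_cobounded_atTop.eventually_ge_atTop (4 : ℝ)] with ξ h hξ
    exact ⟨h, hξ⟩
  choose! E hE hP using HK θ hθ
  have hT : ∀ i j, ‖matT i j‖ ≤ 1 := by
    intro i j; fin_cases i <;> fin_cases j <;> simp [matT] <;> norm_num
  have hT' : ∀ i j, ‖matTInv i j‖ ≤ 1 := by
    intro i j; fin_cases i <;> fin_cases j <;> simp [matTInv]
  obtain ⟨M, hM⟩ : ∃ M, ∀ i j, ‖Psi1 a i j‖ ≤ M :=
    ⟨∑ i, ∑ j, ‖Psi1 a i j‖, fun i j =>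
      (Finset.single_le_sum (f := fun j => ‖Psi1 a i j‖) (fun _ _ => norm_nonneg _)
        (Finset.mem_univ j)).trans
      (Finset.single_le_sum (f := fun i => ∑ j, ‖Psi1 a i j‖)
        (fun _ _ => Finset.sum_nonneg fun _ _ => norm_nonneg _) (Finset.mem_univ i))⟩
  refine ⟨fun ξ => matTInv * ((sqrtBr θ ξ)⁻¹ • Psi1 a + E ξ) * matT, fun i j => ?_, ?_⟩
  · refine IsBigO.of_bound (4 * (M + |K|)) ?_
    filter_upwards [hev] with ξ ⟨h4, hξ⟩
    have hξ0 := ne_zero_of_notMem_ray (notMem_ray_zero_of_notMem_contour hξ)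
    have hs := norm_sqrtBr_sq (θ := θ) hξ0
    have hs1 : 1 ≤ ‖sqrtBr θ ξ‖ := by
      rw [← one_le_sq_iff₀ (norm_nonneg _), hs]; linarith
    have hinv : K / ‖ξ‖ ≤ |K| * ‖(sqrtBr θ ξ)⁻¹‖ := by
      rw [norm_inv, ← div_eq_mul_inv]
      have : ‖sqrtBr θ ξ‖ ≤ ‖ξ‖ := by nlinarith
      exact div_le_div₀ (abs_nonneg _) (le_abs_self _) (by linarith) this
    have hS : ∀ i j, ‖((sqrtBr θ ξ)⁻¹ • Psi1 a + E ξ) i j‖ ≤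
        (M + |K|) * ‖(sqrtBr θ ξ)⁻¹‖ := by
      intro i j
      rw [Matrix.add_apply, Matrix.smul_apply, smul_eq_mul]
      refine (norm_add_le _ _).trans ?_
      rw [norm_mul]
      have h2 := mul_le_mul_of_nonneg_left (hM i j) (norm_nonneg (sqrtBr θ ξ)⁻¹)
      have h3 := (hE ξ hξ h4 i j).trans hinv
      linarith
    have := norm_mul_apply_le (norm_mul_apply_le hT' hS) hT i j
    linarith
  · filter_upwards [hev] with ξ ⟨h4, hξ⟩
    have e : matT * (1 + matTInv * ((sqrtBr θ ξ)⁻¹ • Psi1 a + E ξ) * matT) =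
        (1 + (sqrtBr θ ξ)⁻¹ • Psi1 a + E ξ) * matT := by
      rw [mul_add, mul_one, ← mul_assoc, ← mul_assoc, matT_mul_matTInv, one_mul, add_assoc,
        add_mul 1, one_mul]
    rw [hP ξ hξ h4, mul_assoc _ _ matT, ← e, ← mul_assoc]

lemma solvesModelRHP_Psi0 {a θ : ℝ} (h0 : 0 < a) (h1 : a < 2)
    (hθ : θ ∈ Set.Icc (0 : ℝ) (Real.pi / 2)) : SolvesModelRHP a θ (Psi0 a θ) where
  analytic := Psi0_analytic a θ
  jumps k _ hξ hξ0 := Psi0_jumps a θ k hξ hξ0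
  infinity := Psi0_infinity h0 h1 hθ
  zero := by
    have hpi := Real.pi_pos
    refine Psi0_zero ?_ θ
    have hs : 0 < Real.sin (Real.pi * (a / 2)) :=
      Real.sin_pos_of_pos_of_lt_pi (by positivity) (by nlinarith)
    have : Complex.sin (Real.pi * ((a : ℂ) / 2)) = (Real.sin (Real.pi * (a / 2)) : ℝ) := by
      push_cast; rfl
    rw [this]
    exact_mod_cast hs.ne'

end ModelRH

end

theorem mainTheorem7 (a : ℝ) (ha0 : 0 < a) (ha2 : a < 2) :
    (∀ θ ∈ Set.Icc (0 : ℝ) (Real.pi / 2),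
      ModelRH.SolvesModelRHP a θ (ModelRH.Psi0 a θ)) ∧
    ∃ K R₀ : ℝ, 0 < R₀ ∧
      ∀ θ ∈ Set.Icc (0 : ℝ) (Real.pi / 2), ∀ ξ ∉ ModelRH.contour θ, R₀ ≤ ‖ξ‖ →
        ∃ E : Matrix (Fin 2) (Fin 2) ℂ, (∀ i j, ‖E i j‖ ≤ K / ‖ξ‖) ∧
          ModelRH.Psi0 a θ ξ =
            ModelRH.expSigma (-(ModelRH.logBr θ ξ / 4)) *
              (1 + (ModelRH.sqrtBr θ ξ)⁻¹ • ModelRH.Psi1 a + E) * ModelRH.matT *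
              ModelRH.expSigma (ModelRH.sqrtBr θ ξ / 2) := by
  obtain ⟨K, hK⟩ := ModelRH.Psi0_expansion ha0 ha2
  exact ⟨fun θ hθ => ModelRH.solvesModelRHP_Psi0 ha0 ha2 hθ, K, 4, by norm_num, hK⟩
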